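/- Let $n\ge 1$ and let $\mathbb H^n=\mathbb R^n\times\mathbb R^n\times\mathbb R$ be the Heisenberg group with group law $(x,y,t)\circ(x',y',t')=(x+x',y+y',t+t'+\tfrac12(x\cdot y'-x'\cdot y))$, left-invariant fields $X_j=\partial_{x_j}-\tfrac{y_j}{2}\partial_t$, $X_{n+j}=\partial_{y_j}+\tfrac{x_j}{2}\partial_t$ $(1\le j\le n)$, $T=\partial_t$, Haar (Lebesgue) measure $dg$, and the left-invariant Riemannian metric for which $X_1,\dots,X_{2n},T$ is orthonormal. For a function $u$ put $|\nabla_H u|^2=\sum_i (X_iu)^2$, $\Delta_H u=\sum_i X_i^2u$, let $\nabla_H^2u$ be the symmetrized horizontal Hessian with entries $u_{,ij}=\tfrac12(X_iX_ju+X_jX_iu)$, and $\|\nabla_H^2u\|$ its Hilbert-Schmidt norm. Let $\Omega\subset\mathbb H^n$ be a bounded open set of class $C^2$, with Riemannian outer unit normal $\boldsymbol\nu$ and Riemannian surface measure $\sigma$ on $\partial\Omega$. Put $N^H=\sum_j\langle\boldsymbol\nu,X_j\rangle X_j$, $W=|N^H|$, $\Sigma=\{g\in\partial\Omega: W(g)=0\}$,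 $\nu^H=N^H/W$ on $\partial\Omega\setminus\Sigma$, and $d\sigma_H=W\,d\sigma$. The horizontal mean curvature of $\partial\Omega$ on $\partial\Omega\setminus\Sigma$ is $\mathcal H=-\sum_{a=1}^{2n-1}\langle\nabla^H_{e_a}e_a,\nu^H\rangle$, where $e_1,\dots,e_{2n-1}$ is a local orthonormal $C^1$ frame of the horizontal tangent bundle $T\partial\Omega\cap H\mathbb H^n$ and $\nabla^H$ is the horizontal Levi-Civita connection, $\nabla^H_v(\sum_k\zeta_kX_k)=\sum_k(v\zeta_k)X_k$; at a point of $\Sigma$ it is defined as the limit of $\mathcal H$ from $\partial\Omega\setminus\Sigma$, if that exists (note that $\sigma_H(\Sigma)=0$). Let $u\in\Gamma^3(\overline\Omega)\cap C^2(\overline\Omega)$; that is, $u\in C(\overline\Omega)$, $u$ is $C^2$ in $\Omega$, and all its partial derivatives of order at most $2$, as well as all horizontal derivatives $X_{j_1}\cdots X_{j_s}u$ with $s\le3$, exist in $\Omega$ and extend continuously to $\overline\Omega$. Suppose $u\le0$ in $\Omega$ and $u=0$ on $\partial\Omega$. Then all the integrals below exist and $$\int_\Omega(\Delta_Hu)^2\,dg-\int_\Omega\|\nabla_H^2u\|^2\,dg+\frac32\,n\int_\Omega(Tu)^2\,dg=\int_{\partial\Omega}\mathcal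 H\,|\nabla_Hu|^2\,d\sigma_H .$$ Consequently, if $\mathcal H\ge0$ on $\partial\Omega\setminus\Sigma$, then $$\int_\Omega\|\nabla_H^2u\|^2\,dg\le\int_\Omega(\Delta_Hu)^2\,dg+\frac32\,n\int_\Omega(Tu)^2\,dg .$$ When $n=1$ the identity becomes $$\int_\Omega\det(\nabla_H^2u)\,dg+\frac34\int_\Omega(Tu)^2\,dg=\frac12\int_{\partial\Omega}\mathcal H\,|\nabla_Hu|^2\,d\sigma_H .$$ If instead $u\in C_0^\infty(\Omega)$ (with no condition on the sign of $u$ or of $\mathcal H$), then $$\int_\Omega\|\nabla_H^2u\|^2\,dg=\int_\Omega(\Delta_Hu)^2\,dg+\frac32\,n\int_\Omega(Tu)^2\,dg .$$ -/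

import Mathlib

open MeasureTheory Topology

noncomputable section

namespace Heisenberg

/-- The underlying manifold of the Heisenberg group `ℍⁿ`: points `g = (x, y, t)` with
`x, y ∈ ℝⁿ` and `t ∈ ℝ`. The measure `volume` on it is Lebesgue measure, which is the
(bi-invariant) Haar measure `dg`. -/
abbrev Heis (n : ℕ) : Type := (Fin n → ℝ) × (Fin n → ℝ) × ℝ

variable {n : ℕ}

/-- The group law `(x,y,t) ∘ (x',y',t') = (x+x', y+y', t+t' + (x·y' - x'·y)/2)`. -/
def op (g h : Heis n) : Heis n :=
  (g.1 + h.1, g.2.1 + h.2.1,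
    g.2.2 + h.2.2 + (1 / 2) * (∑ j, g.1 j * h.2.1 j - ∑ j, h.1 j * g.2.1 j))

/-- Indices of the horizontal frame: `Sum.inl j` stands for `j` and `Sum.inr j` for `n + j`. -/
abbrev HIdx (n : ℕ) : Type := Fin n ⊕ Fin n

/-- The horizontal left-invariant frame
`X_j = ∂_{x_j} - (y_j/2) ∂_t` and `X_{n+j} = ∂_{y_j} + (x_j/2) ∂_t`. -/
def X (i : HIdx n) (g : Heis n) : Heis n :=
  match i with
  | Sum.inl j => (Pi.single j 1, 0, -(g.2.1 j) / 2)
  | Sum.inr j => (0, Pi.single j 1, g.1 j / 2)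

/-- The vertical field `T = ∂_t`. -/
def T (_g : Heis n) : Heis n := (0, 0, 1)

/-- Right multiplication by the one-parameter group generated by `X_i(0)` moves `g` along the
straight line with direction `X_i(g)`: the integral curves of `X_i` are straight lines. -/
theorem op_smul_X (i : HIdx n) (g : Heis n) (s : ℝ) : op g (s • X i 0) = g + s • X i g := by
  cases i <;> ext <;> simp [op, X, Pi.single_apply] <;> ring

/-- The derivative `X_i f` of a function along the left-invariant field `X_i`: by `op_smul_X` it is
`d/ds f(g ∘ exp(s X_i))` at `s = 0`. -/
def XD (i : HIdx n) (f : Heis n → ℝ) (g : Heis n) : ℝ := lineDeriv ℝ f g (X i g)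

/-- The derivative `T f`. -/
def TD (f : Heis n → ℝ) (g : Heis n) : ℝ := lineDeriv ℝ f g (T g)

/-- The symmetrized horizontal Hessian `u_{,ij} = (X_i X_j u + X_j X_i u) / 2`. -/
def hessH (u : Heis n → ℝ) (g : Heis n) : Matrix (HIdx n) (HIdx n) ℝ :=
  Matrix.of fun i j => (XD i (XD j u) g + XD j (XD i u) g) / 2

/-- The square of the Hilbert-Schmidt norm of the symmetrized horizontal Hessian. -/
def hessHNormSq (u : Heis n → ℝ) (g : Heis n) : ℝ := ∑ i, ∑ j, (hessH u g i j) ^ 2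

/-- The horizontal Laplacian `Δ_H u = ∑ X_i X_i u`. -/
def lapH (u : Heis n → ℝ) (g : Heis n) : ℝ := ∑ i, XD i (XD i u) g

/-! ### Function classes up to the boundary -/

/-- `f`, considered on `Ω`, has a continuous extension to `closure Ω`. -/
def ExtendsContinuously {F : Type*} [TopologicalSpace F] (Ω : Set (Heis n)) (f : Heis n → F) :
    Prop :=
  ∃ v : Heis n → F, ContinuousOn v (closure Ω) ∧ Set.EqOn f v Ω

/-- All horizontal derivatives `X_{j_1} ⋯ X_{j_s} f`, `0 ≤ s ≤ k`, exist in `Ω` and extend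
continuously to `closure Ω`. -/
def HorizontalDerivsExtend (Ω : Set (Heis n)) : ℕ → (Heis n → ℝ) → Prop
  | 0, f => ExtendsContinuously Ω f
  | k + 1, f => ExtendsContinuously Ω f ∧
      ∀ i : HIdx n, (∀ g ∈ Ω, LineDifferentiableAt ℝ f g (X i g)) ∧
        HorizontalDerivsExtend Ω k (XD i f)

/-- The Folland-Stein class `Γ^k(closure Ω)`. -/
def MemGamma (Ω : Set (Heis n)) (k : ℕ) (u : Heis n → ℝ) : Prop :=
  ContinuousOn u (closure Ω) ∧ HorizontalDerivsExtend Ω k u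

/-- The class `C²(closure Ω)`: `u` is `C²` in `Ω`, continuous on `closure Ω`, and its derivatives
up to order two extend continuously to `closure Ω`. -/
def MemC2Closure (Ω : Set (Heis n)) (u : Heis n → ℝ) : Prop :=
  ContinuousOn u (closure Ω) ∧ ContDiffOn ℝ 2 u Ω ∧
    ∀ k : ℕ, k ≤ 2 → ExtendsContinuously Ω (iteratedFDeriv ℝ k u)

/-- `|∇_H u|²` on `closure Ω`; at boundary points `X_i u` is the limit from inside `Ω`. -/
def gradHNormSq (Ω : Set (Heis n)) (u : Heis n → ℝ) (g : Heis n) : ℝ :=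
  ∑ i, (extendFrom Ω (XD i u) g) ^ 2

/-! ### The left-invariant Riemannian metric and the geometry of the boundary -/

/-- The contact form dual to `T`: it vanishes on every `X_i` and is `1` on `T`. -/
def contact (g v : Heis n) : ℝ :=
  v.2.2 + (1 / 2) * (∑ j, g.2.1 j * v.1 j - ∑ j, g.1 j * v.2.1 j)

/-- The left-invariant Riemannian metric at `g` for which `X_1, …, X_{2n}, T` is orthonormal. -/
def metric (g v w : Heis n) : ℝ :=
  ∑ j, v.1 j * w.1 j + ∑ j, v.2.1 j * w.2.1 j + contact g v * contact g w

/-- The Riemannian gradient `∑ (X_i φ) X_i + (T φ) T`. -/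
def riemGrad (φ : Heis n → ℝ) (g : Heis n) : Heis n :=
  ∑ i, (fderiv ℝ φ g (X i g)) • X i g + (fderiv ℝ φ g (T g)) • T g

/-- `φ` is a local `C²` defining function for `Ω` at `p`: near `p` one has `Ω = {φ < 0}`, and the
differential of `φ` at `p` does not vanish. -/
def IsLocalDefining (Ω : Set (Heis n)) (p : Heis n) (φ : Heis n → ℝ) : Prop :=
  ContDiffAt ℝ 2 φ p ∧ fderiv ℝ φ p ≠ 0 ∧ ∀ᶠ g in 𝓝 p, (g ∈ Ω ↔ φ g < 0)

/-- `C²` open sets. -/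
def IsC2Open (Ω : Set (Heis n)) : Prop :=
  IsOpen Ω ∧ ∀ p ∈ frontier Ω, ∃ φ, IsLocalDefining Ω p φ

open Classical in
/-- The Riemannian outer unit normal `∇φ / |∇φ|` at a boundary point (it does not depend on the
local defining function `φ`). -/
def outerNormal (Ω : Set (Heis n)) (p : Heis n) : Heis n :=
  if h : p ∈ frontier Ω ∧ ∃ φ, IsLocalDefining Ω p φ then
    (Real.sqrt (metric p (riemGrad h.2.choose p) (riemGrad h.2.choose p)))⁻¹ •
      riemGrad h.2.choose p
  else 0

/-- The components `⟨ν, X_j⟩` of the outer horizontal normal `N^H`. -/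
def NH (Ω : Set (Heis n)) (p : Heis n) (j : HIdx n) : ℝ := metric p (outerNormal Ω p) (X j p)

/-- The angle function `W = |N^H|`. -/
def angle (Ω : Set (Heis n)) (p : Heis n) : ℝ := Real.sqrt (∑ j, (NH Ω p j) ^ 2)

/-- The characteristic set of the boundary: the points where `W` vanishes. -/
def charSet (Ω : Set (Heis n)) : Set (Heis n) := {p ∈ frontier Ω | angle Ω p = 0}

/-- The components of the horizontal Gauss map `ν^H = N^H / |N^H|`. -/
def nuH (Ω : Set (Heis n)) (p : Heis n) (j : HIdx n) : ℝ := NH Ω p j / angle Ω p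

/-- The horizontal fields `e_a = ∑_k (e_a)^k X_k`, `1 ≤ a ≤ 2n - 1`, are `C¹` near `p` and form, at
all boundary points near `p`, an orthonormal basis of the horizontal tangent space
`T ∂Ω ∩ H`, the set of horizontal vectors orthogonal to `ν`. -/
def IsHorizontalTangentFrame (Ω : Set (Heis n)) (p : Heis n)
    (e : Fin (2 * n - 1) → Heis n → HIdx n → ℝ) : Prop :=
  (∀ a, ContDiffAt ℝ 1 (e a) p) ∧
    ∀ᶠ g in 𝓝[frontier Ω] p,
      (∀ a b, ∑ k, e a g k * e b g k = if a = b then 1 else 0) ∧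
      (∀ a, ∑ k, e a g k * NH Ω g k = 0)

/-- The components of `∇^H_v ζ` at `p`, where `v = ∑ v^j X_j` and `ζ = ∑ ζ^k X_k`. The horizontal
Levi-Civita connection of `ℍⁿ` is flat in the frame `X_k`:
`∇^H_v ζ = ∑_k (∑_j v^j X_j ζ^k) X_k`. -/
def nablaH (v : HIdx n → ℝ) (ζ : Heis n → HIdx n → ℝ) (p : Heis n) (k : HIdx n) : ℝ :=
  ∑ j, v j * XD j (fun g => ζ g k) p

open Classical in
/-- The horizontal mean curvature at a non-characteristic boundary point,
`-∑_a ⟨∇^H_{e_a} e_a, ν^H⟩` for an orthonormal frame `e_a` of the horizontal tangent bundle.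
It does not depend on the frame; the sign is the one for which the curvature is the horizontal
divergence of the outer horizontal Gauss map. -/
def meanCurvNonchar (Ω : Set (Heis n)) (p : Heis n) : ℝ :=
  if h : ∃ e, IsHorizontalTangentFrame Ω p e then
    -∑ a, ∑ k, nablaH (h.choose a p) (h.choose a) p k * nuH Ω p k
  else 0

open Classical in
/-- The horizontal mean curvature of the boundary; at a characteristic point it is the limit of
the values at non-characteristic points (a meaningless value if there is no limit). -/
def meanCurv (Ω : Set (Heis n)) (p : Heis n) : ℝ :=
  if p ∈ charSet Ω then Filter.limUnder (𝓝[frontier Ω \ charSet Ω] p) (meanCurvNonchar Ω)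
  else meanCurvNonchar Ω p

/-- `ψ` is a regular (injective, `C¹`, immersive) parametrization, defined on the open set
`V ⊆ ℝ^{2n}`, of a piece of the hypersurface `S`. -/
structure IsRegularParam (S : Set (Heis n)) (V : Set (Fin (2 * n) → ℝ))
    (ψ : (Fin (2 * n) → ℝ) → Heis n) : Prop where
  isOpen : IsOpen V
  contDiffOn : ContDiffOn ℝ 1 ψ V
  injOn : Set.InjOn ψ V
  immersion : ∀ v ∈ V, Function.Injective (fderiv ℝ ψ v)
  mapsTo : Set.MapsTo ψ V S

/-- The Riemannian area element `√ det ⟨∂_a ψ, ∂_b ψ⟩` of a parametrization. -/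
def areaElement (ψ : (Fin (2 * n) → ℝ) → Heis n) (v : Fin (2 * n) → ℝ) : ℝ :=
  Real.sqrt (Matrix.det (Matrix.of fun a b : Fin (2 * n) =>
    metric (ψ v) (fderiv ℝ ψ v (Pi.single a 1)) (fderiv ℝ ψ v (Pi.single b 1))))

/-- The Riemannian area measure of a parametrized piece: the image under `ψ` of
`√ det ⟨∂_a ψ, ∂_b ψ⟩ dv` on `V`. -/
def pieceMeasure (V : Set (Fin (2 * n) → ℝ)) (ψ : (Fin (2 * n) → ℝ) → Heis n) :
    Measure (Heis n) :=
  Measure.map ψ ((volume.restrict V).withDensity fun v => ENNReal.ofReal (areaElement ψ v))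

/-- The Riemannian surface measure `σ` of a hypersurface `S`: the least measure that dominates the
area measure of every regularly parametrized piece. Area measures of two pieces agree on
the overlap, so `σ` restricted to a piece is the area measure of that piece. -/
def surfaceMeasure (S : Set (Heis n)) : Measure (Heis n) :=
  ⨆ P : {P : Set (Fin (2 * n) → ℝ) × ((Fin (2 * n) → ℝ) → Heis n) // IsRegularParam S P.1 P.2},
    pieceMeasure P.1.1 P.1.2

/-- The horizontal perimeter measure `dσ_H = W dσ` on the boundary of `Ω`. -/
def perimeterMeasure (Ω : Set (Heis n)) : Measure (Heis n) :=
  (surfaceMeasure (frontier Ω)).withDensity fun g => ENNReal.ofReal (angle Ω g)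

end Heisenberg

end

open Heisenberg

open Heisenberg

noncomputable section



namespace Heisenberg

variable {n : ℕ}

/-! ### The horizontal frame and its commutators -/

/-! The identity is the divergence theorem for the horizontal field `V_j = X_j u Δ_H u - Σ_i X_i u
X_i X_j u - Σ_i c_ij X_i u T u`, where `[X_i, X_j] = c_ij T`. In `Σ_j X_j V_j` all third derivatives
cancel: commuting `X_j` past `X_i` in `X_j X_i X_j u` leaves a term `c_ij T X_j u`, which the last
summand of `V` removes because `T` commutes with the frame. What remains is `(Δ_H u)² - Σ (X_i X_j
u)² + 2n (T u)²`, as `Σ c_ij² = 2n`. Symmetrizing the Hessian lowers `Σ (X_i X_j u)²` by `(n/2) (T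
u)²`, whence the constant `2n - n/2 = 3n/2` (`div_fieldV`).

On the boundary `u = 0` forces `∇_H u = c N^H`. The commutator part of `V · N^H` vanishes by
antisymmetry, and the rest is `c W²` times the trace of `X_j X_k u` over the horizontal tangent
space. Differentiating `e_a u = 0` along `e_a` turns this trace into `c W 𝓗`, so `V · N^H = 𝓗 |∇_H
u|² W` (`sum_jV_mul_NH`). At characteristic points both sides are zero.

The divergence of `V` involves third derivatives, but its value is a polynomial expression in the
second order jet. Hence the identity, tested against `φ`, passes from smooth functions to `C²`
functions by mollification (`integral_weakIntegrand`). The field `V` is then merely continuous on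
the closure and has a continuous weak divergence, so a divergence theorem for such fields on `C²`
domains is needed (`divergence_theorem`). It is proved with a partition of unity, charts that
flatten the boundary, and cutoffs whose gradients concentrate on the boundary.
`surfaceMeasure_restrict_source` identifies the surface measure in a chart, and
`FlatChart.areaElement_chartParam` computes its density. For compactly supported `u` there is no
boundary term, and a cutoff equal to one near the support suffices (`integral_jQ_eq_zero`). -/

/-- The structure constants of the frame: `[X_i, X_j] = comm i j • T`. -/
def comm : HIdx n → HIdx n → ℝ
  | Sum.inl a, Sum.inr b => if a = b then 1 else 0
  | Sum.inr a, Sum.inl b => if a = b then -1 else 0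
  | _, _ => 0

theorem comm_swap (i j : HIdx n) : comm j i = -comm i j := by
  rcases i with i | i <;> rcases j with j | j <;> simp [comm, eq_comm] <;> split_ifs <;> simp

theorem sum_comm_sq : ∑ i : HIdx n, ∑ j : HIdx n, comm i j ^ 2 = 2 * (n : ℝ) := by
  simp [comm, Fintype.sum_sum_type, Finset.sum_add_distrib, ite_pow]
  ring

/-- The embedding of the vertical direction. -/
def vert : ℝ →L[ℝ] Heis n :=
  (ContinuousLinearMap.inr ℝ (Fin n → ℝ) ((Fin n → ℝ) × ℝ)).comp
    (ContinuousLinearMap.inr ℝ (Fin n → ℝ) ℝ)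

@[simp] theorem vert_apply (s : ℝ) : (vert s : Heis n) = (0, 0, s) := rfl

/-- The linear part of the affine vector field `X_i`. -/
def XL : HIdx n → Heis n →L[ℝ] Heis n
  | Sum.inl j => vert.comp ((-(1 / 2) : ℝ) • (ContinuousLinearMap.proj j).comp
      ((ContinuousLinearMap.fst ℝ (Fin n → ℝ) ℝ).comp
        (ContinuousLinearMap.snd ℝ (Fin n → ℝ) ((Fin n → ℝ) × ℝ))))
  | Sum.inr j => vert.comp ((1 / 2 : ℝ) • (ContinuousLinearMap.proj j).comp
      (ContinuousLinearMap.fst ℝ (Fin n → ℝ) ((Fin n → ℝ) × ℝ)))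

theorem X_eq (i : HIdx n) (g : Heis n) : X i g = X i 0 + XL i g := by
  rcases i with j | j <;> simp [X, XL] <;> ring

theorem hasFDerivAt_X (i : HIdx n) (g : Heis n) : HasFDerivAt (X i) (XL i) g := by
  have h : (X i : Heis n → Heis n) = fun g => X i 0 + XL i g := funext (X_eq i)
  rw [h]
  exact (XL i).hasFDerivAt.const_add _

theorem contDiff_X {k : WithTop ℕ∞} (i : HIdx n) : ContDiff ℝ k (X i : Heis n → Heis n) := by
  have h : (X i : Heis n → Heis n) = fun g => X i 0 + XL i g := funext (X_eq i)
  rw [h]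
  exact contDiff_const.add (XL i).contDiff

theorem continuous_X (i : HIdx n) : Continuous (X i : Heis n → Heis n) :=
  (contDiff_X (k := 0) i).continuous

/-- The fields are affine, so their Lie bracket is obtained by applying the linear part of each to
the other. This is the only source of the vertical derivative in the argument. -/
theorem XL_X_sub (i j : HIdx n) (g : Heis n) :
    XL j (X i g) - XL i (X j g) = comm i j • T g := by
  rcases i with i | i <;> rcases j with j | j <;>
    simp [X, XL, T, comm, Pi.single_apply, eq_comm] <;> split_ifs <;>
    norm_num <;> rfl

theorem XL_T (i : HIdx n) (g : Heis n) : XL i (T g) = 0 := by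
  rcases i with i | i <;> simp [XL, T]

theorem XD_eq {u : Heis n → ℝ} {g : Heis n} (h : DifferentiableAt ℝ u g) (i : HIdx n) :
    XD i u g = fderiv ℝ u g (X i g) := h.lineDeriv_eq_fderiv

theorem TD_eq {u : Heis n → ℝ} {g : Heis n} (h : DifferentiableAt ℝ u g) :
    TD u g = fderiv ℝ u g (T g) := h.lineDeriv_eq_fderiv

/-! ### Second order jets -/

/-- A point together with a first and a second derivative. -/
abbrev Jet (n : ℕ) : Type := Heis n × (Heis n →L[ℝ] ℝ) × (Heis n →L[ℝ] Heis n →L[ℝ] ℝ)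

/-- The second order jet of a function. -/
def jet (u : Heis n → ℝ) (g : Heis n) : Jet n := (g, fderiv ℝ u g, fderiv ℝ (fderiv ℝ u) g)

/-- The horizontal derivative `X_i u` in terms of the jet. -/
def jU (z : Jet n) (i : HIdx n) : ℝ := z.2.1 (X i z.1)

/-- The derivative `X_i X_j u` in terms of the jet. -/
def jH (z : Jet n) (i j : HIdx n) : ℝ := z.2.2 (X i z.1) (X j z.1) + z.2.1 (XL j (X i z.1))

/-- The derivative `T u` in terms of the jet. -/
def jT (z : Jet n) : ℝ := z.2.1 (T z.1)

/-- The integrand `(Δ_H u)² - ‖∇_H² u‖² + (3/2) n (T u)²`. -/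
def jQ (z : Jet n) : ℝ :=
  (∑ i, jH z i i) ^ 2 - ∑ i, ∑ j, ((jH z i j + jH z j i) / 2) ^ 2 + 3 / 2 * (n : ℝ) * jT z ^ 2

/-- The horizontal vector field whose divergence is `jQ`. -/
def jV (z : Jet n) (j : HIdx n) : ℝ :=
  jU z j * (∑ i, jH z i i) - ∑ i, jU z i * jH z i j - ∑ i, comm i j * jU z i * jT z

@[fun_prop]
theorem continuous_jU (i : HIdx n) : Continuous fun z : Jet n => jU z i := by
  unfold jU
  exact (continuous_fst.comp continuous_snd).clm_apply ((continuous_X i).comp continuous_fst)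

@[fun_prop]
theorem continuous_jH (i j : HIdx n) : Continuous fun z : Jet n => jH z i j := by
  have hi := (continuous_X i).comp (continuous_fst (X := Heis n)
    (Y := (Heis n →L[ℝ] ℝ) × (Heis n →L[ℝ] Heis n →L[ℝ] ℝ)))
  have hj := (continuous_X j).comp (continuous_fst (X := Heis n)
    (Y := (Heis n →L[ℝ] ℝ) × (Heis n →L[ℝ] Heis n →L[ℝ] ℝ)))
  unfold jH
  exact (((continuous_snd.comp continuous_snd).clm_apply hi).clm_apply hj).add
    ((continuous_fst.comp continuous_snd).clm_apply ((XL j).continuous.comp hi))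

@[fun_prop]
theorem continuous_jT : Continuous (jT : Jet n → ℝ) := by
  unfold jT T
  exact (continuous_fst.comp continuous_snd).clm_apply continuous_const

theorem continuous_jQ : Continuous (jQ : Jet n → ℝ) := by
  unfold jQ
  exact (((continuous_finsetSum _ fun i _ => continuous_jH i i).pow 2).sub
    (continuous_finsetSum _ fun i _ => continuous_finsetSum _ fun j _ =>
      (((continuous_jH i j).add (continuous_jH j i)).div_const 2).pow 2)).add
    (continuous_const.mul (continuous_jT.pow 2))

theorem continuous_jV (j : HIdx n) : Continuous fun z : Jet n => jV z j := by
  unfold jV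
  exact (((continuous_jU j).mul (continuous_finsetSum _ fun i _ => continuous_jH i i)).sub
    (continuous_finsetSum _ fun i _ => (continuous_jU i).mul (continuous_jH i j))).sub
    (continuous_finsetSum _ fun i _ => (continuous_const.mul (continuous_jU i)).mul continuous_jT)

theorem eventually_XD_eq {u : Heis n → ℝ} {g : Heis n} (h : ContDiffAt ℝ 2 u g) (j : HIdx n) :
    XD j u =ᶠ[𝓝 g] fun g' => fderiv ℝ u g' (X j g') := by
  filter_upwards [h.eventually (by simp)] with g' hg'
  exact XD_eq (hg'.differentiableAt (by simp)) j

theorem hasFDerivAt_fderiv {u : Heis n → ℝ} {g : Heis n} (h : ContDiffAt ℝ 2 u g) :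
    HasFDerivAt (fderiv ℝ u) (fderiv ℝ (fderiv ℝ u) g) g :=
  ((h.fderiv_right (m := 1) (by norm_num)).differentiableAt (by simp)).hasFDerivAt

theorem XD_XD_eq {u : Heis n → ℝ} {g : Heis n} (h : ContDiffAt ℝ 2 u g) (i j : HIdx n) :
    XD i (XD j u) g = jH (jet u g) i j := by
  have hd := ((hasFDerivAt_fderiv h).clm_apply (hasFDerivAt_X j g)).congr_of_eventuallyEq
    (eventually_XD_eq h j)
  rw [XD_eq hd.differentiableAt, hd.fderiv]
  simp [jH, jet, add_comm]

theorem XD_TD_eq {u : Heis n → ℝ} {g : Heis n} (h : ContDiffAt ℝ 2 u g) (i : HIdx n) :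
    XD i (TD u) g = fderiv ℝ (fderiv ℝ u) g (X i g) (T g) := by
  have he : TD u =ᶠ[𝓝 g] fun g' => fderiv ℝ u g' (T g) := by
    filter_upwards [h.eventually (by simp)] with g' hg'
    exact TD_eq (hg'.differentiableAt (by simp))
  have hd := ((hasFDerivAt_fderiv h).clm_apply (hasFDerivAt_const (T g) g)).congr_of_eventuallyEq he
  rw [XD_eq hd.differentiableAt, hd.fderiv]
  simp

theorem TD_XD_eq {u : Heis n → ℝ} {g : Heis n} (h : ContDiffAt ℝ 2 u g) (j : HIdx n) :
    TD (XD j u) g = fderiv ℝ (fderiv ℝ u) g (T g) (X j g) := by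
  have hd := ((hasFDerivAt_fderiv h).clm_apply (hasFDerivAt_X j g)).congr_of_eventuallyEq
    (eventually_XD_eq h j)
  rw [TD_eq hd.differentiableAt, hd.fderiv]
  simp [XL_T]

theorem isSymm_second {u : Heis n → ℝ} {g : Heis n} (h : ContDiffAt ℝ 2 u g) (v w : Heis n) :
    fderiv ℝ (fderiv ℝ u) g v w = fderiv ℝ (fderiv ℝ u) g w v :=
  (h.isSymmSndFDerivAt (by simp)).eq v w

theorem XD_commutator {u : Heis n → ℝ} {g : Heis n} (h : ContDiffAt ℝ 2 u g) (i j : HIdx n) :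
    XD i (XD j u) g - XD j (XD i u) g = comm i j * TD u g := by
  rw [XD_XD_eq h, XD_XD_eq h, TD_eq (h.differentiableAt (by simp))]
  simp only [jH, jet]
  rw [isSymm_second h (X j g) (X i g)]
  have := congrArg (fderiv ℝ u g) (XL_X_sub i j g)
  simp only [map_sub, map_smul, smul_eq_mul] at this
  linarith

theorem XD_TD_comm {u : Heis n → ℝ} {g : Heis n} (h : ContDiffAt ℝ 2 u g) (i : HIdx n) :
    XD i (TD u) g = TD (XD i u) g := by
  rw [XD_TD_eq h, TD_XD_eq h, isSymm_second h]

theorem jet_relations {u : Heis n → ℝ} {g : Heis n} (h : ContDiffAt ℝ 2 u g) :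
    (∀ i, XD i u g = jU (jet u g) i) ∧ (∀ i j, XD i (XD j u) g = jH (jet u g) i j) ∧
      TD u g = jT (jet u g) :=
  ⟨fun i => XD_eq (h.differentiableAt (by simp)) i, XD_XD_eq h,
    TD_eq (h.differentiableAt (by simp))⟩

theorem lapH_eq {u : Heis n → ℝ} {g : Heis n} (h : ContDiffAt ℝ 2 u g) :
    lapH u g = ∑ i, jH (jet u g) i i := by
  simp [lapH, (jet_relations h).2.1]

theorem hessHNormSq_eq {u : Heis n → ℝ} {g : Heis n} (h : ContDiffAt ℝ 2 u g) :
    hessHNormSq u g = ∑ i, ∑ j, ((jH (jet u g) i j + jH (jet u g) j i) / 2) ^ 2 := by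
  simp [hessHNormSq, hessH, (jet_relations h).2.1]

theorem jQ_jet {u : Heis n → ℝ} {g : Heis n} (h : ContDiffAt ℝ 2 u g) :
    lapH u g ^ 2 - hessHNormSq u g + 3 / 2 * (n : ℝ) * TD u g ^ 2 = jQ (jet u g) := by
  simp [jQ, lapH_eq h, hessHNormSq_eq h, (jet_relations h).2.2]

/-! ### The divergence identity for smooth functions -/

theorem contDiff_XD {u : Heis n → ℝ} (h : ContDiff ℝ (⊤ : ℕ∞) u) (i : HIdx n) :
    ContDiff ℝ (⊤ : ℕ∞) (XD i u) := by
  have : XD i u = fun g => fderiv ℝ u g (X i g) :=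
    funext fun g => XD_eq (h.differentiable (by simp) g) i
  rw [this]
  exact (h.fderiv_right (m := (⊤ : ℕ∞)) (by simp)).clm_apply (contDiff_X i)

theorem contDiff_TD {u : Heis n → ℝ} (h : ContDiff ℝ (⊤ : ℕ∞) u) :
    ContDiff ℝ (⊤ : ℕ∞) (TD u) := by
  have : TD u = fun g => fderiv ℝ u g (T g) :=
    funext fun g => TD_eq (h.differentiable (by simp) g)
  rw [this]
  exact (h.fderiv_right (m := (⊤ : ℕ∞)) (by simp)).clm_apply contDiff_const

theorem XD_mul {f k : Heis n → ℝ} {g : Heis n} (hf : DifferentiableAt ℝ f g)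
    (hk : DifferentiableAt ℝ k g) (i : HIdx n) :
    XD i (fun g => f g * k g) g = f g * XD i k g + k g * XD i f g := by
  rw [XD_eq (hf.fun_mul hk), XD_eq hf, XD_eq hk, fderiv_fun_mul hf hk]
  simp

theorem XD_const_mul {f : Heis n → ℝ} {g : Heis n} (hf : DifferentiableAt ℝ f g) (c : ℝ)
    (i : HIdx n) : XD i (fun g => c * f g) g = c * XD i f g := by
  rw [XD_eq (hf.const_mul c), XD_eq hf, fderiv_const_mul hf]
  simp

theorem XD_sub {f k : Heis n → ℝ} {g : Heis n} (hf : DifferentiableAt ℝ f g)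
    (hk : DifferentiableAt ℝ k g) (i : HIdx n) :
    XD i (fun g => f g - k g) g = XD i f g - XD i k g := by
  rw [XD_eq (hf.fun_sub hk), XD_eq hf, XD_eq hk, fderiv_fun_sub hf hk]
  simp

theorem XD_sum {ι : Type*} [Fintype ι] {f : ι → Heis n → ℝ} {g : Heis n}
    (hf : ∀ a, DifferentiableAt ℝ (f a) g) (i : HIdx n) :
    XD i (fun g => ∑ a, f a g) g = ∑ a, XD i (f a) g := by
  rw [XD_eq (DifferentiableAt.fun_sum fun a _ => hf a), fderiv_fun_sum fun a _ => hf a]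
  simp [XD_eq (hf _)]

/-- The horizontal vector field
`(Δ_H u) X_j u - ∑ X_i u X_i X_j u - ∑ comm i j X_i u T u`. -/
def fieldV (u : Heis n → ℝ) (j : HIdx n) (g : Heis n) : ℝ :=
  XD j u g * (∑ i, XD i (XD i u) g) - ∑ i, XD i u g * XD i (XD j u) g
    - ∑ i, comm i j * (XD i u g * TD u g)

theorem fieldV_eq_jV {u : Heis n → ℝ} {g : Heis n} (h : ContDiffAt ℝ 2 u g) (j : HIdx n) :
    fieldV u j g = jV (jet u g) j := by
  simp [fieldV, jV, jet_relations h, mul_assoc]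

theorem contDiff_fieldV {u : Heis n → ℝ} (h : ContDiff ℝ (⊤ : ℕ∞) u) (j : HIdx n) :
    ContDiff ℝ (⊤ : ℕ∞) (fieldV u j) := by
  have h1 := contDiff_XD h
  have h2 := fun i j => contDiff_XD (h1 j) i
  have h3 := contDiff_TD h
  unfold fieldV
  exact (((h1 j).mul (ContDiff.sum fun i _ => h2 i i)).sub
    (ContDiff.sum fun i _ => (h1 i).mul (h2 i j))).sub
    (ContDiff.sum fun i _ => contDiff_const.mul ((h1 i).mul h3))

theorem XD_fieldV {u : Heis n → ℝ} (h : ContDiff ℝ (⊤ : ℕ∞) u) (j : HIdx n) (g : Heis n) :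
    XD j (fieldV u j) g =
      XD j u g * (∑ i, XD j (XD i (XD i u)) g) + (∑ i, XD i (XD i u) g) * XD j (XD j u) g
        - ∑ i, (XD i u g * XD j (XD i (XD j u)) g + XD i (XD j u) g * XD j (XD i u) g)
        - ∑ i, comm i j * (XD i u g * XD j (TD u) g + TD u g * XD j (XD i u) g) := by
  have hd : ∀ {f : Heis n → ℝ}, ContDiff ℝ (⊤ : ℕ∞) f → ∀ g, DifferentiableAt ℝ f g :=
    fun hf g => hf.differentiable (by simp) g
  have h1 := contDiff_XD h
  have h2 := fun i j => contDiff_XD (h1 j) i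
  have h3 := contDiff_TD h
  unfold fieldV
  rw [XD_sub, XD_sub, XD_mul, XD_sum, XD_sum, XD_sum]
  · congr 1
    · congr 1
      exact Finset.sum_congr rfl fun i _ => XD_mul (hd (h1 i) g) (hd (h2 i j) g) j
    · refine Finset.sum_congr rfl fun i _ => ?_
      rw [XD_const_mul ((hd (h1 i) g).fun_mul (hd h3 g)), XD_mul (hd (h1 i) g) (hd h3 g)]
  · exact fun i => hd (contDiff_const.mul ((h1 i).mul h3)) g
  · exact fun i => hd ((h1 i).mul (h2 i j)) g
  · exact fun i => hd (h2 i i) g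
  · exact hd (h1 j) g
  · exact hd (ContDiff.sum fun i _ => h2 i i) g
  · exact hd ((h1 j).mul (ContDiff.sum fun i _ => h2 i i)) g
  · exact hd (ContDiff.sum fun i _ => (h1 i).mul (h2 i j)) g
  · exact hd (((h1 j).mul (ContDiff.sum fun i _ => h2 i i)).sub
      (ContDiff.sum fun i _ => (h1 i).mul (h2 i j))) g
  · exact hd (ContDiff.sum fun i _ => contDiff_const.mul ((h1 i).mul h3)) g

/-- The third order terms cancel by the commutation relations together with `[X_i, T] = 0`; the
second order terms are reduced to `Σ (X_i X_j u)²` and `(T u)²`. -/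
theorem div_fieldV {u : Heis n → ℝ} (h : ContDiff ℝ (⊤ : ℕ∞) u) (g : Heis n) :
    ∑ j, XD j (fieldV u j) g = jQ (jet u g) := by
  have hd : ∀ {f : Heis n → ℝ}, ContDiff ℝ (⊤ : ℕ∞) f → ContDiffAt ℝ 2 f g :=
    fun hf => (contDiff_infty.1 hf 2).contDiffAt
  have h1 := contDiff_XD h
  rw [← jQ_jet (hd h)]
  simp only [XD_fieldV h, lapH, hessHNormSq, hessH, Matrix.of_apply]
  have e1 : ∀ i j, XD j (XD i (XD j u)) g
      = XD i (XD j (XD j u)) g - comm i j * XD j (TD u) g := fun i j => by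
    rw [XD_TD_comm (hd h), ← XD_commutator (hd (h1 j)) i j]; ring
  have e2 : ∀ i j, XD j (XD i u) g = XD i (XD j u) g - comm i j * TD u g := fun i j => by
    rw [← XD_commutator (hd h) i j]; ring
  set t := TD u g
  set U := fun i => XD i u g
  set H := fun i j => XD i (XD j u) g
  have e3 : ∑ i, ∑ j, XD i u g * XD i (XD j (XD j u)) g
      = ∑ j, ∑ i, XD j u g * XD j (XD i (XD i u)) g := rfl
  have e4 : ∑ j, ∑ i, XD i u g * XD i (XD j (XD j u)) g
      = ∑ j, ∑ i, XD j u g * XD j (XD i (XD i u)) g := by rw [Finset.sum_comm]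
  -- With `h = X_i X_j u` and `X_j X_i u = h - c t`, the left side is `(h - c t)(h + c t)`.
  have key : ∀ i j, (XD i (XD j u) g * XD j (XD i u) g) + comm i j * (t * XD j (XD i u) g)
      = XD i (XD j u) g ^ 2 - comm i j ^ 2 * t ^ 2 := fun i j => by
    rw [e2 i j]; ring
  -- Parallelogram law: the antisymmetric part of `X_i X_j u` is `c t / 2`. Summed over all pairs,
  -- it accounts for `(n/2) t²`.
  have key2 : ∀ i j, ((XD i (XD j u) g + XD j (XD i u) g) / 2) ^ 2
      = XD i (XD j u) g ^ 2 / 2 + XD j (XD i u) g ^ 2 / 2 - comm i j ^ 2 * t ^ 2 / 4 :=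
    fun i j => by
    rw [e2 i j]; ring
  have s1 : ∑ i : HIdx n, ∑ j : HIdx n, comm i j ^ 2 * t ^ 2 = 2 * (n : ℝ) * t ^ 2 := by
    rw [← sum_comm_sq]; simp only [Finset.sum_mul]
  have s1' : ∑ i : HIdx n, ∑ j : HIdx n, comm i j ^ 2 * t ^ 2 / 4 = 2 * (n : ℝ) * t ^ 2 / 4 := by
    rw [← s1]; simp only [Finset.sum_div]
  have s2 : ∑ i, ∑ j, XD j (XD i u) g ^ 2 / 2 = ∑ i, ∑ j, XD i (XD j u) g ^ 2 / 2 :=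
    Finset.sum_comm
  simp only [key2, Finset.sum_add_distrib, Finset.sum_sub_distrib, s1', s2]
  have s3 : ∑ i, ∑ j, XD i (XD j u) g ^ 2 / 2 + ∑ i, ∑ j, XD i (XD j u) g ^ 2 / 2
      = ∑ i, ∑ j, XD i (XD j u) g ^ 2 := by
    simp only [← Finset.sum_add_distrib, add_halves]
  rw [s3]
  have s4 : ∑ j, ∑ i, (XD i (XD j u) g * XD j (XD i u) g) +
      ∑ j, ∑ i, comm i j * (t * XD j (XD i u) g)
      = ∑ i, ∑ j, XD i (XD j u) g ^ 2 - 2 * (n : ℝ) * t ^ 2 := by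
    rw [← s1]
    simp only [← Finset.sum_add_distrib, ← Finset.sum_sub_distrib, key]
    exact Finset.sum_comm
  have s5 : ∑ j, ∑ i, XD i u g * XD j (XD i (XD j u)) g
      = ∑ j, ∑ i, XD j u g * XD j (XD i (XD i u)) g
        - ∑ j, ∑ i, comm i j * (XD i u g * XD j (TD u) g) := by
    rw [← e4]
    simp only [← Finset.sum_sub_distrib]
    refine Finset.sum_congr rfl fun j _ => Finset.sum_congr rfl fun i _ => ?_
    rw [e1]; ring
  simp only [mul_add, Finset.sum_add_distrib, s5, Finset.mul_sum] at s4 ⊢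
  rw [sq, Finset.mul_sum]
  simp only [t] at *
  linarith
end Heisenberg


/-! ### Cutoff functions and mollification -/

section General

variable {E : Type*} [NormedAddCommGroup E] [NormedSpace ℝ E] [FiniteDimensional ℝ E]

open scoped Manifold ContDiff in
-- The value one is taken on a whole neighbourhood of `K`, so that multiplication by `χ` preserves
-- jets on `K` and the derivatives of `χ` vanish there.
theorem exists_contDiff_cutoff {K U : Set E} (hK : IsCompact K) (hU : IsOpen U) (hKU : K ⊆ U) :
    ∃ χ : E → ℝ, ContDiff ℝ (⊤ : ℕ∞) χ ∧ HasCompactSupport χ ∧ tsupport χ ⊆ U ∧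
      ∀ᶠ x in 𝓝ˢ K, χ x = 1 := by
  obtain ⟨K', hK', h1, h2⟩ := exists_compact_between hK hU hKU
  obtain ⟨f, hf1, hf0, -⟩ := exists_contMDiffMap_one_nhds_of_subset_interior (n := (⊤ : ℕ∞))
    𝓘(ℝ, E) hK.isClosed h1
  have hs : tsupport f ⊆ K' := closure_minimal
    (fun x hx => by by_contra h; exact hx (hf0 x h)) hK'.isClosed
  exact ⟨f, f.contMDiff.contDiff, HasCompactSupport.of_support_subset_isCompact hK'
    ((subset_tsupport _).trans hs), hs.trans h2, hf1⟩

theorem uniformContinuous_of_hasCompactSupport {E F : Type*} [NormedAddCommGroup E] [NormedAddCommGroup F]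
    {f : E → F} (hf : Continuous f) (h : HasCompactSupport f) : UniformContinuous f :=
  hf.uniformContinuous_of_tendsto_cocompact h.is_zero_at_infty

theorem ContDiffBump.fderiv_normed_convolution [MeasurableSpace E] [BorelSpace E]
    {F : Type*} [NormedAddCommGroup F] [NormedSpace ℝ F] [CompleteSpace F]
    (μ : Measure E) [μ.IsAddHaarMeasure] (φ : ContDiffBump (0 : E)) {f : E → F}
    (hf : ContDiff ℝ 1 f) (hc : HasCompactSupport f) :
    fderiv ℝ (convolution (φ.normed μ) f (ContinuousLinearMap.lsmul ℝ ℝ) μ)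
      = convolution (φ.normed μ) (fderiv ℝ f) (ContinuousLinearMap.lsmul ℝ ℝ) μ := by
  ext1 x
  have h := (hc.hasFDerivAt_convolution_right (L := ContinuousLinearMap.lsmul ℝ ℝ)
    (μ := μ) (f := φ.normed μ) φ.continuous_normed.locallyIntegrable hf x).fderiv
  rw [h]
  congr 1

/-- Convolution commutes with differentiation, and the first two derivatives are uniformly
continuous because of the compact support. Closeness of the values themselves is not needed, since
jets carry derivatives only. -/
theorem exists_smooth_approx_jet {u : E → ℝ} (hu : ContDiff ℝ 2 u) (hc : HasCompactSupport u)
    {ε : ℝ} (hε : 0 < ε) :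
    ∃ w : E → ℝ, ContDiff ℝ (⊤ : ℕ∞) w ∧ ∀ x, dist (fderiv ℝ w x) (fderiv ℝ u x) ≤ ε ∧
      dist (fderiv ℝ (fderiv ℝ w) x) (fderiv ℝ (fderiv ℝ u) x) ≤ ε := by
  borelize E
  have h1 : ContDiff ℝ 1 (fderiv ℝ u) := hu.fderiv_right (by norm_num)
  have hc1 : HasCompactSupport (fderiv ℝ u) := hc.fderiv ℝ
  have hc2 : HasCompactSupport (fderiv ℝ (fderiv ℝ u)) := hc1.fderiv ℝ
  obtain ⟨δ1, hδ1, h1δ⟩ := Metric.uniformContinuous_iff.mp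
    (uniformContinuous_of_hasCompactSupport h1.continuous hc1) ε hε
  have h2c := h1.continuous_fderiv one_ne_zero
  obtain ⟨δ2, hδ2, h2δ⟩ := Metric.uniformContinuous_iff.mp
    (uniformContinuous_of_hasCompactSupport h2c hc2) ε hε
  have hδ := lt_min hδ1 hδ2
  set δ := min δ1 δ2
  -- The outer radius is a common modulus of uniform continuity for the first and the second
  -- derivative.
  let φ : ContDiffBump (0 : E) := ⟨δ / 2, δ, half_pos hδ, half_lt_self hδ⟩
  have hu1 : ContDiff ℝ 1 u := hu.of_le (by norm_num)
  refine ⟨convolution (φ.normed Measure.addHaar) u (ContinuousLinearMap.lsmul ℝ ℝ)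
    Measure.addHaar, φ.hasCompactSupport_normed.contDiff_convolution_left _ φ.contDiff_normed
      hu.continuous.locallyIntegrable, fun x => ⟨?_, ?_⟩⟩
  · rw [φ.fderiv_normed_convolution _ hu1 hc]
    exact φ.dist_normed_convolution_le h1.continuous.aestronglyMeasurable
      fun y hy => (h1δ ((Metric.mem_ball.1 hy).trans_le (min_le_left _ _))).le
  · rw [φ.fderiv_normed_convolution _ hu1 hc, φ.fderiv_normed_convolution _ h1 hc1]
    exact φ.dist_normed_convolution_le h2c.aestronglyMeasurable
      fun y hy => (h2δ ((Metric.mem_ball.1 hy).trans_le (min_le_right _ _))).le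

end General

namespace Heisenberg

variable {n : ℕ}

/-! ### Integration by parts along the horizontal frame -/

instance : (volume : Measure (Heis n)).IsAddHaarMeasure := by
  have : ((volume : Measure (Fin n → ℝ)).prod (volume : Measure ℝ)).IsAddHaarMeasure := inferInstance
  exact Measure.prod.instIsAddHaarMeasure (volume : Measure (Fin n → ℝ))
    ((volume : Measure (Fin n → ℝ)).prod (volume : Measure ℝ))

theorem integral_fderiv_apply_eq_zero {f : Heis n → ℝ} (hf : ContDiff ℝ 1 f)
    (hc : HasCompactSupport f) (v : Heis n) : ∫ g, fderiv ℝ f g v = 0 := by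
  have h1 : Continuous fun g => fderiv ℝ f g v :=
    (hf.continuous_fderiv one_ne_zero).clm_apply continuous_const
  have hc1 : HasCompactSupport fun g => fderiv ℝ f g v := hc.fderiv_apply ℝ v
  have := integral_mul_fderiv_eq_neg_fderiv_mul_of_integrable (μ := (volume : Measure (Heis n)))
    (f := fun _ => (1 : ℝ)) (g := f) (v := v) (by simp)
    (by simpa using h1.integrable_of_hasCompactSupport hc1)
    (by simpa using hf.continuous.integrable_of_hasCompactSupport hc)
    (fun x _ => differentiableAt_const _)
    (fun x _ => hf.differentiable one_ne_zero x)
  simpa using this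

/-- The condition `ℓ v = 0` says that the coefficient of `X_i` along the vertical direction is
constant in that direction, which makes `X_i` divergence free. -/
theorem exists_XL_eq_smul (i : HIdx n) :
    ∃ (v : Heis n) (ℓ : Heis n →L[ℝ] ℝ), ℓ v = 0 ∧ ∀ h, XL i h = ℓ h • v := by
  rcases i with j | j
  · exact ⟨(0, 0, 1), (-(1 / 2) : ℝ) • (ContinuousLinearMap.proj j).comp
      ((ContinuousLinearMap.fst ℝ (Fin n → ℝ) ℝ).comp
        (ContinuousLinearMap.snd ℝ (Fin n → ℝ) ((Fin n → ℝ) × ℝ))), by simp, by simp [XL]⟩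
  · exact ⟨(0, 0, 1), (1 / 2 : ℝ) • (ContinuousLinearMap.proj j).comp
      (ContinuousLinearMap.fst ℝ (Fin n → ℝ) ((Fin n → ℝ) × ℝ)), by simp, by simp [XL]⟩

theorem integral_XD_eq_zero {f : Heis n → ℝ} (hf : ContDiff ℝ 1 f) (hc : HasCompactSupport f)
    (i : HIdx n) : ∫ g, XD i f g = 0 := by
  obtain ⟨v, ℓ, hv, hℓ⟩ := exists_XL_eq_smul i
  have hd := hf.differentiable one_ne_zero
  have hm : ContDiff ℝ 1 fun g => ℓ g * f g := ℓ.contDiff.mul hf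
  have hmc : HasCompactSupport fun g => ℓ g * f g := hc.mul_left
  -- Since `ℓ v = 0`, the linear coefficient can be moved under the derivative: `ℓ ∂_v f = ∂_v (ℓ
  -- f)`. Both terms are then derivatives in constant directions.
  have e : ∀ g, XD i f g = fderiv ℝ f g (X i 0) + fderiv ℝ (fun g => ℓ g * f g) g v := fun g => by
    rw [XD_eq (hd g), X_eq, hℓ, fderiv_fun_mul ℓ.differentiableAt (hd g)]
    simp [hv]
  have hi : ∀ {k : Heis n → ℝ}, ContDiff ℝ 1 k → HasCompactSupport k → ∀ v : Heis n,
      Integrable fun g => fderiv ℝ k g v := fun hk hkc v =>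
    ((hk.continuous_fderiv one_ne_zero).clm_apply continuous_const).integrable_of_hasCompactSupport
      (hkc.fderiv_apply ℝ v)
  simp only [e]
  rw [integral_add (hi hf hc _) (hi hm hmc v), integral_fderiv_apply_eq_zero hf hc,
    integral_fderiv_apply_eq_zero hm hmc, add_zero]

theorem XD_eq_zero_of_notMem_tsupport {f : Heis n → ℝ} {g : Heis n} (hg : g ∉ tsupport f)
    (i : HIdx n) : XD i f g = 0 := by
  have h : f =ᶠ[𝓝 g] 0 := notMem_tsupport_iff_eventuallyEq.1 hg
  have h2 : DifferentiableAt ℝ f g := (differentiableAt_const (0 : ℝ)).congr_of_eventuallyEq h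
  rw [XD_eq h2, h.fderiv_eq]
  simp

theorem continuous_XD {f : Heis n → ℝ} (hf : ContDiff ℝ 1 f) (i : HIdx n) :
    Continuous (XD i f) := by
  have : XD i f = fun g => fderiv ℝ f g (X i g) :=
    funext fun g => XD_eq (hf.differentiable one_ne_zero g) i
  rw [this]
  exact (hf.continuous_fderiv one_ne_zero).clm_apply (continuous_X i)

/-- The integrand of the weak divergence identity. -/
def weakIntegrand (φ : Heis n → ℝ) (z : Heis n → Jet n) (g : Heis n) : ℝ :=
  φ g * jQ (z g) + ∑ j, jV (z g) j * XD j φ g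

theorem weakIntegrand_eq_zero {φ : Heis n → ℝ} {g : Heis n} (hg : g ∉ tsupport φ)
    (z : Heis n → Jet n) : weakIntegrand φ z g = 0 := by
  simp [weakIntegrand, image_eq_zero_of_notMem_tsupport hg, XD_eq_zero_of_notMem_tsupport hg]

/-- By `div_fieldV` the integrand is the horizontal divergence of the compactly supported field `φ
V`. -/
theorem integral_weakIntegrand_smooth {u φ : Heis n → ℝ} (hu : ContDiff ℝ (⊤ : ℕ∞) u)
    (hφ : ContDiff ℝ 1 φ) (hc : HasCompactSupport φ) :
    ∫ g, weakIntegrand φ (jet u) g = 0 := by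
  have h2 : ∀ g, ContDiffAt ℝ 2 u g := fun g => (contDiff_infty.1 hu 2).contDiffAt
  have hV : ∀ j, ContDiff ℝ 1 (fieldV u j) := fun j => contDiff_infty.1 (contDiff_fieldV hu j) 1
  have hp : ∀ j, ContDiff ℝ 1 fun g => φ g * fieldV u j g := fun j => hφ.mul (hV j)
  have hpc : ∀ j, HasCompactSupport fun g => φ g * fieldV u j g := fun j => hc.mul_right
  have e : ∀ g, weakIntegrand φ (jet u) g = ∑ j, XD j (fun g => φ g * fieldV u j g) g := fun g => by
    simp only [weakIntegrand, ← div_fieldV hu, ← fieldV_eq_jV (h2 g),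
      fun j => XD_mul (hφ.differentiable one_ne_zero g) ((hV j).differentiable one_ne_zero g) j,
      Finset.sum_add_distrib, Finset.mul_sum]
  have hcs : ∀ j, HasCompactSupport (XD j fun g => φ g * fieldV u j g) := fun j =>
    HasCompactSupport.of_support_subset_isCompact (hpc j) fun g hg => by
      by_contra h; exact hg (XD_eq_zero_of_notMem_tsupport h j)
  simp only [e]
  rw [integral_finsetSum _ fun j _ =>
    (continuous_XD (hp j) j).integrable_of_hasCompactSupport (hcs j)]
  exact Finset.sum_eq_zero fun j _ => integral_XD_eq_zero (hp j) (hpc j) j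

theorem continuous_jet {u : Heis n → ℝ} (hu : ContDiff ℝ 2 u) : Continuous (jet u) := by
  have h1 : ContDiff ℝ 1 (fderiv ℝ u) := hu.fderiv_right (by norm_num)
  exact continuous_id.prodMk (h1.continuous.prodMk (h1.continuous_fderiv one_ne_zero))

theorem continuous_weakIntegrand {φ : Heis n → ℝ} (hφ : ContDiff ℝ 1 φ) {z : Heis n → Jet n}
    (hz : Continuous z) : Continuous (weakIntegrand φ z) :=
  (hφ.continuous.mul (continuous_jQ.comp hz)).add (continuous_finsetSum _ fun j _ =>
    ((continuous_jV j).comp hz).mul (continuous_XD hφ j))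

theorem properSpace_dual (E F : Type*) [NormedAddCommGroup E] [NormedSpace ℝ E]
    [FiniteDimensional ℝ E] [NormedAddCommGroup F] [NormedSpace ℝ F] [FiniteDimensional ℝ F] :
    ProperSpace (E →L[ℝ] F) := FiniteDimensional.proper ℝ _

/-- Properness makes closed thickenings of compact sets of jets compact, which provides the uniform
bound for dominated convergence below. -/
instance : ProperSpace (Jet n) := by
  have h1 : ProperSpace (Heis n →L[ℝ] ℝ) := properSpace_dual _ _
  have h2 : ProperSpace (Heis n →L[ℝ] Heis n →L[ℝ] ℝ) := properSpace_dual _ _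
  infer_instance

theorem integral_weakIntegrand_of_hasCompactSupport {u φ : Heis n → ℝ} (hu : ContDiff ℝ 2 u)
    (huc : HasCompactSupport u) (hφ : ContDiff ℝ 1 φ) (hc : HasCompactSupport φ) :
    ∫ g, weakIntegrand φ (jet u) g = 0 := by
  have hε : ∀ k : ℕ, (0 : ℝ) < 1 / ((k : ℝ) + 1) := fun k => Nat.one_div_pos_of_nat
  choose w hw hd using fun k : ℕ => exists_smooth_approx_jet hu huc (hε k)
  have hε0 : Filter.Tendsto (fun k : ℕ => 1 / ((k : ℝ) + 1)) Filter.atTop (𝓝 0) :=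
    tendsto_one_div_add_atTop_nhds_zero_nat
  have hjet : ∀ g, Filter.Tendsto (fun k => jet (w k) g) Filter.atTop (𝓝 (jet u g)) := fun g =>
    tendsto_const_nhds.prodMk_nhds ((tendsto_iff_dist_tendsto_zero.2 (squeeze_zero
      (fun _ => dist_nonneg) (fun k => (hd k g).1) hε0)).prodMk_nhds
      (tendsto_iff_dist_tendsto_zero.2 (squeeze_zero
      (fun _ => dist_nonneg) (fun k => (hd k g).2) hε0)))
  have hKc : IsCompact (tsupport φ) := hc
  -- the jets of the approximations stay in a compact set
  have hju := (continuous_jet hu)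
  have hS0 : IsCompact (jet u '' tsupport φ) := hKc.image hju
  have hS : IsCompact (tsupport φ ×ˢ Metric.cthickening 1 (jet u '' tsupport φ)) :=
    hKc.prod (IsCompact.cthickening (α := Jet n) hS0)
  have hG : Continuous fun p : Heis n × Jet n => φ p.1 * jQ p.2 + ∑ j, jV p.2 j * XD j φ p.1 :=
    ((hφ.continuous.comp continuous_fst).mul (continuous_jQ.comp continuous_snd)).add
      (continuous_finsetSum _ fun j _ => ((continuous_jV j).comp continuous_snd).mul
        ((continuous_XD hφ j).comp continuous_fst))
  obtain ⟨M, hM⟩ := hS.exists_bound_of_continuousOn hG.continuousOn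
  have hbound : ∀ k g, ‖weakIntegrand φ (jet (w k)) g‖ ≤ (tsupport φ).indicator (fun _ => M) g := by
    intro k g
    by_cases hg : g ∈ tsupport φ
    · rw [Set.indicator_of_mem hg]
      refine hM (g, jet (w k) g) ⟨hg, ?_⟩
      have h1 : dist (jet (w k) g) (jet u g) ≤ 1 := by
        have h1' : 1 / ((k : ℝ) + 1) ≤ 1 := by
          rw [div_le_one (by positivity)]; linarith [(Nat.cast_nonneg k : (0 : ℝ) ≤ k)]
        simp only [jet, Prod.dist_eq, dist_self]
        exact max_le zero_le_one (max_le ((hd k g).1.trans h1') ((hd k g).2.trans h1'))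
      exact Metric.mem_cthickening_of_dist_le (α := Jet n) _ _ _ _ ⟨g, hg, rfl⟩ h1
    · rw [weakIntegrand_eq_zero hg, Set.indicator_of_notMem hg, norm_zero]
  have hlim := tendsto_integral_of_dominated_convergence
    (μ := (volume : Measure (Heis n))) (F := fun k => weakIntegrand φ (jet (w k)))
    (f := weakIntegrand φ (jet u)) ((tsupport φ).indicator fun _ => M)
    (fun k => (continuous_weakIntegrand hφ (continuous_jet
      (contDiff_infty.1 (hw k) 2))).aestronglyMeasurable)
    ((integrable_indicator_iff hKc.measurableSet).2
      (integrableOn_const (hKc.measure_lt_top.ne)))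
    (fun k => Filter.Eventually.of_forall (hbound k))
    (Filter.Eventually.of_forall fun g =>
      ((hG.tendsto (g, jet u g)).comp (tendsto_const_nhds.prodMk_nhds (hjet g))))
  simp only [integral_weakIntegrand_smooth (hw _) hφ hc] at hlim
  exact (tendsto_nhds_unique hlim tendsto_const_nhds)

/-- The weak form of the divergence identity for functions of class `C²`. -/
theorem integral_weakIntegrand {Ω : Set (Heis n)} (hΩ : IsOpen Ω) {u φ : Heis n → ℝ}
    (hu : ContDiffOn ℝ 2 u Ω) (hφ : ContDiff ℝ 1 φ) (hc : HasCompactSupport φ)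
    (hs : tsupport φ ⊆ Ω) : ∫ g, weakIntegrand φ (jet u) g = 0 := by
  -- `χ u` is globally `C²` with compact support and has the same jet as `u` on the support of `φ`.
  obtain ⟨χ, hχ, hχc, hχs, hχ1⟩ := exists_contDiff_cutoff hc hΩ hs
  have hw : ContDiff ℝ 2 fun g => χ g * u g := by
    rw [contDiff_iff_contDiffAt]
    intro g
    by_cases hg : g ∈ tsupport χ
    · exact (contDiff_infty.1 hχ 2).contDiffAt.mul (hu.contDiffAt (hΩ.mem_nhds (hχs hg)))
    · refine (contDiffAt_const (c := (0 : ℝ))).congr_of_eventuallyEq ?_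
      filter_upwards [notMem_tsupport_iff_eventuallyEq.1 hg] with g' hg'
      simp [hg']
  rw [← integral_weakIntegrand_of_hasCompactSupport hw hχc.mul_right hφ hc]
  congr 1
  ext g
  by_cases hg : g ∈ tsupport φ
  · have he : u =ᶠ[𝓝 g] fun g => χ g * u g := by
      filter_upwards [(eventually_nhdsSet_iff_forall.1 hχ1) g hg] with g' hg'
      simp [hg']
    have : jet u g = jet (fun g => χ g * u g) g := by
      simp only [jet, he.fderiv_eq, (he.fderiv (𝕜 := ℝ)).fderiv_eq]
    simp [weakIntegrand, this]
  · rw [weakIntegrand_eq_zero hg, weakIntegrand_eq_zero hg]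

end Heisenberg


/-! ### Defining functions and the outer normal -/

/-- A one-constraint Farkas lemma: a half space contained in another one forces the functionals to
be proportional, with a nonnegative factor. -/
theorem ContinuousLinearMap.exists_eq_smul_of_nonpos {E : Type*} [NormedAddCommGroup E]
    [NormedSpace ℝ E] {ℓ m : E →L[ℝ] ℝ} (hℓ : ℓ ≠ 0) (h : ∀ v, ℓ v < 0 → m v ≤ 0) :
    ∃ c : ℝ, 0 ≤ c ∧ m = c • ℓ := by
  obtain ⟨w0, hw0⟩ : ∃ w, ℓ w ≠ 0 := by
    by_contra! h0
    exact hℓ (ContinuousLinearMap.ext h0)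
  set w := (ℓ w0)⁻¹ • w0
  have hw : ℓ w = 1 := by simp [w, hw0]
  have hker : ∀ v, ℓ v = 0 → m v = 0 := by
    intro v hv
    by_contra hmv
    -- The multiple of `v` does not change `ℓ` and is chosen so that `m` takes the value `1 > 0`.
    have h1 := h (-w + ((m w + 1) / m v) • v) (by simp [hw, hv])
    simp only [map_add, map_neg, map_smul, smul_eq_mul, div_mul_cancel₀ _ hmv] at h1
    linarith
  refine ⟨m w, ?_, ?_⟩
  · have := h (-w) (by simp [hw])
    simpa using this
  · ext v
    have := hker (v - ℓ v • w) (by simp [hw])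
    simp only [map_sub, map_smul, smul_eq_mul, sub_eq_zero] at this
    simp [this, mul_comm]

namespace Heisenberg

variable {n : ℕ}

theorem frame_decomp (g v : Heis n) :
    v = ∑ j, v.1 j • X (Sum.inl j) g + ∑ j, v.2.1 j • X (Sum.inr j) g + contact g v • T g := by
  ext k
  · simp only [Prod.fst_add, Prod.fst_sum, Pi.add_apply, Finset.sum_apply, Prod.smul_fst]
    simp [X, T, Pi.single_apply]
  · simp only [Prod.fst_add, Prod.snd_add, Prod.fst_sum, Prod.snd_sum, Pi.add_apply,
      Finset.sum_apply, Prod.smul_fst, Prod.smul_snd]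
    simp [X, T, Pi.single_apply]
  · simp only [Prod.snd_add, Prod.snd_sum, Prod.smul_snd, contact, X, T, smul_eq_mul]
    have h1 : ∑ j, v.1 j * (-g.2.1 j / 2) = -∑ j, 1 / 2 * (g.2.1 j * v.1 j) := by
      rw [← Finset.sum_neg_distrib]
      exact Finset.sum_congr rfl fun j _ => by ring
    have h2 : ∑ j, v.2.1 j * (g.1 j / 2) = ∑ j, 1 / 2 * (g.1 j * v.2.1 j) :=
      Finset.sum_congr rfl fun j _ => by ring
    rw [h1, h2]
    simp only [mul_sub, Finset.mul_sum]
    ring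

/-- The coordinates of a vector in the frame `X_1, …, X_{2n}, T`. -/
def frameCoord (g : Heis n) : Heis n →ₗ[ℝ] (HIdx n ⊕ Unit) → ℝ where
  toFun v := Sum.elim (Sum.elim v.1 v.2.1) fun _ => contact g v
  map_add' v w := by
    ext k
    rcases k with (k | k) | k <;> simp [contact, mul_add, Finset.sum_add_distrib]
    ring
  map_smul' c v := by
    ext k
    rcases k with (k | k) | k <;>
      simp [contact, mul_add, mul_sub, Finset.mul_sum, mul_left_comm]

/-- The frame `X_1, …, X_{2n}, T`. -/
def frame (k : HIdx n ⊕ Unit) (g : Heis n) : Heis n := Sum.elim (fun i => X i g) (fun _ => T g) k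

theorem sum_frameCoord_smul (g v : Heis n) : ∑ k, frameCoord g v k • frame k g = v := by
  conv_rhs => rw [frame_decomp g v]
  simp [frameCoord, frame, Fintype.sum_sum_type]

theorem metric_eq (g v w : Heis n) :
    metric g v w = ∑ k, frameCoord g v k * frameCoord g w k := by
  simp [metric, frameCoord, Fintype.sum_sum_type]

theorem frameCoord_frame (g : Heis n) (k : HIdx n ⊕ Unit) :
    frameCoord g (frame k g) = Pi.single k 1 := by
  ext l
  rcases k with (k | k) | k <;> rcases l with (l | l) | l <;>
    simp [frameCoord, frame, X, T, Pi.single_apply, contact] <;> ring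

theorem frameCoord_riemGrad (φ : Heis n → ℝ) (g : Heis n) (k : HIdx n ⊕ Unit) :
    frameCoord g (riemGrad φ g) k = fderiv ℝ φ g (frame k g) := by
  have : riemGrad φ g = ∑ k, fderiv ℝ φ g (frame k g) • frame k g := by
    simp [riemGrad, frame, Fintype.sum_sum_type]
  rw [this]
  simp only [map_sum, map_smul, frameCoord_frame, Finset.sum_apply, Pi.smul_apply, smul_eq_mul]
  simp only [Pi.single_apply, mul_ite, mul_one, mul_zero, Finset.sum_ite_eq, Finset.mem_univ, if_true]

/-- The Riemannian norm of the differential of a function. -/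
def gradNorm (φ : Heis n → ℝ) (g : Heis n) : ℝ := √(∑ k, fderiv ℝ φ g (frame k g) ^ 2)

theorem gradNorm_pos {φ : Heis n → ℝ} {g : Heis n} (h : fderiv ℝ φ g ≠ 0) : 0 < gradNorm φ g := by
  refine Real.sqrt_pos.2 (lt_of_le_of_ne (Finset.sum_nonneg fun _ _ => sq_nonneg _) fun h0 => h ?_)
  refine ContinuousLinearMap.ext fun v => ?_
  have h1 := (Finset.sum_eq_zero_iff_of_nonneg fun _ _ => sq_nonneg _).1 h0.symm
  rw [← sum_frameCoord_smul g v, map_sum]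
  refine Finset.sum_eq_zero fun k hk => ?_
  simp [pow_eq_zero_iff (two_ne_zero) |>.1 (h1 k hk)]

theorem sqrt_metric_riemGrad (φ : Heis n → ℝ) (g : Heis n) :
    √(metric g (riemGrad φ g) (riemGrad φ g)) = gradNorm φ g := by
  simp [metric_eq, frameCoord_riemGrad, gradNorm, sq]

theorem IsLocalDefining.apply_eq_zero {Ω : Set (Heis n)} {p : Heis n} {φ : Heis n → ℝ}
    (h : IsLocalDefining Ω p φ) (hΩ : IsOpen Ω) (hp : p ∈ frontier Ω) : φ p = 0 := by
  rw [hΩ.frontier_eq] at hp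
  refine le_antisymm ?_ ?_
  · have hc : ContinuousAt φ p := h.1.continuousAt
    have := mem_closure_iff_frequently.1 hp.1
    refine le_of_tendsto_of_frequently hc (this.mp ?_)
    filter_upwards [h.2.2] with g hg hgΩ using (hg.1 hgΩ).le
  · exact not_lt.1 fun hlt => hp.2 (h.2.2.self_of_nhds.2 hlt)

/-- A direction `v` with `dφ(v) < 0` points into `Ω`, so `ψ < 0` along a short segment and `dψ(v) ≤
0`. This makes the outer normal independent of the chosen defining function. -/
theorem IsLocalDefining.fderiv_eq_smul {Ω : Set (Heis n)} {p : Heis n} {φ ψ : Heis n → ℝ}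
    (hφ : IsLocalDefining Ω p φ) (hψ : IsLocalDefining Ω p ψ) (hΩ : IsOpen Ω)
    (hp : p ∈ frontier Ω) : ∃ c : ℝ, 0 < c ∧ fderiv ℝ ψ p = c • fderiv ℝ φ p := by
  obtain ⟨c, hc, h⟩ := ContinuousLinearMap.exists_eq_smul_of_nonpos (m := fderiv ℝ ψ p) hφ.2.1
    fun v hv => by
      have d1 := ((hφ.1.differentiableAt (by simp)).hasFDerivAt.hasLineDerivAt v).tendsto_slope_zero_right
      have d2 := ((hψ.1.differentiableAt (by simp)).hasFDerivAt.hasLineDerivAt v).tendsto_slope_zero_right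
      rw [hφ.apply_eq_zero hΩ hp] at d1
      rw [hψ.apply_eq_zero hΩ hp] at d2
      have hl : Filter.Tendsto (fun t : ℝ => p + t • v) (𝓝[>] 0) (𝓝 p) := by
        have : Continuous fun t : ℝ => p + t • v := by fun_prop
        have h0 := this.tendsto 0
        simp only [zero_smul, add_zero] at h0
        exact h0.mono_left nhdsWithin_le_nhds
      refine le_of_tendsto d2 ?_
      filter_upwards [d1.eventually_lt_const hv, hl.eventually hφ.2.2, hl.eventually hψ.2.2,
        self_mem_nhdsWithin] with t h1 h2 h3 (h4 : 0 < t)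
      have h5 : p + t • v ∈ Ω := h2.2 (by
        simp only [sub_zero, smul_eq_mul] at h1
        exact (mul_neg_iff.1 h1).elim (fun h => h.2) fun h => absurd h.1 (not_lt.2 (inv_pos.2 h4).le))
      simp only [sub_zero, smul_eq_mul]
      exact mul_nonpos_of_nonneg_of_nonpos (inv_pos.2 h4).le (h3.1 h5).le
  refine ⟨c, lt_of_le_of_ne hc fun h0 => hψ.2.1 ?_, h⟩
  rw [h, ← h0, zero_smul]

theorem NH_eq {Ω : Set (Heis n)} {p : Heis n} {φ : Heis n → ℝ} (hφ : IsLocalDefining Ω p φ)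
    (hΩ : IsOpen Ω) (hp : p ∈ frontier Ω) (j : HIdx n) :
    NH Ω p j = (gradNorm φ p)⁻¹ * fderiv ℝ φ p (X j p) := by
  have h : p ∈ frontier Ω ∧ ∃ φ, IsLocalDefining Ω p φ := ⟨hp, φ, hφ⟩
  obtain ⟨c, hc, hcψ⟩ := hφ.fderiv_eq_smul h.2.choose_spec hΩ hp
  set ψ := h.2.choose
  have e1 : NH Ω p j = (gradNorm ψ p)⁻¹ * fderiv ℝ ψ p (X j p) := by
    have : X j p = frame (Sum.inl j) p := rfl
    rw [NH, outerNormal, dif_pos h, sqrt_metric_riemGrad, metric_eq, this]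
    simp only [map_smul, Pi.smul_apply, frameCoord_frame, frameCoord_riemGrad, smul_eq_mul]
    simp [Pi.single_apply, ψ]
  have e2 : gradNorm ψ p = c * gradNorm φ p := by
    rw [gradNorm, gradNorm, hcψ, ← Real.sqrt_sq hc.le, ← Real.sqrt_mul (sq_nonneg _),
      Finset.mul_sum]
    simp [mul_pow, Real.sqrt_sq hc.le]
  rw [e1, e2, hcψ]
  have := gradNorm_pos hφ.2.1
  simp
  field_simp

/-! ### Flattening charts of the boundary -/

/-- A `C²` chart in which the set is given by the negativity of the last coordinate. -/
structure FlatChart (Ω : Set (Heis n)) (e : OpenPartialHomeomorph (Heis n) (Heis n)) : Prop where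
  contDiffAt : ∀ g ∈ e.source, ContDiffAt ℝ 2 e g
  contDiffAt_symm : ∀ q ∈ e.target, ContDiffAt ℝ 2 e.symm q
  mem_iff : ∀ g ∈ e.source, g ∈ Ω ↔ (e g).2.2 < 0

/-- The last coordinate. -/
def height : Heis n →L[ℝ] ℝ :=
  (ContinuousLinearMap.snd ℝ (Fin n → ℝ) ℝ).comp
    (ContinuousLinearMap.snd ℝ (Fin n → ℝ) ((Fin n → ℝ) × ℝ))

@[simp] theorem height_apply (g : Heis n) : height g = g.2.2 := rfl

/-- The linear automorphism `v ↦ v + (ℓ v - v.2.2) • x`. -/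
def shearEquiv (ℓ : Heis n →L[ℝ] ℝ) (x : Heis n) (hx : x.2.2 = 1) (hℓ : ℓ x ≠ 0) :
    Heis n ≃L[ℝ] Heis n :=
  ContinuousLinearEquiv.equivOfInverse
    (ContinuousLinearMap.id ℝ (Heis n) + (ℓ - height).smulRight x)
    (ContinuousLinearMap.id ℝ (Heis n) + ((ℓ x)⁻¹ • (height - ℓ)).smulRight x)
    (fun v => by
      have h : height x = 1 := hx
      simp only [add_apply, ContinuousLinearMap.id_apply,
        ContinuousLinearMap.smulRight_apply, smul_apply,
        sub_apply, map_add, map_smul, smul_eq_mul, h]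
      match_scalars
      · ring
      · field_simp
        ring)
    (fun v => by
      have h : height x = 1 := hx
      simp only [add_apply, ContinuousLinearMap.id_apply,
        ContinuousLinearMap.smulRight_apply, smul_apply,
        sub_apply, map_add, map_smul, smul_eq_mul, h]
      match_scalars
      · ring
      · field_simp
        ring)

theorem shearEquiv_coe (ℓ : Heis n →L[ℝ] ℝ) (x : Heis n) (hx : x.2.2 = 1) (hℓ : ℓ x ≠ 0) :
    (shearEquiv ℓ x hx hℓ : Heis n →L[ℝ] Heis n) =
      ContinuousLinearMap.id ℝ (Heis n) + (ℓ - height).smulRight x := rfl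

/-- The chart is `g ↦ g + (φ g - height g) • x` with `x` of height one, so its last coordinate is
exactly `φ`. Its derivative is a shear, invertible as long as `dφ(x) ≠ 0`, and the inverse function
theorem applies. -/
theorem exists_flatChart {Ω : Set (Heis n)} {p : Heis n} {φ : Heis n → ℝ}
    (hφ : IsLocalDefining Ω p φ) : ∃ e, FlatChart Ω e ∧ p ∈ e.source := by
  -- If `dφ` kills the vertical direction, any `y` with `dφ(y) ≠ 0` can be shifted vertically to
  -- height one without changing `dφ(y)`; otherwise the vertical vector itself serves.
  obtain ⟨x, hx, hℓ⟩ : ∃ x : Heis n, x.2.2 = 1 ∧ fderiv ℝ φ p x ≠ 0 := by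
    by_cases h0 : fderiv ℝ φ p (0, 0, 1) = 0
    · obtain ⟨y, hy⟩ : ∃ y, fderiv ℝ φ p y ≠ 0 := by
        by_contra! h
        exact hφ.2.1 (ContinuousLinearMap.ext h)
      refine ⟨y + (1 - y.2.2) • (0, 0, 1), by simp, ?_⟩
      rw [map_add, map_smul, h0]
      simpa using hy
    · exact ⟨(0, 0, 1), rfl, h0⟩
  have hd : ∀ g, ContDiffAt ℝ 2 φ g →
      ContDiffAt ℝ 2 (fun g => g + (φ g - height g) • x) g := fun g hg =>
    contDiffAt_id.add ((hg.sub height.contDiff.contDiffAt).smul contDiffAt_const)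
  have hd' : ∀ g, ContDiffAt ℝ 2 φ g → ∀ h : fderiv ℝ φ g x ≠ 0,
      HasFDerivAt (fun g => g + (φ g - height g) • x)
        (shearEquiv (fderiv ℝ φ g) x hx h : Heis n →L[ℝ] Heis n) g := fun g hg h => by
    rw [shearEquiv_coe]
    exact (hasFDerivAt_id g).add (((hg.differentiableAt (by simp)).hasFDerivAt.sub
      height.hasFDerivAt).smul_const x)
  have hO : ∀ᶠ g in 𝓝 p, ContDiffAt ℝ 2 φ g ∧ (g ∈ Ω ↔ φ g < 0) ∧ fderiv ℝ φ g x ≠ 0 := by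
    have hc : ContinuousAt (fun g => fderiv ℝ φ g x) p :=
      ((hφ.1.fderiv_right (m := 0) (by norm_num)).continuousAt).clm_apply continuousAt_const
    exact (hφ.1.eventually (by simp)).and (hφ.2.2.and (hc.eventually_ne hℓ))
  obtain ⟨O, hO1, hO2, hpO⟩ := eventually_nhds_iff.1 hO
  set e := ((hd p hφ.1).toOpenPartialHomeomorph _ (hd' p hφ.1 hℓ) (by simp)).restrOpen O hO2
  have hsrc : e.source ⊆ O := by
    intro g hg
    rw [OpenPartialHomeomorph.restrOpen_source] at hg
    exact hg.2
  have he : ∀ g, e g = g + (φ g - height g) • x := fun g => rfl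
  have he' : (e : Heis n → Heis n) = fun g => g + (φ g - height g) • x := rfl
  refine ⟨e, ⟨fun g hg => ?_, fun q hq => ?_, fun g hg => ?_⟩, ?_⟩
  · rw [he']; exact hd g (hO1 g (hsrc hg)).1
  · have hg := hO1 _ (hsrc (e.map_target hq))
    exact e.contDiffAt_symm hq (hd' _ hg.1 hg.2.2) (hd _ hg.1)
  · rw [(hO1 g (hsrc hg)).2.1, he]
    simp [hx]
  · rw [OpenPartialHomeomorph.restrOpen_source]
    exact ⟨ContDiffAt.mem_toOpenPartialHomeomorph_source _ _ _, hpO⟩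

namespace FlatChart

variable {Ω : Set (Heis n)} {e : OpenPartialHomeomorph (Heis n) (Heis n)}

theorem continuous_height : Continuous fun g : Heis n => g.2.2 := by fun_prop

theorem mem_closure_iff (h : FlatChart Ω e) {g : Heis n} (hg : g ∈ e.source) :
    g ∈ closure Ω ↔ (e g).2.2 ≤ 0 := by
  constructor
  · intro hc
    have hcont : ContinuousAt (fun g => (e g).2.2) g :=
      continuous_height.continuousAt.comp (e.continuousAt hg)
    refine le_of_tendsto_of_frequently hcont ((mem_closure_iff_frequently.1 hc).mp ?_)
    filter_upwards [e.open_source.mem_nhds hg] with g' hg' hΩ using ((h.mem_iff g' hg').1 hΩ).le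
  · intro hle
    -- A point of height at most zero is the limit of points pushed straight down in the chart, and
    -- these lie in `Ω`.
    have hl : Filter.Tendsto (fun t : ℝ => e g + t • (0, 0, -1)) (𝓝[>] 0) (𝓝 (e g)) := by
      have : Continuous fun t : ℝ => e g + t • ((0, 0, -1) : Heis n) := by fun_prop
      have h0 := this.tendsto 0
      simp only [zero_smul, add_zero] at h0
      exact h0.mono_left nhdsWithin_le_nhds
    have hl2 := (e.continuousAt_symm (e.map_source hg)).tendsto.comp hl
    rw [e.left_inv hg] at hl2
    refine mem_closure_of_tendsto hl2 ?_
    filter_upwards [hl.eventually (e.open_target.mem_nhds (e.map_source hg)),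
      self_mem_nhdsWithin] with t ht (ht0 : 0 < t)
    rw [Function.comp_apply, h.mem_iff _ (e.map_target ht), e.right_inv ht]
    simp
    linarith

theorem mem_frontier_iff (h : FlatChart Ω e) (hΩ : IsOpen Ω) {g : Heis n} (hg : g ∈ e.source) :
    g ∈ frontier Ω ↔ (e g).2.2 = 0 := by
  rw [hΩ.frontier_eq, Set.mem_sdiff, h.mem_closure_iff hg, h.mem_iff g hg, not_lt]
  exact ⟨fun h => le_antisymm h.1 h.2, fun h => ⟨h.le, h.ge⟩⟩

theorem hasFDerivAt (h : FlatChart Ω e) {g : Heis n} (hg : g ∈ e.source) :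
    HasFDerivAt e (fderiv ℝ e g) g :=
  ((h.contDiffAt g hg).differentiableAt (by simp)).hasFDerivAt

theorem hasFDerivAt_symm (h : FlatChart Ω e) {q : Heis n} (hq : q ∈ e.target) :
    HasFDerivAt e.symm (fderiv ℝ e.symm q) q :=
  ((h.contDiffAt_symm q hq).differentiableAt (by simp)).hasFDerivAt

theorem fderiv_comp_symm (h : FlatChart Ω e) {q : Heis n} (hq : q ∈ e.target) (v : Heis n) :
    fderiv ℝ e (e.symm q) (fderiv ℝ e.symm q v) = v := by
  have h1 := (h.hasFDerivAt (e.map_target hq)).comp q (h.hasFDerivAt_symm hq)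
  have h2 : HasFDerivAt (e ∘ e.symm) (ContinuousLinearMap.id ℝ (Heis n)) q := by
    refine (hasFDerivAt_id q).congr_of_eventuallyEq ?_
    filter_upwards [e.open_target.mem_nhds hq] with q' hq' using e.right_inv hq'
  simpa using congrArg (fun L => L v) (h1.unique h2)

theorem fderiv_symm_comp (h : FlatChart Ω e) {q : Heis n} (hq : q ∈ e.target) (v : Heis n) :
    fderiv ℝ e.symm q (fderiv ℝ e (e.symm q) v) = v := by
  have h1 := (h.hasFDerivAt_symm (e.map_source (e.map_target hq))).comp (e.symm q)
    (h.hasFDerivAt (e.map_target hq))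
  have h2 : HasFDerivAt (e.symm ∘ e) (ContinuousLinearMap.id ℝ (Heis n)) (e.symm q) := by
    refine (hasFDerivAt_id _).congr_of_eventuallyEq ?_
    filter_upwards [e.open_source.mem_nhds (e.map_target hq)] with q' hq' using e.left_inv hq'
  have := congrArg (fun L => L v) (h1.unique h2)
  simpa [e.right_inv hq] using this

/-- The defining function of a flattening chart. -/
def _root_.Heisenberg.chartFun (e : OpenPartialHomeomorph (Heis n) (Heis n)) (g : Heis n) : ℝ :=
  (e g).2.2

theorem contDiffAt_chartFun (h : FlatChart Ω e) {g : Heis n} (hg : g ∈ e.source) :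
    ContDiffAt ℝ 2 (chartFun e) g :=
  height.contDiff.contDiffAt.comp g (h.contDiffAt g hg)

theorem fderiv_chartFun (h : FlatChart Ω e) {g : Heis n} (hg : g ∈ e.source) (v : Heis n) :
    fderiv ℝ (chartFun e) g v = (fderiv ℝ e g v).2.2 := by
  have := (height.hasFDerivAt.comp g (h.hasFDerivAt hg)).fderiv
  exact congrArg (fun L => L v) this

theorem fderiv_chartFun_ne_zero (h : FlatChart Ω e) {g : Heis n} (hg : g ∈ e.source) :
    fderiv ℝ (chartFun e) g ≠ 0 := by
  intro h0
  have h1 := h.fderiv_comp_symm (e.map_source hg) (0, 0, 1)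
  rw [e.left_inv hg] at h1
  have h2 := h.fderiv_chartFun hg (fderiv ℝ e.symm (e g) (0, 0, 1))
  rw [h0, h1] at h2
  simp at h2

theorem isLocalDefining (h : FlatChart Ω e) {g : Heis n} (hg : g ∈ e.source) :
    IsLocalDefining Ω g (chartFun e) :=
  ⟨h.contDiffAt_chartFun hg, h.fderiv_chartFun_ne_zero hg, by
    filter_upwards [e.open_source.mem_nhds hg] with g' hg' using h.mem_iff g' hg'⟩

theorem NH_eq (h : FlatChart Ω e) (hΩ : IsOpen Ω) {g : Heis n} (hg : g ∈ e.source)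
    (hf : g ∈ frontier Ω) (j : HIdx n) :
    NH Ω g j = (gradNorm (chartFun e) g)⁻¹ * fderiv ℝ (chartFun e) g (X j g) :=
  Heisenberg.NH_eq (h.isLocalDefining hg) hΩ hf j

end FlatChart

end Heisenberg


/-! ### Gram determinants of hyperplane sections. -/

/-- The volume of a parallelepiped is the area of a face times its height. The vector `r` is the
last row of `A⁻¹`, orthogonal to the face spanned by the other columns, and the height equals `1 /
|r|`. -/
theorem Matrix.det_gram_of_vecMul_eq_single {m : Type*} [Fintype m] [DecidableEq m]
    (A : Matrix (m ⊕ Unit) (m ⊕ Unit) ℝ) (r : m ⊕ Unit → ℝ)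
    (hr : Matrix.vecMul r A = Pi.single (Sum.inr ()) 1) (hA : A.det ≠ 0) :
    Matrix.det (Matrix.of fun a b : m => ∑ k, A k (Sum.inl a) * A k (Sum.inl b))
      = A.det ^ 2 * ∑ k, r k ^ 2 := by
  set G : Matrix m m ℝ := Matrix.of fun a b : m => ∑ k, A k (Sum.inl a) * A k (Sum.inl b)
  set z := Matrix.mulVec A⁻¹ r
  have hAz : Matrix.mulVec A z = r := by
    rw [Matrix.mulVec_mulVec, Matrix.mul_nonsing_inv _ (isUnit_iff_ne_zero.2 hA), Matrix.one_mulVec]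
  have hCz : Matrix.mulVec (A.transpose * A) z = Pi.single (Sum.inr ()) 1 := by
    rw [← Matrix.mulVec_mulVec, hAz, Matrix.mulVec_transpose, hr]
  have hz : z (Sum.inr ()) = ∑ k, r k ^ 2 := by
    have h1 : dotProduct (Matrix.vecMul r A) z = dotProduct r (Matrix.mulVec A z) :=
      (Matrix.dotProduct_mulVec r A z).symm
    rw [hr, hAz, single_one_dotProduct] at h1
    rw [h1]
    simp [dotProduct, sq]
  -- Cramer's rule: `P` is the identity with its last column replaced by the solution `z` of `AᵀA z
  -- = e_last`. The product `AᵀA P` is then block triangular with the face Gram matrix as a diagonal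
  -- block.
  set P : Matrix (m ⊕ Unit) (m ⊕ Unit) ℝ := Matrix.fromBlocks 1 (Matrix.of fun a _ => z (Sum.inl a))
    0 (Matrix.of fun _ _ => z (Sum.inr ()))
  have hP : P.det = z (Sum.inr ()) := by
    rw [Matrix.det_fromBlocks_zero₂₁]
    simp
  have hCP : A.transpose * A * P = Matrix.fromBlocks G 0
      (Matrix.of fun _ b => (A.transpose * A) (Sum.inr ()) (Sum.inl b)) 1 := by
    ext k l
    rcases l with b | b
    · have : (A.transpose * A * P) k (Sum.inl b) = (A.transpose * A) k (Sum.inl b) := by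
        rw [Matrix.mul_apply]
        simp [P, Fintype.sum_sum_type, Matrix.one_apply]
      rw [this]
      rcases k with a | a
      · simp [Matrix.mul_apply, G]
      · simp
    · have : (A.transpose * A * P) k (Sum.inr b) = Matrix.mulVec (A.transpose * A) z k := by
        rw [Matrix.mul_apply, Matrix.mulVec, dotProduct]
        simp [P, Fintype.sum_sum_type]
      rw [this, hCz]
      rcases k with a | a <;> simp
  have := congrArg Matrix.det hCP
  rw [Matrix.det_mul, Matrix.det_mul, Matrix.det_transpose, hP, Matrix.det_fromBlocks_zero₁₂,
    Matrix.det_one, mul_one, hz] at this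
  rw [← this, sq]

namespace Heisenberg

variable {n : ℕ}

/-! ### The splitting of the model space -/

/-- The identification of the index set of the horizontal frame with `{0, …, 2n - 1}`. -/
def idxEquiv (n : ℕ) : HIdx n ≃ Fin (2 * n) := finSumFinEquiv.trans (finCongr (two_mul n).symm)

/-- The identification of `ℝ^{2n} × ℝ` with the Heisenberg group as a measurable space. -/
def splitMeas (n : ℕ) : (Fin (2 * n) → ℝ) × ℝ ≃ᵐ Heis n :=
  (((MeasurableEquiv.piCongrLeft (fun _ : Fin (2 * n) => ℝ) (idxEquiv n)).symm.trans
    (MeasurableEquiv.sumPiEquivProdPi fun _ : HIdx n => ℝ)).prodCongr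
      (MeasurableEquiv.refl ℝ)).trans MeasurableEquiv.prodAssoc

theorem splitMeas_apply (v : Fin (2 * n) → ℝ) (s : ℝ) : splitMeas n (v, s) =
    (fun j => v (idxEquiv n (Sum.inl j)), fun j => v (idxEquiv n (Sum.inr j)), s) := rfl

theorem measurePreserving_splitMeas : MeasurePreserving (splitMeas n) volume volume :=
  volume_preserving_prodAssoc.comp <| MeasurePreserving.prod
    ((volume_measurePreserving_sumPiEquivProdPi fun _ : HIdx n => ℝ).comp
      (MeasurePreserving.symm _
        (volume_measurePreserving_piCongrLeft (fun _ : Fin (2 * n) => ℝ) (idxEquiv n))))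
    (MeasurePreserving.id volume)

/-- The linear identification of `ℝ^{2n} × ℝ` with the Heisenberg group. -/
def split (n : ℕ) : ((Fin (2 * n) → ℝ) × ℝ) ≃L[ℝ] Heis n :=
  LinearEquiv.toContinuousLinearEquiv
    { (splitMeas n).toEquiv with
      map_add' := fun _ _ => rfl
      map_smul' := fun _ _ => rfl }

theorem split_eq (p : (Fin (2 * n) → ℝ) × ℝ) : split n p = splitMeas n p := rfl

theorem split_symm_snd (q : Heis n) : ((split n).symm q).2 = q.2.2 := by
  conv_rhs => rw [← (split n).apply_symm_apply q]
  rfl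

/-- The horizontal slice of the model space. -/
def slice (n : ℕ) : (Fin (2 * n) → ℝ) →L[ℝ] Heis n :=
  (split n : (Fin (2 * n) → ℝ) × ℝ →L[ℝ] Heis n).comp (ContinuousLinearMap.inl ℝ _ _)

theorem slice_apply (v : Fin (2 * n) → ℝ) : slice n v = split n (v, 0) := rfl

theorem slice_single (i : HIdx n) : slice n (Pi.single (idxEquiv n i) 1) = X i 0 := by
  rw [slice_apply, split_eq, splitMeas_apply]
  rcases i with j | j <;> ext <;> simp [X, Pi.single_apply]

theorem slice_height (v : Fin (2 * n) → ℝ) : (slice n v).2.2 = 0 := rfl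

/-! ### The area element of a flattened piece -/

/-- The frame coordinates as a linear equivalence. -/
def frameEquiv (g : Heis n) : Heis n ≃ₗ[ℝ] (HIdx n ⊕ Unit → ℝ) :=
  { frameCoord g with
    invFun := fun c => ∑ k, c k • frame k g
    left_inv := fun v => sum_frameCoord_smul g v
    right_inv := fun c => by
      ext l
      simp only [AddHom.toFun_eq_coe, LinearMap.coe_toAddHom, map_sum, map_smul, frameCoord_frame,
        Finset.sum_apply, Pi.smul_apply, smul_eq_mul]
      simp only [Pi.single_apply, mul_ite, mul_one, mul_zero, Finset.sum_ite_eq, Finset.mem_univ,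
        if_true] }

theorem frameEquiv_apply (g v : Heis n) : frameEquiv g v = frameCoord g v := rfl

theorem frameEquiv_symm_single (g : Heis n) (k : HIdx n ⊕ Unit) :
    (frameEquiv g).symm (Pi.single k 1) = frame k g := by
  rw [LinearEquiv.symm_apply_eq, frameEquiv_apply, frameCoord_frame]

/-- Passing from the frame at `0` to that at `g` only adds vertical components, so the matrix is
unipotent. The Riemannian volume is therefore Lebesgue measure. -/
theorem det_frameEquiv_comp (g : Heis n) : LinearMap.det ((frameEquiv g).toLinearMap ∘ₗ
    (frameEquiv (0 : Heis n)).symm.toLinearMap) = 1 := by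
  rw [← LinearMap.det_toMatrix']
  have : LinearMap.toMatrix' ((frameEquiv g).toLinearMap ∘ₗ
      (frameEquiv (0 : Heis n)).symm.toLinearMap) = Matrix.fromBlocks 1 0
        (Matrix.of fun _ i => contact g (X i 0)) 1 := by
    ext k l
    have h1 : LinearMap.toMatrix' ((frameEquiv g).toLinearMap ∘ₗ
      (frameEquiv (0 : Heis n)).symm.toLinearMap) k l = frameCoord g (frame l 0) k := by
      rw [LinearMap.toMatrix'_apply]
      change frameEquiv g ((frameEquiv 0).symm (Pi.single l 1)) k = _
      rw [frameEquiv_symm_single, frameEquiv_apply]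
    rw [h1]
    rcases k with (k | k) | k <;> rcases l with (l | l) | l <;>
      simp [frameCoord, frame, X, T, Matrix.one_apply, Pi.single_apply, contact, eq_comm]
  rw [this, Matrix.det_fromBlocks_zero₁₂]
  simp

/-- To be applied with `S` the derivative of an inverse chart and `r` the differential of its height
function; the sum on the right is then the squared Riemannian norm of that differential. -/
theorem det_metric_comp (S : Heis n →ₗ[ℝ] Heis n) (hS : LinearMap.det S ≠ 0) (g : Heis n)
    (r : Heis n →ₗ[ℝ] ℝ) (hr : ∀ v, r (S v) = v.2.2) :
    Matrix.det (Matrix.of fun a b : Fin (2 * n) => metric g (S (slice n (Pi.single a 1)))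
      (S (slice n (Pi.single b 1)))) = LinearMap.det S ^ 2 * ∑ k, r (frame k g) ^ 2 := by
  set A : Matrix (HIdx n ⊕ Unit) (HIdx n ⊕ Unit) ℝ :=
    LinearMap.toMatrix' ((frameEquiv g).toLinearMap ∘ₗ S ∘ₗ
      (frameEquiv (0 : Heis n)).symm.toLinearMap)
  have hA : ∀ k l, A k l = frameCoord g (S (frame l 0)) k := by
    intro k l
    change frameEquiv g (S ((frameEquiv 0).symm (Pi.single l 1))) k = _
    rw [frameEquiv_symm_single, frameEquiv_apply]
  have hdet : A.det = LinearMap.det S := by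
    rw [LinearMap.det_toMatrix']
    have : (frameEquiv g).toLinearMap ∘ₗ S ∘ₗ (frameEquiv (0 : Heis n)).symm.toLinearMap
      = ((frameEquiv g).toLinearMap ∘ₗ (frameEquiv (0 : Heis n)).symm.toLinearMap) ∘ₗ
        ((frameEquiv (0 : Heis n)).toLinearMap ∘ₗ S ∘ₗ
          (frameEquiv (0 : Heis n)).symm.toLinearMap) := by
      ext; simp
    rw [this, LinearMap.det_comp, det_frameEquiv_comp, LinearMap.det_conj, one_mul]
  have hrA : Matrix.vecMul (fun k => r (frame k g)) A = Pi.single (Sum.inr ()) 1 := by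
    ext l
    have h1 : Matrix.vecMul (fun k => r (frame k g)) A l = r (S (frame l 0)) := by
      conv_rhs => rw [← sum_frameCoord_smul g (S (frame l 0))]
      simp [Matrix.vecMul, dotProduct, hA, mul_comm]
    rw [h1, hr]
    rcases l with (l | l) | l <;> simp [frame, X, T]
  have key := Matrix.det_gram_of_vecMul_eq_single A _ hrA (hdet ▸ hS)
  rw [hdet] at key
  rw [← key, ← Matrix.det_submatrix_equiv_self (idxEquiv n)]
  congr 1
  ext a b
  simp only [Matrix.submatrix_apply, Matrix.of_apply, slice_single, metric_eq, hA]
  rfl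

/-- The parameter domain of the piece of the boundary in a flattening chart. -/
def chartDom (e : OpenPartialHomeomorph (Heis n) (Heis n)) : Set (Fin (2 * n) → ℝ) :=
  {v | slice n v ∈ e.target}

/-- The parametrization of the piece of the boundary in a flattening chart. -/
def chartParam (e : OpenPartialHomeomorph (Heis n) (Heis n)) (v : Fin (2 * n) → ℝ) : Heis n :=
  e.symm (slice n v)

namespace FlatChart

variable {Ω : Set (Heis n)} {e : OpenPartialHomeomorph (Heis n) (Heis n)}

theorem det_symm_ne_zero (h : FlatChart Ω e) {q : Heis n} (hq : q ∈ e.target) :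
    (fderiv ℝ e.symm q).det ≠ 0 := by
  have h1 : (fderiv ℝ e.symm q).toLinearMap ∘ₗ (fderiv ℝ e (e.symm q)).toLinearMap
      = LinearMap.id := LinearMap.ext fun v => h.fderiv_symm_comp hq v
  have h2 := congrArg LinearMap.det h1
  rw [LinearMap.det_comp, LinearMap.det_id] at h2
  exact left_ne_zero_of_mul_eq_one h2

theorem fderiv_chartParam (h : FlatChart Ω e) {v : Fin (2 * n) → ℝ} (hv : v ∈ chartDom e) :
    HasFDerivAt (chartParam e) ((fderiv ℝ e.symm (slice n v)).comp (slice n)) v :=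
  (h.hasFDerivAt_symm hv).comp v (slice n).hasFDerivAt

/-- The factor `gradNorm` cancels the normalization of the outer normal in `NH_eq`, so that flux
integrals contain only the Jacobian and the differential of the height. -/
theorem areaElement_chartParam (h : FlatChart Ω e) {v : Fin (2 * n) → ℝ} (hv : v ∈ chartDom e) :
    areaElement (chartParam e) v =
      |(fderiv ℝ e.symm (slice n v)).det| * gradNorm (chartFun e) (chartParam e v) := by
  rw [areaElement, (h.fderiv_chartParam hv).fderiv]
  have hs : chartParam e v ∈ e.source := e.map_target hv
  have := det_metric_comp (fderiv ℝ e.symm (slice n v)).toLinearMap (h.det_symm_ne_zero hv)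
    (chartParam e v) (fderiv ℝ (chartFun e) (chartParam e v)).toLinearMap fun w => by
      change fderiv ℝ (chartFun e) (chartParam e v) (fderiv ℝ e.symm (slice n v) w) = _
      rw [h.fderiv_chartFun hs, chartParam, h.fderiv_comp_symm hv]
  refine (congrArg Real.sqrt this).trans ?_
  rw [Real.sqrt_mul (sq_nonneg _), Real.sqrt_sq_eq_abs]
  rfl

theorem isOpen_chartDom : IsOpen (chartDom e) := e.open_target.preimage (slice n).continuous

theorem isRegularParam (h : FlatChart Ω e) (hΩ : IsOpen Ω) :
    IsRegularParam (frontier Ω) (chartDom e) (chartParam e) where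
  isOpen := isOpen_chartDom
  contDiffOn := fun v hv => (((h.contDiffAt_symm _ hv).of_le (by norm_num)).comp v
    (slice n).contDiff.contDiffAt).contDiffWithinAt
  injOn := fun v hv w hw hvw => by
    have h1 : slice n v = slice n w := e.symm.injOn hv hw hvw
    have h2 := (split n).injective h1
    exact congrArg Prod.fst h2
  immersion := fun v hv => by
    rw [(h.fderiv_chartParam hv).fderiv]
    intro a b hab
    have h1 := congrArg (fderiv ℝ e (e.symm (slice n v))) hab
    simp only [ContinuousLinearMap.comp_apply, h.fderiv_comp_symm hv] at h1
    exact congrArg Prod.fst ((split n).injective h1)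
  mapsTo := fun v hv => by
    refine (h.mem_frontier_iff hΩ (e.map_target hv)).2 ?_
    rw [e.right_inv hv]
    rfl

end FlatChart

end Heisenberg


namespace Heisenberg

variable {n : ℕ}

/-! ### The surface measure -/

/-- Reparametrization changes the Gram matrix by the congruence `Pᵀ G P`, hence its determinant by
`(det P)²`. -/
theorem areaElement_comp {ψ ψ' : (Fin (2 * n) → ℝ) → Heis n} {v w : Fin (2 * n) → ℝ}
    (L : (Fin (2 * n) → ℝ) →L[ℝ] (Fin (2 * n) → ℝ)) (h0 : ψ v = ψ' w)
    (h1 : fderiv ℝ ψ v = (fderiv ℝ ψ' w).comp L) :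
    areaElement ψ v = |L.det| * areaElement ψ' w := by
  set P : Matrix (Fin (2 * n)) (Fin (2 * n)) ℝ := LinearMap.toMatrix' L.toLinearMap
  set B : Matrix (HIdx n ⊕ Unit) (Fin (2 * n)) ℝ := Matrix.of fun k a =>
    frameCoord (ψ' w) (fderiv ℝ ψ' w (Pi.single a 1)) k
  have hB : ∀ b : Fin (2 * n) → ℝ, ∀ k, frameCoord (ψ' w) (fderiv ℝ ψ' w b) k
      = Matrix.mulVec B b k := by
    intro b k
    conv_lhs => rw [pi_eq_sum_univ' b]
    simp only [map_sum, map_smul, Finset.sum_apply, Pi.smul_apply, smul_eq_mul, Matrix.mulVec,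
      dotProduct, B, Matrix.of_apply]
    refine Finset.sum_congr rfl fun i _ => ?_
    rw [mul_comm]
  have hG : (Matrix.of fun a b : Fin (2 * n) => metric (ψ' w) (fderiv ℝ ψ' w (Pi.single a 1))
      (fderiv ℝ ψ' w (Pi.single b 1))) = B.transpose * B := by
    ext a b
    simp [metric_eq, Matrix.mul_apply, B]
  have hG' : (Matrix.of fun a b : Fin (2 * n) => metric (ψ v) (fderiv ℝ ψ v (Pi.single a 1))
      (fderiv ℝ ψ v (Pi.single b 1))) = P.transpose * (B.transpose * B) * P := by
    have e : P.transpose * (B.transpose * B) * P = (B * P).transpose * (B * P) := by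
      rw [Matrix.transpose_mul]; simp only [Matrix.mul_assoc]
    rw [e]
    ext a b
    simp only [Matrix.of_apply, metric_eq, h0, h1, Matrix.mul_apply, Matrix.transpose_apply,
      ContinuousLinearMap.comp_apply, hB]
    rfl
  rw [areaElement, areaElement, hG, hG', Matrix.det_mul, Matrix.det_mul, Matrix.det_transpose]
  have hP : P.det = L.det := LinearMap.det_toMatrix' _
  rw [hP, show L.det * (B.transpose * B).det * L.det = L.det ^ 2 * (B.transpose * B).det by ring,
    Real.sqrt_mul (sq_nonneg _), Real.sqrt_sq_eq_abs]

theorem IsRegularParam.aemeasurable {S : Set (Heis n)} {V : Set (Fin (2 * n) → ℝ)}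
    {ψ : (Fin (2 * n) → ℝ) → Heis n} (h : IsRegularParam S V ψ) :
    AEMeasurable ψ (volume.restrict V) :=
  h.contDiffOn.continuousOn.aemeasurable h.isOpen.measurableSet

theorem IsRegularParam.pieceMeasure_apply {S : Set (Heis n)} {V : Set (Fin (2 * n) → ℝ)}
    {ψ : (Fin (2 * n) → ℝ) → Heis n} (h : IsRegularParam S V ψ) {A : Set (Heis n)}
    (hA : MeasurableSet A) :
    pieceMeasure V ψ A = ∫⁻ v in ψ ⁻¹' A ∩ V, ENNReal.ofReal (areaElement ψ v) := by
  rw [pieceMeasure, Measure.map_apply_of_aemeasurable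
    (h.aemeasurable.mono_ac (withDensity_absolutelyContinuous _ _)) hA, withDensity_apply',
    Measure.restrict_restrict' h.isOpen.measurableSet]

theorem IsRegularParam.measurableSet_preimage {S : Set (Heis n)} {V : Set (Fin (2 * n) → ℝ)}
    {ψ : (Fin (2 * n) → ℝ) → Heis n} (h : IsRegularParam S V ψ) {A : Set (Heis n)}
    (hA : MeasurableSet A) : MeasurableSet (ψ ⁻¹' A ∩ V) := by
  have h1 := (continuousOn_iff_continuous_domRestrict.1 h.contDiffOn.continuousOn).measurable hA
  have h2 := h.isOpen.measurableSet.subtype_image h1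
  rwa [Set.domRestrict_eq, Set.preimage_comp, Subtype.image_preimage_coe, Set.inter_comm] at h2

theorem IsRegularParam.pieceMeasure_compl {S : Set (Heis n)} (hS : MeasurableSet S)
    {V : Set (Fin (2 * n) → ℝ)} {ψ : (Fin (2 * n) → ℝ) → Heis n} (h : IsRegularParam S V ψ) :
    pieceMeasure V ψ Sᶜ = 0 := by
  rw [h.pieceMeasure_apply hS.compl]
  have : ψ ⁻¹' Sᶜ ∩ V = ∅ := by
    ext v
    simp only [Set.mem_inter_iff, Set.mem_preimage, Set.mem_compl_iff, Set.mem_empty_iff_false,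
      iff_false, not_and']
    exact fun hv h2 => h2 (h.mapsTo hv)
  rw [this, Measure.restrict_empty, lintegral_zero_measure]

theorem surfaceMeasure_le {S : Set (Heis n)} {μ : Measure (Heis n)}
    (h : ∀ V ψ, IsRegularParam S V ψ → pieceMeasure V ψ ≤ μ) : surfaceMeasure S ≤ μ :=
  iSup_le fun P => h P.1.1 P.1.2 P.2

theorem pieceMeasure_le_surfaceMeasure {S : Set (Heis n)} {V : Set (Fin (2 * n) → ℝ)}
    {ψ : (Fin (2 * n) → ℝ) → Heis n} (h : IsRegularParam S V ψ) :
    pieceMeasure V ψ ≤ surfaceMeasure S :=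
  le_iSup (fun P : {P : Set (Fin (2 * n) → ℝ) × ((Fin (2 * n) → ℝ) → Heis n) //
    IsRegularParam S P.1 P.2} => pieceMeasure P.1.1 P.1.2) ⟨(V, ψ), h⟩

/-- Every piece is concentrated on `S`, so the least measure dominating all pieces is too.
Integrands then need to be controlled on the boundary only. -/
theorem surfaceMeasure_restrict {S : Set (Heis n)} (hS : MeasurableSet S) :
    (surfaceMeasure S).restrict S = surfaceMeasure S := by
  refine le_antisymm Measure.restrict_le_self (surfaceMeasure_le fun V ψ h => ?_)
  have h1 : (pieceMeasure V ψ).restrict S = pieceMeasure V ψ := by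
    rw [Measure.restrict_eq_self_of_ae_mem]
    exact (h.pieceMeasure_compl hS)
  rw [← h1]
  exact Measure.restrict_mono_measure (pieceMeasure_le_surfaceMeasure h) _

namespace FlatChart

variable {Ω : Set (Heis n)} {e : OpenPartialHomeomorph (Heis n) (Heis n)}

/-- Inside the chart an arbitrary piece factors as `ψ = chartParam e ∘ τ` with `τ` injective and
differentiable. The change of variables formula turns its area into that of a subset of the chart
piece. -/
theorem pieceMeasure_le (h : FlatChart Ω e) (hΩ : IsOpen Ω) {V : Set (Fin (2 * n) → ℝ)}
    {ψ : (Fin (2 * n) → ℝ) → Heis n} (hψ : IsRegularParam (frontier Ω) V ψ) {A : Set (Heis n)}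
    (hA : MeasurableSet A) :
    pieceMeasure V ψ (A ∩ e.source) ≤ pieceMeasure (chartDom e) (chartParam e) A := by
  have hr := h.isRegularParam hΩ
  have hA' := hA.inter e.open_source.measurableSet
  rw [hψ.pieceMeasure_apply hA', hr.pieceMeasure_apply hA]
  set V' := ψ ⁻¹' (A ∩ e.source) ∩ V
  set τ : (Fin (2 * n) → ℝ) → (Fin (2 * n) → ℝ) := fun v => ((split n).symm (e (ψ v))).1
  have hsl : ∀ v ∈ V, ψ v ∈ e.source → slice n (τ v) = e (ψ v) := by
    intro v hv hs
    have h0 : ((split n).symm (e (ψ v))).2 = 0 := by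
      rw [split_symm_snd]
      exact (h.mem_frontier_iff hΩ hs).1 (hψ.mapsTo hv)
    rw [slice_apply, ← h0]
    exact (split n).apply_symm_apply _
  have hdom : ∀ v ∈ V, ψ v ∈ e.source → τ v ∈ chartDom e ∧ chartParam e (τ v) = ψ v := by
    intro v hv hs
    have := hsl v hv hs
    refine ⟨?_, ?_⟩
    · change slice n (τ v) ∈ e.target
      rw [this]; exact e.map_source hs
    · rw [chartParam, this, e.left_inv hs]
  have hψd : ∀ v ∈ V, HasFDerivAt ψ (fderiv ℝ ψ v) v := fun v hv =>
    ((hψ.contDiffOn.contDiffAt (hψ.isOpen.mem_nhds hv)).differentiableAt one_ne_zero).hasFDerivAt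
  set τ' : (Fin (2 * n) → ℝ) → (Fin (2 * n) → ℝ) →L[ℝ] (Fin (2 * n) → ℝ) := fun v =>
    (ContinuousLinearMap.fst ℝ (Fin (2 * n) → ℝ) ℝ).comp (((split n).symm : Heis n →L[ℝ] (Fin (2 * n) → ℝ) × ℝ).comp
      ((fderiv ℝ e (ψ v)).comp (fderiv ℝ ψ v)))
  have hτ : ∀ v ∈ V, ψ v ∈ e.source → HasFDerivAt τ (τ' v) v := fun v hv hs =>
    (ContinuousLinearMap.fst ℝ (Fin (2 * n) → ℝ) ℝ).hasFDerivAt.comp v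
      (((split n).symm : Heis n →L[ℝ] (Fin (2 * n) → ℝ) × ℝ).hasFDerivAt.comp v ((h.hasFDerivAt hs).comp v (hψd v hv)))
  have harea : ∀ v ∈ V, ψ v ∈ e.source →
      areaElement ψ v = |(τ' v).det| * areaElement (chartParam e) (τ v) := by
    intro v hv hs
    have hd := hdom v hv hs
    refine areaElement_comp (τ' v) hd.2.symm ?_
    have h1 : HasFDerivAt (chartParam e ∘ τ) ((fderiv ℝ (chartParam e) (τ v)).comp (τ' v)) v :=
      (h.fderiv_chartParam hd.1).differentiableAt.hasFDerivAt.comp v (hτ v hv hs)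
    refine HasFDerivAt.unique (hψd v hv) (h1.congr_of_eventuallyEq ?_)
    have hc : ContinuousAt ψ v := (hψd v hv).continuousAt
    filter_upwards [hψ.isOpen.mem_nhds hv, hc.preimage_mem_nhds (e.open_source.mem_nhds hs)]
      with w hw hws using (hdom w hw hws).2.symm
  have hV' : MeasurableSet V' := hψ.measurableSet_preimage hA'
  have hinj : Set.InjOn τ V' := by
    intro v hv w hw hvw
    have h1 := (hdom v hv.2 hv.1.2).2
    rw [hvw, (hdom w hw.2 hw.1.2).2] at h1
    exact hψ.injOn hv.2 hw.2 h1.symm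
  calc ∫⁻ v in V', ENNReal.ofReal (areaElement ψ v)
      = ∫⁻ v in V', ENNReal.ofReal |(τ' v).det| *
          ENNReal.ofReal (areaElement (chartParam e) (τ v)) := by
        refine setLIntegral_congr_fun hV' fun v hv => ?_
        rw [harea v hv.2 hv.1.2, ENNReal.ofReal_mul (abs_nonneg _)]
    _ = ∫⁻ v in τ '' V', ENNReal.ofReal (areaElement (chartParam e) v) :=
        (lintegral_image_eq_lintegral_abs_det_fderiv_mul volume hV'
          (fun v hv => (hτ v hv.2 hv.1.2).hasFDerivWithinAt) hinj
          fun v => ENNReal.ofReal (areaElement (chartParam e) v)).symm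
    _ ≤ _ := by
        refine lintegral_mono_set ?_
        rintro _ ⟨v, hv, rfl⟩
        have hd := hdom v hv.2 hv.1.2
        refine ⟨?_, hd.1⟩
        rw [Set.mem_preimage, hd.2]
        exact hv.1.1

theorem surfaceMeasure_restrict_source (h : FlatChart Ω e) (hΩ : IsOpen Ω) :
    (surfaceMeasure (frontier Ω)).restrict e.source
      = pieceMeasure (chartDom e) (chartParam e) := by
  set σ := surfaceMeasure (frontier Ω)
  set c := pieceMeasure (chartDom e) (chartParam e)
  have hr := h.isRegularParam hΩ
  have hs := e.open_source.measurableSet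
  -- The right side dominates every piece: by the chart piece on the source, by `σ` itself off it.
  -- Minimality of `σ` gives the bound.
  have hκ : σ ≤ c + σ.restrict e.sourceᶜ := by
    refine surfaceMeasure_le fun V ψ hψ => Measure.le_iff.2 fun A hA => ?_
    rw [Measure.add_apply, Measure.restrict_apply hA, ← measure_inter_add_sdiff A hs]
    exact add_le_add (h.pieceMeasure_le hΩ hψ hA) (pieceMeasure_le_surfaceMeasure hψ _)
  have hc0 : c e.sourceᶜ = 0 := by
    rw [hr.pieceMeasure_apply hs.compl]
    have : chartParam e ⁻¹' e.sourceᶜ ∩ chartDom e = ∅ := by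
      ext v
      simp only [Set.mem_inter_iff, Set.mem_preimage, Set.mem_compl_iff, Set.mem_empty_iff_false,
        iff_false, not_and']
      exact fun hv h2 => h2 (e.map_target hv)
    rw [this, Measure.restrict_empty, lintegral_zero_measure]
  have hcs : c.restrict e.source = c := Measure.restrict_eq_self_of_ae_mem hc0
  refine le_antisymm ?_ ?_
  · refine (Measure.restrict_mono_measure hκ _).trans ?_
    rw [Measure.restrict_add, Measure.restrict_restrict hs, Set.inter_compl_self,
      Measure.restrict_empty, add_zero, hcs]
  · rw [← hcs]
    exact Measure.restrict_mono_measure (pieceMeasure_le_surfaceMeasure hr) _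

theorem continuousOn_symm_det (h : FlatChart Ω e) :
    ContinuousOn (fun q => |(fderiv ℝ e.symm q).det|) e.target := fun q hq =>
  (continuous_abs.comp ContinuousLinearMap.continuous_det).continuousAt.comp_continuousWithinAt
    ((h.contDiffAt_symm q hq).fderiv_right (m := 0) (by norm_num)).continuousAt.continuousWithinAt

theorem continuousOn_fderiv_chartFun (h : FlatChart Ω e) :
    ContinuousOn (fun g => fderiv ℝ (chartFun e) g) e.source := fun g hg =>
  ((h.contDiffAt_chartFun hg).fderiv_right (m := 0) (by norm_num)).continuousAt.continuousWithinAt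

end FlatChart

theorem continuous_frame (k : HIdx n ⊕ Unit) : Continuous (frame k : Heis n → Heis n) := by
  rcases k with k | k
  · exact continuous_X k
  · exact continuous_const

namespace FlatChart

variable {Ω : Set (Heis n)} {e : OpenPartialHomeomorph (Heis n) (Heis n)}

theorem continuousOn_gradNorm (h : FlatChart Ω e) :
    ContinuousOn (gradNorm (chartFun e)) e.source :=
  (continuousOn_finsetSum _ fun k _ => (h.continuousOn_fderiv_chartFun.clm_apply
    (continuous_frame k).continuousOn).pow 2).sqrt

theorem continuousOn_chartParam : ContinuousOn (chartParam e) (chartDom e) :=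
  e.continuousOn_symm.comp (slice n).continuous.continuousOn fun _ hv => hv

theorem mapsTo_chartParam : Set.MapsTo (chartParam e) (chartDom e) e.source :=
  fun _ hv => e.map_target hv

theorem continuousOn_areaElement (h : FlatChart Ω e) :
    ContinuousOn (areaElement (chartParam e)) (chartDom e) := by
  have h1 : ContinuousOn (fun v => |(fderiv ℝ e.symm (slice n v)).det|) (chartDom e) :=
    h.continuousOn_symm_det.comp (slice n).continuous.continuousOn fun _ hv => hv
  exact (h1.mul (h.continuousOn_gradNorm.comp continuousOn_chartParam mapsTo_chartParam)).congr
    fun v hv => h.areaElement_chartParam hv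

theorem surface_integral (h : FlatChart Ω e) (hΩ : IsOpen Ω) {f : Heis n → ℝ}
    (hf : AEStronglyMeasurable f (surfaceMeasure (frontier Ω))) (h0 : ∀ g ∉ e.source, f g = 0) :
    (IntegrableOn (fun v => areaElement (chartParam e) v * f (chartParam e v)) (chartDom e) →
      Integrable f (surfaceMeasure (frontier Ω))) ∧
    ∫ g, f g ∂(surfaceMeasure (frontier Ω))
      = ∫ v in chartDom e, areaElement (chartParam e) v * f (chartParam e v) := by
  have hr := h.isRegularParam hΩ
  have hdm : AEMeasurable (fun v => ENNReal.ofReal (areaElement (chartParam e) v))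
      (volume.restrict (chartDom e)) :=
    (h.continuousOn_areaElement.aemeasurable isOpen_chartDom.measurableSet).ennreal_ofReal
  have hψm : AEMeasurable (chartParam e) ((volume.restrict (chartDom e)).withDensity
      fun v => ENNReal.ofReal (areaElement (chartParam e) v)) :=
    hr.aemeasurable.mono_ac (withDensity_absolutelyContinuous _ _)
  have hfs := hf.mono_measure (Measure.restrict_le_self (s := e.source))
  rw [h.surfaceMeasure_restrict_source hΩ] at hfs
  have hsub : Function.support f ⊆ e.source := fun g hg => by
    by_contra h'; exact hg (h0 g h')
  have htr : ∀ v, (ENNReal.ofReal (areaElement (chartParam e) v)).toReal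
      = areaElement (chartParam e) v := fun v => ENNReal.toReal_ofReal (Real.sqrt_nonneg _)
  constructor
  · intro hi
    rw [← integrableOn_iff_integrable_of_support_subset hsub, IntegrableOn,
      h.surfaceMeasure_restrict_source hΩ, pieceMeasure, integrable_map_measure hfs hψm,
      integrable_withDensity_iff_integrable_smul₀' hdm
        (Filter.Eventually.of_forall fun _ => ENNReal.ofReal_lt_top)]
    simpa only [htr, smul_eq_mul, Function.comp_apply, IntegrableOn] using hi
  · rw [← setIntegral_eq_integral_of_forall_compl_eq_zero (s := e.source) h0,
      h.surfaceMeasure_restrict_source hΩ, pieceMeasure, integral_map hψm hfs,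
      integral_withDensity_eq_integral_toReal_smul₀ hdm
        (Filter.Eventually.of_forall fun _ => ENNReal.ofReal_lt_top)]
    simp only [htr, smul_eq_mul]

end FlatChart

end Heisenberg


/-! ### Boundary layers -/

theorem continuous_deriv_smoothTransition : Continuous (deriv Real.smoothTransition) :=
  (Real.smoothTransition.contDiff (n := 1)).continuous_deriv le_rfl

theorem deriv_smoothTransition_of_notMem {r : ℝ} (h : r ∉ Set.Icc (0 : ℝ) 1) :
    deriv Real.smoothTransition r = 0 := by
  have h2 : (∀ᶠ x in 𝓝 r, x < 0) ∨ ∀ᶠ x in 𝓝 r, 1 < x := by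
    rcases lt_or_ge r 0 with h0 | h0
    · exact Or.inl (eventually_lt_nhds h0)
    · exact Or.inr (eventually_gt_nhds (not_le.1 fun h1 => h ⟨h0, h1⟩))
  rcases h2 with h2 | h2
  · have : Real.smoothTransition =ᶠ[𝓝 r] fun _ => 0 := by
      filter_upwards [h2] with x hx using Real.smoothTransition.zero_of_nonpos hx.le
    rw [this.deriv_eq]; simp
  · have : Real.smoothTransition =ᶠ[𝓝 r] fun _ => 1 := by
      filter_upwards [h2] with x hx using Real.smoothTransition.one_of_one_le hx.le
    rw [this.deriv_eq]; simp

theorem integral_deriv_smoothTransition : ∫ r, deriv Real.smoothTransition r = 1 := by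
  have h1 : ∫ r in (0 : ℝ)..1, deriv Real.smoothTransition r = 1 := by
    rw [intervalIntegral.integral_deriv_eq_sub' _ rfl
      (fun x _ => (Real.smoothTransition.contDiff (n := 1)).differentiable one_ne_zero x)
      continuous_deriv_smoothTransition.continuousOn]
    simp
  rw [← h1, intervalIntegral.integral_of_le zero_le_one, ← integral_Icc_eq_integral_Ioc,
    setIntegral_eq_integral_of_forall_compl_eq_zero]
  exact fun x hx => deriv_smoothTransition_of_notMem hx

/-- The kernel has integral one in `s` and lives on `-2/(k+1) ≤ s ≤ -1/(k+1)`, so it is an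
approximate identity approaching `s = 0` from below. The substitution `r = -(k+1) s - 1` makes the
kernel independent of `k` and moves the dependence into the continuous function `I`. -/
theorem tendsto_integral_boundary_layer {B : Type*} [TopologicalSpace B] [MeasureSpace B]
    [OpensMeasurableSpace B] [SecondCountableTopology B] [T2Space B] [FirstCountableTopology B]
    [SigmaFinite (volume : Measure B)] [IsLocallyFiniteMeasure (volume : Measure B)]
    {G : B × ℝ → ℝ} (hG : Continuous G) {K : Set B}
    (hK : IsCompact K) (h0 : ∀ v ∉ K, ∀ s, G (v, s) = 0) :
    Filter.Tendsto (fun k : ℕ => ∫ p : B × ℝ,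
        G p * (((k : ℝ) + 1) * deriv Real.smoothTransition (-((k : ℝ) + 1) * p.2 - 1)))
      Filter.atTop (𝓝 (∫ v, G (v, 0))) := by
  set θ' := deriv Real.smoothTransition
  have hθ' : Continuous θ' := continuous_deriv_smoothTransition
  set I : ℝ → ℝ := fun s => ∫ v, G (v, s)
  have hI : Continuous I := by
    have : I = fun s => ∫ v in K, G (v, s) := by
      ext s
      exact (setIntegral_eq_integral_of_forall_compl_eq_zero fun v hv => h0 v hv s).symm
    rw [this]
    exact continuous_parametric_integral_of_continuous (f := fun s v => G (v, s))
      (hG.comp (continuous_snd.prodMk continuous_fst)) hK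
  have hN : ∀ k : ℕ, (0 : ℝ) < (k : ℝ) + 1 := fun k => by positivity
  have hstep : ∀ k : ℕ, ∫ p : B × ℝ, G p * (((k : ℝ) + 1) * θ' (-((k : ℝ) + 1) * p.2 - 1))
      = ∫ r, I (-(r + 1) / ((k : ℝ) + 1)) * θ' r := by
    intro k
    have hc : Continuous fun p : B × ℝ =>
        G p * (((k : ℝ) + 1) * θ' (-((k : ℝ) + 1) * p.2 - 1)) := by fun_prop
    have hs : HasCompactSupport fun p : B × ℝ =>
        G p * (((k : ℝ) + 1) * θ' (-((k : ℝ) + 1) * p.2 - 1)) := by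
      -- The interval `[-2, 0]` contains the support of the kernel for every `k`.
      refine HasCompactSupport.intro (hK.prod (isCompact_Icc (a := (-2 : ℝ)) (b := 0))) ?_
      rintro ⟨v, s⟩ hp
      by_cases hv : v ∈ K
      · have : -((k : ℝ) + 1) * s - 1 ∉ Set.Icc (0 : ℝ) 1 := by
          intro hmem
          refine hp ⟨hv, ?_, ?_⟩
          · change -2 ≤ s
            nlinarith [hmem.2, (Nat.cast_nonneg k : (0 : ℝ) ≤ k)]
          · change s ≤ 0
            nlinarith [hmem.1, hN k]
        simp only [θ', deriv_smoothTransition_of_notMem this, mul_zero]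
      · simp [h0 v hv]
    have hi := hc.integrable_of_hasCompactSupport (μ := (volume : Measure B).prod volume) hs
    have e1 : ∫ p : B × ℝ, G p * (((k : ℝ) + 1) * θ' (-((k : ℝ) + 1) * p.2 - 1))
        = ∫ s : ℝ, I s * (((k : ℝ) + 1) * θ' (-((k : ℝ) + 1) * s - 1)) :=
      (integral_prod_symm _ hi).trans (by simp only [integral_mul_const, I])
    rw [e1]
    set F : ℝ → ℝ := fun r => I (-(r + 1) / ((k : ℝ) + 1)) * θ' r
    have e2 : ∀ s, I s * (((k : ℝ) + 1) * θ' (-((k : ℝ) + 1) * s - 1))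
        = ((k : ℝ) + 1) * (fun y => F (y - 1)) (-((k : ℝ) + 1) * s) := by
      intro s
      have : -(-((k : ℝ) + 1) * s - 1 + 1) / ((k : ℝ) + 1) = s := by
        have := (hN k).ne'
        field_simp
        ring
      simp only [F, this]
      ring
    simp only [e2]
    rw [integral_const_mul, Measure.integral_comp_mul_left (fun y => F (y - 1)),
      integral_sub_right_eq_self F, smul_eq_mul, ← mul_assoc, inv_neg, abs_neg,
      abs_of_pos (inv_pos.2 (hN k)), mul_inv_cancel₀ (hN k).ne', one_mul]
  simp only [hstep]
  have hlim : ∫ v, G (v, 0) = ∫ r, I 0 * θ' r := by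
    rw [integral_const_mul, integral_deriv_smoothTransition, mul_one]
  rw [hlim]
  obtain ⟨M, hM⟩ := (isCompact_Icc (a := (-2 : ℝ)) (b := 0)).exists_bound_of_continuousOn
    hI.continuousOn
  have hM0 : 0 ≤ M := (norm_nonneg _).trans (hM 0 (by norm_num))
  refine tendsto_integral_of_dominated_convergence (fun r => M * ‖θ' r‖)
    (fun k => (by fun_prop : Continuous fun r => I (-(r + 1) / ((k : ℝ) + 1)) * θ' r).aestronglyMeasurable) ?_
    (fun k => Filter.Eventually.of_forall fun r => ?_) (Filter.Eventually.of_forall fun r => ?_)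
  · have : HasCompactSupport θ' := HasCompactSupport.intro (isCompact_Icc (a := (0 : ℝ)) (b := 1))
      fun x hx => deriv_smoothTransition_of_notMem hx
    exact (hθ'.integrable_of_hasCompactSupport this).norm.const_mul M
  · rw [norm_mul]
    by_cases hr : r ∈ Set.Icc (0 : ℝ) 1
    · refine mul_le_mul_of_nonneg_right (hM _ ⟨?_, ?_⟩) (norm_nonneg _)
      · rw [le_div_iff₀ (hN k)]
        nlinarith [hr.2, (Nat.cast_nonneg k : (0 : ℝ) ≤ k)]
      · exact div_nonpos_of_nonpos_of_nonneg (by linarith [hr.1]) (hN k).le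
    · simp [θ', deriv_smoothTransition_of_notMem hr]
  · have h1 : Filter.Tendsto (fun k : ℕ => -(r + 1) / ((k : ℝ) + 1)) Filter.atTop (𝓝 0) := by
      have := (tendsto_one_div_add_atTop_nhds_zero_nat (𝕜 := ℝ)).const_mul (-(r + 1))
      simpa [div_eq_mul_inv] using this
    exact ((hI.tendsto 0).comp h1).mul_const _

/-- Extension by zero: `a` is under control only on the chart domain `O`, while `b` vanishes outside
a closed subset of it. -/
theorem ContinuousOn.mul_of_eq_zero {E : Type*} [TopologicalSpace E] {a b : E → ℝ}
    {s T O : Set E} (hO : IsOpen O) (hT : IsClosed T) (hTO : T ⊆ O) (ha : ContinuousOn a (s ∩ O))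
    (hb : ContinuousOn b s) (h0 : ∀ x ∉ T, b x = 0) : ContinuousOn (fun x => a x * b x) s := by
  intro x hx
  by_cases hxT : x ∈ T
  · have h1 : ContinuousWithinAt a s x :=
      (ha x ⟨hx, hTO hxT⟩).mono_of_mem_nhdsWithin (inter_mem_nhdsWithin _ (hO.mem_nhds (hTO hxT)))
    exact h1.mul (hb x hx)
  · have : (fun x => a x * b x) =ᶠ[𝓝 x] fun _ => 0 := by
      filter_upwards [hT.isOpen_compl.mem_nhds hxT] with y hy
      rw [h0 y hy, mul_zero]
    exact (continuousAt_const.congr this.symm).continuousWithinAt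

/-! ### The divergence theorem inside one chart. -/

namespace Heisenberg

variable {n : ℕ}

/-- The flux density of `χ V` through the level sets of the defining function of a chart. -/
def chartFlux (e : OpenPartialHomeomorph (Heis n) (Heis n)) (χ : Heis n → ℝ)
    (V : HIdx n → Heis n → ℝ) (g : Heis n) : ℝ :=
  ∑ j, fderiv ℝ (chartFun e) g (X j g) * (χ g * V j g)

/-- The flux density in the coordinates of a chart. -/
def modelFlux (e : OpenPartialHomeomorph (Heis n) (Heis n)) (χ : Heis n → ℝ)
    (V : HIdx n → Heis n → ℝ) : Heis n → ℝ :=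
  e.target.indicator fun q => |(fderiv ℝ e.symm q).det| * chartFlux e χ V (e.symm q)

/-- The projection of the model space to the lower half space. -/
def clip (q : Heis n) : Heis n := (q.1, q.2.1, min q.2.2 0)

theorem clip_of_nonpos {q : Heis n} (h : q.2.2 ≤ 0) : clip q = q := by
  simp [clip, min_eq_left h]

theorem continuous_clip : Continuous (clip : Heis n → Heis n) := by
  unfold clip; fun_prop

namespace FlatChart

variable {Ω : Set (Heis n)} {e : OpenPartialHomeomorph (Heis n) (Heis n)}
  {χ : Heis n → ℝ} {V : HIdx n → Heis n → ℝ} {q : Heis n → ℝ}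

theorem continuousOn_chartFun (h : FlatChart Ω e) : ContinuousOn (chartFun e) e.source :=
  fun _ hg => (h.contDiffAt_chartFun hg).continuousAt.continuousWithinAt

theorem chartFlux_eq_zero {g : Heis n} (hg : g ∉ tsupport χ) : chartFlux e χ V g = 0 := by
  simp [chartFlux, image_eq_zero_of_notMem_tsupport hg]

theorem continuousOn_chartFlux (h : FlatChart Ω e) (hχ : Continuous χ)
    (hχs : tsupport χ ⊆ e.source) (hV : ∀ j, ContinuousOn (V j) (closure Ω)) :
    ContinuousOn (chartFlux e χ V) (closure Ω) :=
  continuousOn_finsetSum _ fun j _ =>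
    ContinuousOn.mul_of_eq_zero e.open_source (isClosed_tsupport χ) hχs
      ((h.continuousOn_fderiv_chartFun.clm_apply (continuous_X j).continuousOn).mono
        Set.inter_subset_right)
      (hχ.continuousOn.mul (hV j)) fun x hx => by simp [image_eq_zero_of_notMem_tsupport hx]

theorem modelFlux_eq_zero {p : Heis n} (hp : p ∉ e '' tsupport χ) : modelFlux e χ V p = 0 := by
  by_cases hpt : p ∈ e.target
  · rw [modelFlux, Set.indicator_of_mem hpt, chartFlux_eq_zero, mul_zero]
    exact fun hm => hp ⟨_, hm, e.right_inv hpt⟩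
  · exact Set.indicator_of_notMem hpt _

theorem continuousOn_modelFlux (h : FlatChart Ω e) (hχ : Continuous χ) (hχc : HasCompactSupport χ)
    (hχs : tsupport χ ⊆ e.source) (hV : ∀ j, ContinuousOn (V j) (closure Ω)) :
    ContinuousOn (modelFlux e χ V) {p | p.2.2 ≤ 0} := by
  have hK : IsCompact (e '' tsupport χ) := hχc.isCompact.image_of_continuousOn
    (e.continuousOn.mono hχs)
  have hKt : e '' tsupport χ ⊆ e.target := by
    rintro _ ⟨g, hg, rfl⟩
    exact e.map_source (hχs hg)
  intro p hp
  by_cases hpK : p ∈ e '' tsupport χ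
  · have hpt := hKt hpK
    have h1 : ContinuousWithinAt (fun p => |(fderiv ℝ e.symm p).det| *
        chartFlux e χ V (e.symm p)) ({p | p.2.2 ≤ 0} ∩ e.target) p := by
      refine ((h.continuousOn_symm_det.mono Set.inter_subset_right) p ⟨hp, hpt⟩).mul ?_
      refine ((h.continuousOn_chartFlux hχ hχs hV).comp
        (e.continuousOn_symm.mono Set.inter_subset_right) ?_) p ⟨hp, hpt⟩
      intro p' hp'
      rw [h.mem_closure_iff (e.map_target hp'.2), e.right_inv hp'.2]
      exact hp'.1
    have h2 := h1.mono_of_mem_nhdsWithin (inter_mem_nhdsWithin _ (e.open_target.mem_nhds hpt))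
    refine h2.congr_of_eventuallyEq ?_ (Set.indicator_of_mem hpt _)
    filter_upwards [mem_nhdsWithin_of_mem_nhds (e.open_target.mem_nhds hpt)] with p' hp'
      using Set.indicator_of_mem hp' _
  · have : modelFlux e χ V =ᶠ[𝓝 p] fun _ => 0 := by
      filter_upwards [hK.isClosed.isOpen_compl.mem_nhds hpK] with p' hp' using modelFlux_eq_zero hp'
    exact (continuousAt_const.congr this.symm).continuousWithinAt

/-- The layer function that is `1` inside the domain and vanishes near the boundary. -/
def layer (e : OpenPartialHomeomorph (Heis n) (Heis n)) (k : ℕ) (g : Heis n) : ℝ :=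
  Real.smoothTransition (-((k : ℝ) + 1) * chartFun e g - 1)

theorem contDiffAt_layer (h : FlatChart Ω e) (k : ℕ) {g : Heis n} (hg : g ∈ e.source) :
    ContDiffAt ℝ 2 (layer e k) g :=
  Real.smoothTransition.contDiff.contDiffAt.comp g
    ((contDiffAt_const.mul (h.contDiffAt_chartFun hg)).sub contDiffAt_const)

theorem XD_layer (h : FlatChart Ω e) (k : ℕ) {g : Heis n} (hg : g ∈ e.source) (j : HIdx n) :
    XD j (layer e k) g = -(fderiv ℝ (chartFun e) g (X j g) * (((k : ℝ) + 1) *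
      deriv Real.smoothTransition (-((k : ℝ) + 1) * chartFun e g - 1))) := by
  have h1 : HasFDerivAt (fun g => -((k : ℝ) + 1) * chartFun e g - 1)
      ((-((k : ℝ) + 1)) • fderiv ℝ (chartFun e) g) g :=
    ((((h.contDiffAt_chartFun hg).differentiableAt (by simp)).hasFDerivAt).const_mul _).sub_const 1
  have h2 := ((Real.smoothTransition.contDiff (n := 1)).differentiable one_ne_zero
    (-((k : ℝ) + 1) * chartFun e g - 1)).hasDerivAt.comp_hasFDerivAt g h1
  have h3 : HasFDerivAt (layer e k) _ g := h2
  rw [XD_eq h3.differentiableAt, h3.fderiv]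
  simp only [smul_apply, smul_eq_mul]
  ring

theorem contDiff_mul_layer (h : FlatChart Ω e) (hχ : ContDiff ℝ 1 χ)
    (hχs : tsupport χ ⊆ e.source) (k : ℕ) : ContDiff ℝ 1 fun g => χ g * layer e k g := by
  rw [contDiff_iff_contDiffAt]
  intro g
  by_cases hg : g ∈ tsupport χ
  · exact hχ.contDiffAt.mul ((h.contDiffAt_layer k (hχs hg)).of_le (by norm_num))
  · refine (contDiffAt_const (c := (0 : ℝ))).congr_of_eventuallyEq ?_
    filter_upwards [notMem_tsupport_iff_eventuallyEq.1 hg] with g' hg'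
    simp [hg']

/-- The layer vanishes where the height exceeds `-1/(k+1)`, in particular on a neighbourhood of
every chart point outside `Ω`. Thus `χ` times the layer is an admissible test function even if `χ`
meets the boundary. -/
theorem tsupport_mul_layer_subset (h : FlatChart Ω e) (hχs : tsupport χ ⊆ e.source) (k : ℕ) :
    tsupport (fun g => χ g * layer e k g) ⊆ Ω := by
  intro g hg
  have hgχ : g ∈ tsupport χ := tsupport_mul_subset_left hg
  by_contra hgΩ
  have h0 : 0 ≤ chartFun e g := not_lt.1 fun hlt => hgΩ ((h.mem_iff g (hχs hgχ)).2 hlt)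
  refine absurd hg (notMem_tsupport_iff_eventuallyEq.2 ?_)
  have hk : (0 : ℝ) < (k : ℝ) + 1 := by positivity
  have hlt : -1 / ((k : ℝ) + 1) < chartFun e g :=
    (div_neg_of_neg_of_pos (by norm_num) hk).trans_le h0
  filter_upwards [(h.contDiffAt_chartFun (hχs hgχ)).continuousAt.eventually_const_lt hlt]
    with g' hg'
  rw [div_lt_iff₀ hk] at hg'
  have : layer e k g' = 0 := Real.smoothTransition.zero_of_nonpos (by linarith)
  simp [this]

/-- Change of variables by the inverse chart. The kernel vanishes at nonnegative heights, so
inserting `clip` does not affect the integrand and the integral may be taken over the whole model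
space. -/
theorem integral_chartFlux (h : FlatChart Ω e) (hΩ : IsOpen Ω) (k : ℕ)
    (hχs : tsupport χ ⊆ e.source) :
    ∫ g in Ω, chartFlux e χ V g * (((k : ℝ) + 1) *
        deriv Real.smoothTransition (-((k : ℝ) + 1) * chartFun e g - 1))
      = ∫ p : (Fin (2 * n) → ℝ) × ℝ, modelFlux e χ V (clip (split n p)) * (((k : ℝ) + 1) *
        deriv Real.smoothTransition (-((k : ℝ) + 1) * p.2 - 1)) := by
  set f : Heis n → ℝ := fun g => chartFlux e χ V g * (((k : ℝ) + 1) *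
        deriv Real.smoothTransition (-((k : ℝ) + 1) * chartFun e g - 1))
  set F : Heis n → ℝ := fun p => modelFlux e χ V (clip p) * (((k : ℝ) + 1) *
        deriv Real.smoothTransition (-((k : ℝ) + 1) * p.2.2 - 1))
  have hk : (0 : ℝ) < (k : ℝ) + 1 := by positivity
  have hθ : ∀ s : ℝ, 0 ≤ s → deriv Real.smoothTransition (-((k : ℝ) + 1) * s - 1) = 0 := by
    intro s hs
    refine deriv_smoothTransition_of_notMem fun hm => ?_
    have : -((k : ℝ) + 1) * s ≤ 0 := by nlinarith
    linarith [hm.1]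
  have e1 : ∫ p : (Fin (2 * n) → ℝ) × ℝ, F (split n p) = ∫ p, F p :=
    measurePreserving_splitMeas.integral_comp (splitMeas n).measurableEmbedding F
  have e2 : ∫ g in Ω, f g = ∫ g in e.source, Ω.indicator f g := by
    rw [setIntegral_eq_integral_of_forall_compl_eq_zero (s := e.source),
      integral_indicator hΩ.measurableSet]
    intro g hg
    have : chartFlux e χ V g = 0 := chartFlux_eq_zero fun hm => hg (hχs hm)
    simp [Set.indicator, f, this]
  have e3 := integral_target_eq_integral_abs_det_fderiv_smul (μ := (volume : Measure (Heis n)))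
    (f := e.symm) (fun x hx => h.hasFDerivAt_symm hx) (Ω.indicator f)
  rw [OpenPartialHomeomorph.symm_target, OpenPartialHomeomorph.symm_source] at e3
  rw [e2, e3]
  refine Eq.trans ?_ e1.symm
  rw [← setIntegral_eq_integral_of_forall_compl_eq_zero (s := e.target) (f := F)]
  · refine setIntegral_congr_fun e.open_target.measurableSet fun p hp => ?_
    simp only [smul_eq_mul]
    have hs := e.map_target hp
    by_cases hp0 : p.2.2 < 0
    · have hpΩ : e.symm p ∈ Ω := by rw [h.mem_iff _ hs, e.right_inv hp]; exact hp0
      have hc : chartFun e (e.symm p) = p.2.2 := by rw [chartFun, e.right_inv hp]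
      simp only [F, f, Set.indicator_of_mem hpΩ, clip_of_nonpos hp0.le, modelFlux,
        Set.indicator_of_mem hp, hc]
      ring
    · have hpΩ : e.symm p ∉ Ω := by rw [h.mem_iff _ hs, e.right_inv hp]; exact hp0
      simp only [F, Set.indicator_of_notMem hpΩ, hθ _ (not_lt.1 hp0), mul_zero]
  · intro p hp
    by_cases hp0 : p.2.2 < 0
    · simp only [F, clip_of_nonpos hp0.le, modelFlux, Set.indicator_of_notMem hp, zero_mul]
    · simp only [F, hθ _ (not_lt.1 hp0), mul_zero]

theorem tendsto_integral_chartFlux (h : FlatChart Ω e) (hΩ : IsOpen Ω) (hχ : Continuous χ)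
    (hχc : HasCompactSupport χ) (hχs : tsupport χ ⊆ e.source)
    (hV : ∀ j, ContinuousOn (V j) (closure Ω)) :
    Filter.Tendsto (fun k : ℕ => ∫ g in Ω, chartFlux e χ V g * (((k : ℝ) + 1) *
        deriv Real.smoothTransition (-((k : ℝ) + 1) * chartFun e g - 1)))
      Filter.atTop (𝓝 (∫ v, modelFlux e χ V (slice n v))) := by
  have hK : IsCompact (e '' tsupport χ) := hχc.isCompact.image_of_continuousOn
    (e.continuousOn.mono hχs)
  -- The flux is known to be continuous only up to the boundary from inside; `clip` extends it
  -- continuously to positive heights.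
  have hcont : Continuous fun p : (Fin (2 * n) → ℝ) × ℝ => modelFlux e χ V (clip (split n p)) := by
    rw [← continuousOn_univ]
    exact (h.continuousOn_modelFlux hχ hχc hχs hV).comp
      (continuous_clip.comp (split n).continuous).continuousOn fun p _ =>
        (min_le_right _ _ : min (split n p).2.2 0 ≤ 0)
  have hpr : Continuous fun p : Heis n => ((split n).symm p).1 :=
    continuous_fst.comp (split n).symm.continuous
  have hlim := tendsto_integral_boundary_layer hcont (hK.image hpr) fun v hv s => by
    refine modelFlux_eq_zero fun hm => hv ⟨_, hm, ?_⟩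
    have : clip (split n (v, s)) = split n (v, min s 0) := rfl
    rw [this]
    exact congrArg Prod.fst ((split n).symm_apply_apply (v, min s 0))
  simp only [h.integral_chartFlux hΩ _ hχs]
  have e0 : ∀ v, clip (split n (v, 0)) = slice n v := fun v => clip_of_nonpos le_rfl
  simpa only [e0] using hlim

/-- The weak identity is tested with `χ` times the layer. The derivative falling on the layer gives
minus the flux against the approximate identity, which tends to the boundary integral; elsewhere the
layer tends to one in `Ω`. -/
theorem divergence_chart (h : FlatChart Ω e) (hΩ : IsOpen Ω) (hc : IsCompact (closure Ω))
    (hχ : ContDiff ℝ 1 χ) (hχc : HasCompactSupport χ) (hχs : tsupport χ ⊆ e.source)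
    (hq : ContinuousOn q (closure Ω)) (hV : ∀ j, ContinuousOn (V j) (closure Ω))
    (hw : ∀ φ : Heis n → ℝ, ContDiff ℝ 1 φ → HasCompactSupport φ → tsupport φ ⊆ Ω →
      ∫ g, (φ g * q g + ∑ j, V j g * XD j φ g) = 0) :
    ∫ g in Ω, (χ g * q g + ∑ j, V j g * XD j χ g) = ∫ v, modelFlux e χ V (slice n v) := by
  set R : Heis n → ℝ := fun g => χ g * q g + ∑ j, V j g * XD j χ g
  have hR : ContinuousOn R (closure Ω) := (hχ.continuous.continuousOn.mul hq).add
    (continuousOn_finsetSum _ fun j _ => (hV j).mul (continuous_XD hχ j).continuousOn)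
  have hR0 : ∀ g ∉ tsupport χ, R g = 0 := fun g hg => by
    simp [R, image_eq_zero_of_notMem_tsupport hg, XD_eq_zero_of_notMem_tsupport hg]
  have hint : ∀ {f : Heis n → ℝ}, ContinuousOn f (closure Ω) → IntegrableOn f Ω := fun hf =>
    (hf.integrableOn_compact hc).mono_set subset_closure
  have hlay : ∀ k, ContinuousOn (layer e k) e.source := fun k g hg =>
    (h.contDiffAt_layer k hg).continuousAt.continuousWithinAt
  have hLR : ∀ k, ContinuousOn (fun g => layer e k g * R g) (closure Ω) := fun k =>
    ContinuousOn.mul_of_eq_zero e.open_source (isClosed_tsupport χ) hχs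
      ((hlay k).mono Set.inter_subset_right) hR hR0
  have hF : ∀ k : ℕ, ContinuousOn (fun g => (((k : ℝ) + 1) *
      deriv Real.smoothTransition (-((k : ℝ) + 1) * chartFun e g - 1)) * chartFlux e χ V g)
      (closure Ω) := fun k =>
    ContinuousOn.mul_of_eq_zero e.open_source (isClosed_tsupport χ) hχs
      ((continuousOn_const.mul (continuous_deriv_smoothTransition.comp_continuousOn
        ((continuousOn_const.mul h.continuousOn_chartFun).sub continuousOn_const))).mono
        Set.inter_subset_right)
      (h.continuousOn_chartFlux hχ.continuous hχs hV) fun x hx => chartFlux_eq_zero hx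
  have hkey : ∀ k : ℕ, ∫ g in Ω, chartFlux e χ V g * (((k : ℝ) + 1) *
      deriv Real.smoothTransition (-((k : ℝ) + 1) * chartFun e g - 1))
      = ∫ g in Ω, layer e k g * R g := by
    intro k
    have hs := h.tsupport_mul_layer_subset hχs k
    have h1 := hw _ (h.contDiff_mul_layer hχ hχs k) hχc.mul_right hs
    rw [← setIntegral_eq_integral_of_forall_compl_eq_zero (s := Ω)] at h1
    · have h2 : ∀ g ∈ Ω, (χ g * layer e k g) * q g
          + ∑ j, V j g * XD j (fun g => χ g * layer e k g) g
          = layer e k g * R g - (((k : ℝ) + 1) *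
      deriv Real.smoothTransition (-((k : ℝ) + 1) * chartFun e g - 1)) * chartFlux e χ V g := by
        intro g hg
        by_cases hgs : g ∈ tsupport χ
        · have h3 : ∀ j, XD j (fun g => χ g * layer e k g) g = _ := fun j =>
            XD_mul (hχ.differentiable one_ne_zero g)
              ((h.contDiffAt_layer k (hχs hgs)).differentiableAt (by simp)) j
          simp only [h3, h.XD_layer k (hχs hgs), R, chartFlux, mul_add, Finset.sum_add_distrib,
            Finset.mul_sum]
          rw [add_sub_assoc, ← Finset.sum_sub_distrib, ← Finset.sum_add_distrib]
          congr 1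
          · ring
          · exact Finset.sum_congr rfl fun j _ => by ring
        · have h4 : g ∉ tsupport fun g => χ g * layer e k g := fun hm =>
            hgs (tsupport_mul_subset_left hm)
          simp [image_eq_zero_of_notMem_tsupport hgs, XD_eq_zero_of_notMem_tsupport h4,
            hR0 g hgs, chartFlux_eq_zero hgs]
      rw [setIntegral_congr_fun hΩ.measurableSet h2,
        integral_sub (hint (hLR k)) (hint (hF k)), sub_eq_zero] at h1
      rw [h1]
      exact integral_congr_ae (Filter.Eventually.of_forall fun g => mul_comm _ _)
    · intro g hg
      have h4 : g ∉ tsupport fun g => χ g * layer e k g := fun hm => hg (hs hm)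
      have h5 : χ g * layer e k g = 0 :=
        image_eq_zero_of_notMem_tsupport (f := fun g => χ g * layer e k g) h4
      simp [h5, XD_eq_zero_of_notMem_tsupport h4]
  have hlim1 := h.tendsto_integral_chartFlux hΩ hχ.continuous hχc hχs hV
  simp only [hkey] at hlim1
  have hlim2 : Filter.Tendsto (fun k : ℕ => ∫ g in Ω, layer e k g * R g) Filter.atTop
      (𝓝 (∫ g in Ω, R g)) := by
    refine tendsto_integral_of_dominated_convergence (fun g => ‖R g‖)
      (fun k => (hint (hLR k)).aestronglyMeasurable) (hint hR).norm
      (fun k => Filter.Eventually.of_forall fun g => ?_) ?_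
    · rw [norm_mul]
      refine mul_le_of_le_one_left (norm_nonneg _) ?_
      exact (Real.norm_of_nonneg (Real.smoothTransition.nonneg _)).trans_le
        (Real.smoothTransition.le_one _)
    · filter_upwards [self_mem_ae_restrict hΩ.measurableSet] with g hg
      by_cases hgs : g ∈ tsupport χ
      · have hneg : 0 < -chartFun e g := neg_pos.2 ((h.mem_iff g (hχs hgs)).1 hg)
        refine tendsto_const_nhds.congr' ?_
        -- The layer equals one once `(k+1)` times the depth is at least two.
        obtain ⟨k0, hk0⟩ := exists_nat_gt (2 / -chartFun e g)
        filter_upwards [Filter.eventually_ge_atTop k0] with k hk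
        have h6 : 2 < ((k : ℝ) + 1) * -chartFun e g := by
          rw [← div_lt_iff₀ hneg]
          have : (k0 : ℝ) ≤ k := by exact_mod_cast hk
          linarith
        have : layer e k g = 1 := Real.smoothTransition.one_of_one_le (by linarith)
        rw [this, one_mul]
      · simp [hR0 g hgs]
  exact tendsto_nhds_unique hlim2 hlim1

end FlatChart

end Heisenberg


namespace Heisenberg

variable {n : ℕ}

/-! ### The divergence theorem -/

theorem IsC2Open.exists_chart {Ω : Set (Heis n)} (hΩ : IsC2Open Ω) {p : Heis n}
    (hp : p ∈ frontier Ω) : ∃ e, FlatChart Ω e ∧ p ∈ e.source :=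
  let ⟨_, hφ⟩ := hΩ.2 p hp
  exists_flatChart hφ

theorem continuousOn_NH {Ω : Set (Heis n)} (hΩ : IsC2Open Ω) (j : HIdx n) :
    ContinuousOn (fun g => NH Ω g j) (frontier Ω) := by
  intro p hp
  obtain ⟨e, he, hpe⟩ := hΩ.exists_chart hp
  have h1 : ContinuousAt (fun g => (gradNorm (chartFun e) g)⁻¹ *
      fderiv ℝ (chartFun e) g (X j g)) p :=
    (((he.continuousOn_gradNorm.continuousAt (e.open_source.mem_nhds hpe)).inv₀
      (gradNorm_pos (he.fderiv_chartFun_ne_zero hpe)).ne').mul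
      ((he.continuousOn_fderiv_chartFun.continuousAt (e.open_source.mem_nhds hpe)).clm_apply
        (continuous_X j).continuousAt))
  refine h1.continuousWithinAt.congr_of_eventuallyEq ?_ (he.NH_eq hΩ.1 hpe hp j)
  filter_upwards [self_mem_nhdsWithin, mem_nhdsWithin_of_mem_nhds (e.open_source.mem_nhds hpe)]
    with g hg hge using he.NH_eq hΩ.1 hge hg j

theorem aestronglyMeasurable_surfaceMeasure {Ω : Set (Heis n)} {f : Heis n → ℝ}
    (hf : ContinuousOn f (frontier Ω)) :
    AEStronglyMeasurable f (surfaceMeasure (frontier Ω)) := by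
  rw [← surfaceMeasure_restrict isClosed_frontier.measurableSet]
  exact hf.aestronglyMeasurable isClosed_frontier.measurableSet

theorem surface_integral_flux {Ω : Set (Heis n)} (hΩ : IsC2Open Ω)
    {e : OpenPartialHomeomorph (Heis n) (Heis n)} (h : FlatChart Ω e) {χ : Heis n → ℝ}
    {V : HIdx n → Heis n → ℝ} (hχ : Continuous χ) (hχc : HasCompactSupport χ)
    (hχs : tsupport χ ⊆ e.source) (hV : ∀ j, ContinuousOn (V j) (closure Ω)) :
    Integrable (fun g => χ g * ∑ j, V j g * NH Ω g j) (surfaceMeasure (frontier Ω)) ∧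
    ∫ g, χ g * ∑ j, V j g * NH Ω g j ∂(surfaceMeasure (frontier Ω))
      = ∫ v, modelFlux e χ V (slice n v) := by
  have hm : AEStronglyMeasurable (fun g => χ g * ∑ j, V j g * NH Ω g j)
      (surfaceMeasure (frontier Ω)) :=
    aestronglyMeasurable_surfaceMeasure (hχ.continuousOn.mul (continuousOn_finsetSum _ fun j _ =>
      ((hV j).mono frontier_subset_closure).mul (continuousOn_NH hΩ j)))
  have h0 : ∀ g ∉ e.source, χ g * ∑ j, V j g * NH Ω g j = 0 := fun g hg => by
    rw [image_eq_zero_of_notMem_tsupport fun hm => hg (hχs hm), zero_mul]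
  have hs := h.surface_integral hΩ.1 hm h0
  have he : ∀ v ∈ chartDom e, areaElement (chartParam e) v *
      (χ (chartParam e v) * ∑ j, V j (chartParam e v) * NH Ω (chartParam e v) j)
      = modelFlux e χ V (slice n v) := by
    intro v hv
    have hvs : chartParam e v ∈ e.source := e.map_target hv
    have hvf : chartParam e v ∈ frontier Ω := (h.isRegularParam hΩ.1).mapsTo hv
    have hg := (gradNorm_pos (h.fderiv_chartFun_ne_zero hvs)).ne'
    have hvt : slice n v ∈ e.target := hv
    rw [h.areaElement_chartParam hv, modelFlux, Set.indicator_of_mem hvt, mul_assoc]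
    congr 1
    simp only [h.NH_eq hΩ.1 hvs hvf, chartFlux, Finset.mul_sum]
    refine Finset.sum_congr rfl fun j _ => ?_
    rw [← chartParam]
    field_simp
  have hmc : Continuous fun v => modelFlux e χ V (slice n v) := by
    rw [← continuousOn_univ]
    exact (h.continuousOn_modelFlux hχ hχc hχs hV).comp (slice n).continuous.continuousOn
      fun v _ => (slice_height v).le
  have hK : IsCompact (e '' tsupport χ) := hχc.isCompact.image_of_continuousOn
    (e.continuousOn.mono hχs)
  have hms : HasCompactSupport fun v => modelFlux e χ V (slice n v) := by
    have hpr : Continuous fun p : Heis n => ((split n).symm p).1 :=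
      continuous_fst.comp (split n).symm.continuous
    refine HasCompactSupport.intro (hK.image hpr) fun v hv => FlatChart.modelFlux_eq_zero
      fun hm => hv ⟨_, hm, ?_⟩
    exact congrArg Prod.fst ((split n).symm_apply_apply (v, 0))
  refine ⟨hs.1 ?_, ?_⟩
  · exact ((hmc.integrable_of_hasCompactSupport hms).integrableOn).congr_fun
      (fun v hv => (he v hv).symm) FlatChart.isOpen_chartDom.measurableSet
  · rw [hs.2, setIntegral_congr_fun FlatChart.isOpen_chartDom.measurableSet he,
      setIntegral_eq_integral_of_forall_compl_eq_zero]
    intro v hv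
    exact Set.indicator_of_notMem (s := e.target) hv _

open scoped Manifold ContDiff in
theorem exists_partition {Ω : Set (Heis n)} (hΩ : IsC2Open Ω) (hbdd : Bornology.IsBounded Ω) :
    ∃ (ι : Type) (_ : Fintype ι) (χ : ι → Heis n → ℝ), (∀ i, ContDiff ℝ (⊤ : ℕ∞) (χ i)) ∧
      (∀ i, HasCompactSupport (χ i)) ∧ (∀ g ∈ closure Ω, ∑ i, χ i g = 1) ∧
      ∀ i, tsupport (χ i) ⊆ Ω ∨ ∃ e, FlatChart Ω e ∧ tsupport (χ i) ⊆ e.source := by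
  have hc : IsCompact (closure Ω) := hbdd.isCompact_closure
  have hloc : ∀ p ∈ closure Ω, ∃ U : Set (Heis n), IsOpen U ∧ p ∈ U ∧ Bornology.IsBounded U ∧
      (U ⊆ Ω ∨ ∃ e, FlatChart Ω e ∧ U ⊆ e.source) := by
    intro p hp
    by_cases hpΩ : p ∈ Ω
    · exact ⟨Ω, hΩ.1, hpΩ, hbdd, Or.inl subset_rfl⟩
    · obtain ⟨e, he, hpe⟩ := hΩ.exists_chart (p := p) (by rw [hΩ.1.frontier_eq]; exact ⟨hp, hpΩ⟩)
      -- Intersecting with a ball keeps the neighbourhood bounded, so that the partition functions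
      -- have compact support.
      exact ⟨e.source ∩ Metric.ball p 1, e.open_source.inter Metric.isOpen_ball,
        ⟨hpe, Metric.mem_ball_self one_pos⟩, Metric.isBounded_ball.subset Set.inter_subset_right,
        Or.inr ⟨e, he, Set.inter_subset_left⟩⟩
  choose! U hUo hpU hUb hU using hloc
  obtain ⟨t, ht, htc⟩ := hc.elim_nhds_subcover U fun p hp => (hUo p hp).mem_nhds (hpU p hp)
  obtain ⟨f, hf⟩ := SmoothPartitionOfUnity.exists_isSubordinate 𝓘(ℝ, Heis n)
    (isClosed_closure (s := Ω)) (fun p : t => U p) (fun p => hUo p (ht p p.2)) fun g hg => by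
      obtain ⟨p, hp, hgp⟩ := Set.mem_iUnion₂.1 (htc hg)
      exact Set.mem_iUnion.2 ⟨⟨p, hp⟩, hgp⟩
  refine ⟨t, inferInstance, fun p => f p, fun p => (f p).contMDiff.contDiff, fun p => ?_,
    fun g hg => ?_, fun p => ?_⟩
  · exact Metric.isCompact_of_isClosed_isBounded (isClosed_tsupport _)
      ((hUb p (ht p p.2)).subset (hf p))
  · rw [← f.sum_eq_one hg, finsum_eq_sum_of_fintype]
  · exact (hU p (ht p p.2)).imp (fun h => (hf p).trans h)
      fun ⟨e, he, h⟩ => ⟨e, he, (hf p).trans h⟩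

theorem divergence_theorem {Ω : Set (Heis n)} (hΩ : IsC2Open Ω) (hbdd : Bornology.IsBounded Ω)
    {q : Heis n → ℝ} {V : HIdx n → Heis n → ℝ}
    (hq : ContinuousOn q (closure Ω)) (hV : ∀ j, ContinuousOn (V j) (closure Ω))
    (hw : ∀ φ : Heis n → ℝ, ContDiff ℝ 1 φ → HasCompactSupport φ → tsupport φ ⊆ Ω →
      ∫ g, (φ g * q g + ∑ j, V j g * XD j φ g) = 0) :
    Integrable (fun g => ∑ j, V j g * NH Ω g j) (surfaceMeasure (frontier Ω)) ∧
    ∫ g in Ω, q g = ∫ g, ∑ j, V j g * NH Ω g j ∂(surfaceMeasure (frontier Ω)) := by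
  have hc : IsCompact (closure Ω) := hbdd.isCompact_closure
  set σ := surfaceMeasure (frontier Ω)
  have hσ : ∀ᵐ g ∂σ, g ∈ frontier Ω := by
    have := ae_restrict_mem (μ := σ) (isClosed_frontier (s := Ω)).measurableSet
    rwa [surfaceMeasure_restrict isClosed_frontier.measurableSet] at this
  obtain ⟨ι, _, χ, hχ, hχc, hχ1, hχs⟩ := exists_partition hΩ hbdd
  have hχ' : ∀ i, ContDiff ℝ 1 (χ i) := fun i => contDiff_infty.1 (hχ i) 1
  have hpart : ∀ i, Integrable (fun g => χ i g * ∑ j, V j g * NH Ω g j) σ ∧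
      ∫ g in Ω, (χ i g * q g + ∑ j, V j g * XD j (χ i) g)
        = ∫ g, χ i g * ∑ j, V j g * NH Ω g j ∂σ := by
    intro i
    rcases hχs i with h | ⟨e, he, hs⟩
    · have h0 : (fun g => χ i g * ∑ j, V j g * NH Ω g j) =ᵐ[σ] fun _ => 0 := by
        filter_upwards [hσ] with g hg
        have : g ∉ tsupport (χ i) := fun hm => by
          rw [hΩ.1.frontier_eq] at hg; exact hg.2 (h hm)
        rw [image_eq_zero_of_notMem_tsupport this, zero_mul]
      refine ⟨(integrable_congr h0).2 (integrable_zero _ _ _), ?_⟩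
      rw [integral_congr_ae h0, integral_zero, ← hw _ (hχ' i) (hχc i) h,
        setIntegral_eq_integral_of_forall_compl_eq_zero]
      intro g hg
      have : g ∉ tsupport (χ i) := fun hm => hg (h hm)
      simp [image_eq_zero_of_notMem_tsupport this, XD_eq_zero_of_notMem_tsupport this]
    · have h1 := surface_integral_flux hΩ he (hχ i).continuous (hχc i) hs hV
      exact ⟨h1.1, (he.divergence_chart hΩ.1 hc (hχ' i) (hχc i) hs hq hV hw).trans h1.2.symm⟩
  have hsum : (fun g => ∑ j, V j g * NH Ω g j) =ᵐ[σ]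
      fun g => ∑ i, χ i g * ∑ j, V j g * NH Ω g j := by
    filter_upwards [hσ] with g hg
    rw [← Finset.sum_mul, hχ1 g (frontier_subset_closure hg), one_mul]
  refine ⟨(integrable_congr hsum).2 (integrable_finsetSum _ fun i _ => (hpart i).1), ?_⟩
  rw [integral_congr_ae hsum, integral_finsetSum _ fun i _ => (hpart i).1]
  simp only [← (hpart _).2]
  rw [← integral_finsetSum]
  · refine setIntegral_congr_fun hΩ.1.measurableSet fun g hg => ?_
    -- The partition functions add up to one near `g`, so the terms with derivatives of the cutoffs
    -- cancel upon summation.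
    have h1 : ∀ j, ∑ i, XD j (χ i) g = 0 := by
      intro j
      rw [← XD_sum fun i => (hχ' i).differentiable one_ne_zero g]
      have he : (fun g => ∑ i, χ i g) =ᶠ[𝓝 g] fun _ => 1 := by
        filter_upwards [hΩ.1.mem_nhds hg] with g' hg' using hχ1 g' (subset_closure hg')
      have hd : DifferentiableAt ℝ (fun g => ∑ i, χ i g) g :=
        (differentiableAt_const (1 : ℝ)).congr_of_eventuallyEq he
      rw [XD_eq hd, he.fderiv_eq]
      simp
    simp only [Finset.sum_add_distrib, ← Finset.sum_mul, hχ1 g (subset_closure hg), one_mul]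
    rw [Finset.sum_comm]
    simp only [← Finset.mul_sum, h1, mul_zero, Finset.sum_const_zero, add_zero]
  · intro i _
    have : ContinuousOn (fun g => χ i g * q g + ∑ j, V j g * XD j (χ i) g) (closure Ω) :=
      ((hχ i).continuous.continuousOn.mul hq).add (continuousOn_finsetSum _ fun j _ =>
        (hV j).mul (continuous_XD (hχ' i) j).continuousOn)
    exact (this.integrableOn_compact hc).mono_set subset_closure

end Heisenberg


namespace Heisenberg

variable {n : ℕ}

/-! ### Continuous extension of the second order jet -/

/-- The symmetric reformulation of a bilinear multilinear map as an iterated linear map. -/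
def curryTwo (n : ℕ) : (ContinuousMultilinearMap ℝ (fun _ : Fin 2 => Heis n) ℝ) →
    (Heis n →L[ℝ] Heis n →L[ℝ] ℝ) := fun f =>
  ContinuousLinearMap.comp ((continuousMultilinearCurryFin1 ℝ (Heis n) ℝ).toContinuousLinearEquiv :
    (ContinuousMultilinearMap ℝ (fun _ : Fin 1 => Heis n) ℝ) →L[ℝ] (Heis n →L[ℝ] ℝ))
      (continuousMultilinearCurryLeftEquiv ℝ (fun _ : Fin 2 => Heis n) ℝ f)

theorem continuous_curryTwo : Continuous (curryTwo n) :=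
  continuous_const.clm_comp (LinearIsometryEquiv.continuous _)

theorem MemC2Closure.exists_extension {Ω : Set (Heis n)} {u : Heis n → ℝ}
    (h : MemC2Closure Ω u) : ∃ (D₁ : Heis n → Heis n →L[ℝ] ℝ)
      (D₂ : Heis n → Heis n →L[ℝ] Heis n →L[ℝ] ℝ), ContinuousOn D₁ (closure Ω) ∧
      ContinuousOn D₂ (closure Ω) ∧
      ∀ g ∈ Ω, fderiv ℝ u g = D₁ g ∧ fderiv ℝ (fderiv ℝ u) g = D₂ g := by
  obtain ⟨v1, hv1, he1⟩ := h.2.2 1 (by norm_num)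
  obtain ⟨v2, hv2, he2⟩ := h.2.2 2 le_rfl
  refine ⟨fun g => continuousMultilinearCurryFin1 ℝ (Heis n) ℝ (v1 g), fun g => curryTwo n (v2 g),
    (LinearIsometryEquiv.continuous _).comp_continuousOn hv1,
    continuous_curryTwo.comp_continuousOn hv2, fun g hg => ⟨?_, ?_⟩⟩
  · refine ContinuousLinearMap.ext fun v => ?_
    beta_reduce
    rw [← he1 hg, continuousMultilinearCurryFin1_apply, iteratedFDeriv_one_apply]
    rfl
  · refine ContinuousLinearMap.ext fun v => ContinuousLinearMap.ext fun w => ?_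
    beta_reduce
    rw [← he2 hg]
    change _ = iteratedFDeriv ℝ 2 u g (Fin.cons v (Fin.snoc 0 w))
    rw [iteratedFDeriv_two_apply]
    rfl

/-! ### Differentiability up to the boundary -/

/-- In chart coordinates the domain contains a half ball, which is convex. There the mean value
inequality upgrades a continuous extension of the derivative to differentiability at the boundary,
and the result is carried back by the chart. -/
theorem FlatChart.hasFDerivWithinAt_closure {Ω : Set (Heis n)} {F : Type*} [NormedAddCommGroup F]
    [NormedSpace ℝ F] {e : OpenPartialHomeomorph (Heis n) (Heis n)} (h : FlatChart Ω e)
    (hΩ : IsOpen Ω) {f : Heis n → F} {f' : Heis n → Heis n →L[ℝ] F}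
    (hf : ContinuousOn f (closure Ω)) (hd : ∀ g ∈ Ω, HasFDerivAt f (f' g) g)
    (hf' : ContinuousOn f' (closure Ω)) {p : Heis n} (hp : p ∈ e.source) (hpf : p ∈ frontier Ω) :
    HasFDerivWithinAt f (f' p) (closure Ω) p := by
  have hp0 : (e p).2.2 = 0 := (h.mem_frontier_iff hΩ hp).1 hpf
  have hpt := e.map_source hp
  obtain ⟨r, hr, hball⟩ := Metric.nhds_basis_closedBall.mem_iff.1 (e.open_target.mem_nhds hpt)
  set s : Set (Heis n) := Metric.ball (e p) r ∩ {q | q.2.2 < 0}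
  have hs_open : IsOpen s := Metric.isOpen_ball.inter
    (isOpen_lt height.continuous continuous_const)
  have hs_conv : Convex ℝ s := (convex_ball _ _).inter
    (convex_halfSpace_lt height.toLinearMap.isLinear 0)
  have hcl : closure s ⊆ e.target ∩ {q | q.2.2 ≤ 0} := by
    have h1 : closure s ⊆ Metric.closedBall (e p) r ∩ {q | q.2.2 ≤ 0} :=
      closure_minimal (Set.inter_subset_inter Metric.ball_subset_closedBall fun q hq => by
        simp only [Set.mem_ofPred_eq] at hq ⊢
        exact hq.le)
        (Metric.isClosed_closedBall.inter (isClosed_le height.continuous continuous_const))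
    exact h1.trans (Set.inter_subset_inter_left _ hball)
  have hst : ∀ q ∈ s, q ∈ e.target ∧ e.symm q ∈ Ω := fun q hq => by
    have h1 := hcl (subset_closure hq)
    refine ⟨h1.1, ?_⟩
    rw [h.mem_iff _ (e.map_target h1.1), e.right_inv h1.1]
    exact hq.2
  have hmaps : Set.MapsTo e.symm (e.target ∩ {q | q.2.2 ≤ 0}) (closure Ω) := fun q hq => by
    rw [h.mem_closure_iff (e.map_target hq.1), e.right_inv hq.1]
    exact hq.2
  have hderiv : ∀ q ∈ s, HasFDerivAt (f ∘ e.symm)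
      ((f' (e.symm q)).comp (fderiv ℝ e.symm q)) q := fun q hq =>
    (hd _ (hst q hq).2).comp q (h.hasFDerivAt_symm (hst q hq).1)
  have hes : ContinuousOn e.symm (e.target ∩ {q | q.2.2 ≤ 0}) :=
    e.continuousOn_symm.mono Set.inter_subset_left
  have hcont : ContinuousOn (f ∘ e.symm) (e.target ∩ {q | q.2.2 ≤ 0}) := hf.comp hes hmaps
  have hpm : e p ∈ e.target ∩ {q | q.2.2 ≤ 0} := ⟨hpt, hp0.le⟩
  have hlim : ContinuousWithinAt (fun q => (f' (e.symm q)).comp (fderiv ℝ e.symm q))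
      (e.target ∩ {q | q.2.2 ≤ 0}) (e p) := by
    refine ((hf'.comp hes hmaps) _ hpm).clm_comp ?_
    exact ((h.contDiffAt_symm _ hpt).fderiv_right (m := 0) (by norm_num)).continuousAt.continuousWithinAt
  have hext := hasFDerivWithinAt_closure_of_tendsto_fderiv
    (fun q hq => (hderiv q hq).differentiableAt.differentiableWithinAt) hs_conv hs_open
    (fun q hq => (hcont q (hcl hq)).mono (subset_closure.trans hcl))
    (((hlim.mono (subset_closure.trans hcl)).tendsto).congr' (by
      filter_upwards [self_mem_nhdsWithin] with q hq using (hderiv q hq).fderiv.symm))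
  -- Pushing points down shows that the closed half ball is a full neighbourhood of `e p` in the
  -- closed half space.
  have hnhds : closure s ∈ 𝓝[{q : Heis n | q.2.2 ≤ 0}] (e p) := by
    refine Filter.mem_of_superset (inter_mem_nhdsWithin _ (Metric.ball_mem_nhds (e p) hr)) ?_
    rintro q ⟨hq0, hqb⟩
    have hl : Filter.Tendsto (fun t : ℝ => q + t • ((0, 0, -1) : Heis n)) (𝓝[>] 0) (𝓝 q) := by
      have : Continuous fun t : ℝ => q + t • ((0, 0, -1) : Heis n) := by fun_prop
      have h0 := this.tendsto 0
      simp only [zero_smul, add_zero] at h0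
      exact h0.mono_left nhdsWithin_le_nhds
    refine mem_closure_of_tendsto hl ?_
    filter_upwards [hl.eventually (Metric.isOpen_ball.mem_nhds hqb), self_mem_nhdsWithin]
      with t ht (ht0 : 0 < t)
    refine ⟨ht, ?_⟩
    have : q.2.2 ≤ 0 := hq0
    simp
    linarith
  have hext2 := hext.mono_of_mem_nhdsWithin hnhds
  have hcomp := hext2.comp p (h.hasFDerivAt hp).hasFDerivWithinAt
    (s := closure Ω ∩ e.source) (t := {q : Heis n | q.2.2 ≤ 0}) fun g hg =>
      (h.mem_closure_iff hg.2).1 hg.1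
  have hL : ((f' (e.symm (e p))).comp (fderiv ℝ e.symm (e p))).comp (fderiv ℝ e p) = f' p := by
    refine ContinuousLinearMap.ext fun v => ?_
    have := h.fderiv_symm_comp hpt v
    rw [e.left_inv hp] at this
    simp [e.left_inv hp, this]
  rw [hL] at hcomp
  have h3 := hcomp.mono_of_mem_nhdsWithin (s := closure Ω)
    (inter_mem_nhdsWithin _ (e.open_source.mem_nhds hp))
  refine h3.congr_of_eventuallyEq ?_ (by simp [e.left_inv hp])
  filter_upwards [mem_nhdsWithin_of_mem_nhds (e.open_source.mem_nhds hp)] with g hg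
  simp [e.left_inv hg]

/-- A tangent vector is the velocity of a straight line in the flattened boundary, along which `f`
vanishes. -/
theorem FlatChart.apply_eq_zero_of_tangent {Ω : Set (Heis n)}
    {e : OpenPartialHomeomorph (Heis n) (Heis n)} (h : FlatChart Ω e) (hΩ : IsOpen Ω)
    {f : Heis n → ℝ} {f' : Heis n →L[ℝ] ℝ} {p : Heis n} (hp : p ∈ e.source)
    (hpf : p ∈ frontier Ω) (hd : HasFDerivWithinAt f f' (frontier Ω) p)
    (h0 : ∀ᶠ g in 𝓝[frontier Ω] p, f g = 0) {v : Heis n}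
    (hv : fderiv ℝ (chartFun e) p v = 0) : f' v = 0 := by
  have hp0 : (e p).2.2 = 0 := (h.mem_frontier_iff hΩ hp).1 hpf
  have hpt := e.map_source hp
  set w := fderiv ℝ e p v
  have hw : w.2.2 = 0 := by rw [← h.fderiv_chartFun hp]; exact hv
  have hline : Continuous fun t : ℝ => e p + t • w := by fun_prop
  set S : Set ℝ := {t | e p + t • w ∈ e.target}
  have hS : S ∈ 𝓝 (0 : ℝ) := (e.open_target.preimage hline).mem_nhds (by
    simpa using hpt)
  set γ : ℝ → Heis n := fun t => e.symm (e p + t • w)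
  have hγ0 : γ 0 = p := by simp [γ, e.left_inv hp]
  have hγS : Set.MapsTo γ S (frontier Ω) := fun t ht => by
    rw [h.mem_frontier_iff hΩ (e.map_target ht), e.right_inv ht]
    simp [hp0, hw]
  have hγ' : HasDerivAt γ v 0 := by
    have h1 : HasDerivAt (fun t : ℝ => e p + t • w) w 0 := by
      simpa using ((hasDerivAt_id (0 : ℝ)).smul_const w).const_add (e p)
    have h2 : HasFDerivAt e.symm (fderiv ℝ e.symm (e p)) (e p + (0 : ℝ) • w) := by
      have := h.hasFDerivAt_symm hpt
      simpa using this
    have h3 := h2.comp_hasDerivAt (0 : ℝ) h1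
    have h4 := h.fderiv_symm_comp hpt v
    rw [e.left_inv hp] at h4
    have h5 : fderiv ℝ e.symm (e p) w = v := h4
    rw [h5] at h3
    exact h3
  rw [← hγ0] at hd
  have hcomp := (hd.comp_hasDerivWithinAt (0 : ℝ) hγ'.hasDerivWithinAt hγS).hasDerivAt hS
  have hzero : f ∘ γ =ᶠ[𝓝 0] fun _ => 0 := by
    have ht : Filter.Tendsto γ (𝓝 0) (𝓝[frontier Ω] p) := by
      refine tendsto_nhdsWithin_iff.2 ⟨?_, ?_⟩
      · have := hγ'.continuousAt.tendsto
        rwa [hγ0] at this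
      · filter_upwards [hS] with t ht using hγS ht
    exact ht.eventually h0
  have := hcomp.unique ((hasDerivAt_const (0 : ℝ) (0 : ℝ)).congr_of_eventuallyEq hzero)
  exact this

theorem eq_smul_of_ker_le {E : Type*} [AddCommGroup E] [Module ℝ E] {ℓ m : E →ₗ[ℝ] ℝ}
    (h : ∀ v, ℓ v = 0 → m v = 0) : ∃ c : ℝ, ∀ v, m v = c * ℓ v := by
  by_cases h0 : ∃ w, ℓ w ≠ 0
  · obtain ⟨w, hw⟩ := h0
    refine ⟨m w / ℓ w, fun v => ?_⟩
    have := h (v - (ℓ v / ℓ w) • w) (by simp [hw])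
    simp only [map_sub, map_smul, smul_eq_mul, sub_eq_zero] at this
    rw [this]
    ring
  · push Not at h0
    exact ⟨0, fun v => by rw [h v (h0 v), zero_mul]⟩

/-- The first order data of a function that vanishes on the boundary. -/
theorem exists_eq_mul_NH {Ω : Set (Heis n)} (hΩ : IsC2Open Ω) {u : Heis n → ℝ}
    (hu : ContinuousOn u (closure Ω)) {D₁ : Heis n → Heis n →L[ℝ] ℝ}
    (hd : ∀ g ∈ Ω, HasFDerivAt u (D₁ g) g) (hD₁ : ContinuousOn D₁ (closure Ω))
    (h0 : ∀ g ∈ frontier Ω, u g = 0) {p : Heis n} (hp : p ∈ frontier Ω) :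
    ∃ c : ℝ, ∀ i, D₁ p (X i p) = c * NH Ω p i := by
  obtain ⟨e, he, hpe⟩ := hΩ.exists_chart hp
  have h1 := (he.hasFDerivWithinAt_closure hΩ.1 hu hd hD₁ hpe hp).mono frontier_subset_closure
  obtain ⟨c, hc⟩ := eq_smul_of_ker_le (ℓ := (fderiv ℝ (chartFun e) p).toLinearMap)
    (m := (D₁ p).toLinearMap) fun v hv => he.apply_eq_zero_of_tangent hΩ.1 hpe hp h1
      (by filter_upwards [self_mem_nhdsWithin] with g hg using h0 g hg) hv
  have hg := (gradNorm_pos (he.fderiv_chartFun_ne_zero hpe)).ne'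
  refine ⟨c * gradNorm (chartFun e) p, fun i => ?_⟩
  rw [he.NH_eq hΩ.1 hpe hp]
  have := hc (X i p)
  simp only [ContinuousLinearMap.coe_coe] at this
  rw [this]
  field_simp

/-! ### Horizontal tangent frames and the mean curvature -/

theorem angle_sq (Ω : Set (Heis n)) (p : Heis n) : angle Ω p ^ 2 = ∑ j, NH Ω p j ^ 2 :=
  Real.sq_sqrt (Finset.sum_nonneg fun _ _ => sq_nonneg _)

theorem sum_nuH_sq {Ω : Set (Heis n)} {p : Heis n} (h : angle Ω p ≠ 0) :
    ∑ k, nuH Ω p k * nuH Ω p k = 1 := by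
  have : ∀ k, nuH Ω p k * nuH Ω p k = NH Ω p k ^ 2 / angle Ω p ^ 2 := fun k => by
    rw [nuH]; field_simp
  simp only [this, ← Finset.sum_div, ← angle_sq]
  exact div_self (pow_ne_zero 2 h)

/-- Reflecting a unit vector to a coordinate axis gives an orthonormal basis of its orthogonal
complement. -/
theorem householder {ι : Type*} [Fintype ι] [DecidableEq ι] {ν : ι → ℝ} {k₀ : ι} {s : ℝ}
    (hν : ∑ k, ν k * ν k = 1) (hs : s * s = 1) (hD : 1 + s * ν k₀ ≠ 0) :
    (∀ a b : ι, a ≠ k₀ → b ≠ k₀ →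
      ∑ k, ((Pi.single a 1 : ι → ℝ) k - (ν k + s * (Pi.single k₀ 1 : ι → ℝ) k) * (ν a / (1 + s * ν k₀)))
        * ((Pi.single b 1 : ι → ℝ) k - (ν k + s * (Pi.single k₀ 1 : ι → ℝ) k) * (ν b / (1 + s * ν k₀)))
        = if a = b then 1 else 0) ∧
    ∀ a : ι, a ≠ k₀ →
      ∑ k, ((Pi.single a 1 : ι → ℝ) k - (ν k + s * (Pi.single k₀ 1 : ι → ℝ) k) * (ν a / (1 + s * ν k₀)))
        * ν k = 0 := by
  have hS : ∀ (a : ι) (f : ι → ℝ), ∑ k, (Pi.single a 1 : ι → ℝ) k * f k = f a := fun a f => by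
    simp [Pi.single_apply]
  have hS' : ∀ a b : ι, a ≠ b → (Pi.single b 1 : ι → ℝ) a = 0 := fun a b h => by
    simp [h]
  constructor
  · intro a b ha hb
    set α := ν a / (1 + s * ν k₀) with hα
    set β := ν b / (1 + s * ν k₀) with hβ
    have e1 : ∀ k, ((Pi.single a 1 : ι → ℝ) k - (ν k + s * (Pi.single k₀ 1 : ι → ℝ) k) * α)
        * ((Pi.single b 1 : ι → ℝ) k - (ν k + s * (Pi.single k₀ 1 : ι → ℝ) k) * β)
      = (Pi.single a 1 : ι → ℝ) k * (Pi.single b 1 : ι → ℝ) k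
        - β * ((Pi.single a 1 : ι → ℝ) k * (ν k + s * (Pi.single k₀ 1 : ι → ℝ) k))
        - α * ((Pi.single b 1 : ι → ℝ) k * (ν k + s * (Pi.single k₀ 1 : ι → ℝ) k))
        + α * β * (ν k * ν k) + 2 * α * β * s * ((Pi.single k₀ 1 : ι → ℝ) k * ν k)
        + α * β * (s * s) * ((Pi.single k₀ 1 : ι → ℝ) k * (Pi.single k₀ 1 : ι → ℝ) k) :=
      fun k => by ring
    simp only [e1, Finset.sum_add_distrib, Finset.sum_sub_distrib, ← Finset.mul_sum, hS, hν, hs,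
      hS' a k₀ ha, hS' b k₀ hb]
    have h1 : ν a = α * (1 + s * ν k₀) := by rw [hα]; field_simp
    have h2 : ν b = β * (1 + s * ν k₀) := by rw [hβ]; field_simp
    rw [h1, h2]
    simp only [Pi.single_apply, if_true]
    ring
  · intro a ha
    have e1 : ∀ k, ((Pi.single a 1 : ι → ℝ) k
        - (ν k + s * (Pi.single k₀ 1 : ι → ℝ) k) * (ν a / (1 + s * ν k₀))) * ν k
      = (Pi.single a 1 : ι → ℝ) k * ν k - (ν a / (1 + s * ν k₀)) * (ν k * ν k)
        - (ν a / (1 + s * ν k₀)) * s * ((Pi.single k₀ 1 : ι → ℝ) k * ν k) := fun k => by ring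
    simp only [e1, Finset.sum_sub_distrib, ← Finset.mul_sum, hS, hν]
    field_simp
    ring

/-- Without a frame `meanCurvNonchar` would be the default value zero. The normalized horizontal
gradient of the height function is a `C¹` extension of the Gauss map off the boundary, and a
Householder reflection completes it to a frame. -/
theorem exists_horizontalTangentFrame (hn : 1 ≤ n) {Ω : Set (Heis n)} (hΩ : IsC2Open Ω)
    {p : Heis n} (hp : p ∈ frontier Ω) (hW : angle Ω p ≠ 0) :
    ∃ f, IsHorizontalTangentFrame Ω p f := by
  obtain ⟨e, he, hpe⟩ := hΩ.exists_chart hp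
  set a : HIdx n → Heis n → ℝ := fun k g => fderiv ℝ (chartFun e) g (X k g)
  set r : Heis n → ℝ := fun g => ∑ k, a k g ^ 2
  have hNH : ∀ g ∈ e.source, g ∈ frontier Ω → ∀ k,
      NH Ω g k = (gradNorm (chartFun e) g)⁻¹ * a k g := fun g hg hgf k => he.NH_eq hΩ.1 hg hgf k
  have hgr := gradNorm_pos (he.fderiv_chartFun_ne_zero hpe)
  have ha : ∀ k, ContDiffAt ℝ 1 (a k) p := fun k =>
    ((he.contDiffAt_chartFun hpe).fderiv_right (m := 1) (by norm_num)).clm_apply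
      (contDiff_X k).contDiffAt
  have hr : ContDiffAt ℝ 1 r p := ContDiffAt.sum fun k _ => (ha k).pow 2
  have hr0 : r p ≠ 0 := by
    intro h0
    apply hW
    have h1 := (Finset.sum_eq_zero_iff_of_nonneg fun k _ => sq_nonneg (a k p)).1 h0
    have h2 : angle Ω p ^ 2 = 0 := by
      rw [angle_sq]
      refine Finset.sum_eq_zero fun k hk => ?_
      rw [hNH p hpe hp, (pow_eq_zero_iff two_ne_zero).1 (h1 k hk)]
      ring
    exact (pow_eq_zero_iff two_ne_zero).1 h2
  set ν : HIdx n → Heis n → ℝ := fun k g => a k g / √(r g)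
  have hν : ∀ k, ContDiffAt ℝ 1 (ν k) p := fun k =>
    (ha k).div (hr.sqrt hr0) (Real.sqrt_ne_zero'.2
      (lt_of_le_of_ne (Finset.sum_nonneg fun _ _ => sq_nonneg _) hr0.symm))
  set k₀ : HIdx n := Sum.inl ⟨0, hn⟩
  -- The sign is chosen so that the denominator `1 + s ν_{k₀}` is at least one at `p`.
  obtain ⟨s, hs, hsν⟩ : ∃ s : ℝ, s * s = 1 ∧ 0 ≤ s * ν k₀ p := by
    rcases le_total 0 (ν k₀ p) with h | h
    · exact ⟨1, by norm_num, by linarith⟩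
    · exact ⟨-1, by norm_num, by linarith⟩
  have hD : ContDiffAt ℝ 1 (fun g => 1 + s * ν k₀ g) p :=
    contDiffAt_const.add (contDiffAt_const.mul (hν k₀))
  have hD0 : (1 + s * ν k₀ p) ≠ 0 := by positivity
  have hcard : Fintype.card {k : HIdx n // k ≠ k₀} = 2 * n - 1 := by
    rw [Fintype.card_subtype_compl, Fintype.card_subtype_eq]
    simp
    omega
  set ε := (Fintype.equivFinOfCardEq hcard).symm
  refine ⟨fun b g k => (Pi.single (ε b : HIdx n) 1 : HIdx n → ℝ) k
    - (ν k g + s * (Pi.single k₀ 1 : HIdx n → ℝ) k) * (ν (ε b) g / (1 + s * ν k₀ g)), ?_, ?_⟩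
  · intro b
    rw [contDiffAt_pi]
    intro k
    exact contDiffAt_const.sub (((hν k).add contDiffAt_const).mul ((hν (ε b)).div hD hD0))
  · filter_upwards [self_mem_nhdsWithin, mem_nhdsWithin_of_mem_nhds (e.open_source.mem_nhds hpe),
      mem_nhdsWithin_of_mem_nhds (hr.continuousAt.eventually_ne hr0),
      mem_nhdsWithin_of_mem_nhds (hD.continuousAt.eventually_ne hD0)] with g hgf hge hgr hgD
    have hgr : r g ≠ 0 := hgr
    have hgD : 1 + s * ν k₀ g ≠ 0 := hgD
    have hr_nonneg : 0 ≤ r g := Finset.sum_nonneg fun _ _ => sq_nonneg _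
    have hsq : √(r g) ≠ 0 := Real.sqrt_ne_zero'.2 (lt_of_le_of_ne hr_nonneg hgr.symm)
    have hunit : ∑ k, ν k g * ν k g = 1 := by
      have : ∀ k, ν k g * ν k g = a k g ^ 2 / r g := fun k => by
        rw [← sq, div_pow, Real.sq_sqrt hr_nonneg]
      simp only [this, ← Finset.sum_div]
      exact div_self hgr
    obtain ⟨H1, H2⟩ := householder (ν := fun k => ν k g) (k₀ := k₀) hunit hs hgD
    refine ⟨fun b c => ?_, fun b => ?_⟩
    · rw [H1 _ _ (ε b).2 (ε c).2]
      simp [Subtype.coe_inj]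
    · have h3 : ∀ k, NH Ω g k = ((gradNorm (chartFun e) g)⁻¹ * √(r g)) * ν k g := fun k => by
        rw [hNH g hge hgf]
        simp only [ν]
        field_simp
      simp only [h3]
      rw [← mul_zero ((gradNorm (chartFun e) g)⁻¹ * √(r g)), ← H2 _ (ε b).2, Finset.mul_sum]
      exact Finset.sum_congr rfl fun k _ => by ring

/-- The frame vectors and `ν^H` are the rows of a square matrix with orthonormal rows, hence also
with orthonormal columns. This completeness relation makes the tangential trace independent of the
frame. -/
theorem sum_frame_mul {Ω : Set (Heis n)} (hn : 1 ≤ n) {p : Heis n} (hW : angle Ω p ≠ 0)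
    {f : Fin (2 * n - 1) → HIdx n → ℝ}
    (h1 : ∀ a b, ∑ k, f a k * f b k = if a = b then 1 else 0)
    (h2 : ∀ a, ∑ k, f a k * NH Ω p k = 0) (j k : HIdx n) :
    ∑ a, f a j * f a k = (if j = k then 1 else 0) - nuH Ω p j * nuH Ω p k := by
  set M : Matrix (Fin (2 * n - 1) ⊕ Unit) (HIdx n) ℝ :=
    Matrix.of (Sum.elim f fun _ => nuH Ω p)
  have h3 : ∀ a, ∑ k, f a k * nuH Ω p k = 0 := fun a => by
    simp only [nuH, ← mul_div_assoc, ← Finset.sum_div, h2, zero_div]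
  have h3' : ∀ a, ∑ k, nuH Ω p k * f a k = 0 := fun a => by
    rw [← h3 a]; exact Finset.sum_congr rfl fun _ _ => mul_comm _ _
  have hM : M * M.transpose = 1 := by
    ext a b
    rw [Matrix.mul_apply, Matrix.one_apply]
    rcases a with a | a <;> rcases b with b | b
    · simp [M, h1]
    · simp [M, h3]
    · simp [M, h3']
    · simp [M, sum_nuH_sq hW]
  have hcard : Fintype.card (Fin (2 * n - 1) ⊕ Unit) = Fintype.card (HIdx n) := by
    simp
    omega
  have hM' := (Matrix.mul_eq_one_comm_of_equiv (Fintype.equivOfCardEq hcard)).1 hM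
  have h4 := congrFun (congrFun hM' j) k
  rw [Matrix.mul_apply, Matrix.one_apply, Fintype.sum_sum_type] at h4
  simp [M] at h4
  linarith

end Heisenberg


namespace Heisenberg

variable {n : ℕ}

/-! ### The boundary integrand -/

/-- Differentiating the relation `e u = 0` along a horizontal tangent field `e`. -/
theorem sum_nablaH_add_sum_jH {Ω : Set (Heis n)} (hΩ : IsC2Open Ω) {u : Heis n → ℝ}
    (hu : ContinuousOn u (closure Ω)) {D₁ : Heis n → Heis n →L[ℝ] ℝ}
    {D₂ : Heis n → Heis n →L[ℝ] Heis n →L[ℝ] ℝ}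
    (hd₁ : ∀ g ∈ Ω, HasFDerivAt u (D₁ g) g) (hd₂ : ∀ g ∈ Ω, HasFDerivAt D₁ (D₂ g) g)
    (hD₁ : ContinuousOn D₁ (closure Ω)) (hD₂ : ContinuousOn D₂ (closure Ω))
    (h0 : ∀ g ∈ frontier Ω, u g = 0) {p : Heis n} (hp : p ∈ frontier Ω)
    {ζ : Heis n → HIdx n → ℝ} (hζ : ContDiffAt ℝ 1 ζ p)
    (hζN : ∀ᶠ g in 𝓝[frontier Ω] p, ∑ k, ζ g k * NH Ω g k = 0) :
    ∑ k, nablaH (ζ p) ζ p k * jU (p, D₁ p, D₂ p) k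
      + ∑ k, ∑ j, ζ p j * ζ p k * jH (p, D₁ p, D₂ p) j k = 0 := by
  obtain ⟨e, he, hpe⟩ := hΩ.exists_chart hp
  have hζk : ∀ k, DifferentiableAt ℝ (fun g => ζ g k) p := fun k =>
    (contDiffAt_pi.1 hζ k).differentiableAt (by simp)
  have hD : HasFDerivWithinAt D₁ (D₂ p) (frontier Ω) p :=
    (he.hasFDerivWithinAt_closure hΩ.1 hD₁ hd₂ hD₂ hpe hp).mono frontier_subset_closure
  have hF := HasFDerivWithinAt.fun_sum (u := Finset.univ) fun k (_ : k ∈ Finset.univ) =>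
    (hζk k).hasFDerivAt.hasFDerivWithinAt.mul
      (hD.clm_apply (hasFDerivAt_X k p).hasFDerivWithinAt)
  have hF0 : ∀ᶠ g in 𝓝[frontier Ω] p, ∑ k, ζ g k * D₁ g (X k g) = 0 := by
    filter_upwards [hζN, self_mem_nhdsWithin] with g hg hgf
    obtain ⟨c, hc⟩ := exists_eq_mul_NH hΩ hu hd₁ hD₁ h0 hgf
    rw [← mul_zero c, ← hg, Finset.mul_sum]
    exact Finset.sum_congr rfl fun k _ => by rw [hc]; ring
  -- The vector `ζ(p)` is tangent to the boundary, so the function `Σ ζ_k X_k u`, which is zero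
  -- there, can be differentiated along it.
  have hv : fderiv ℝ (chartFun e) p (∑ j, ζ p j • X j p) = 0 := by
    have h1 := hζN.self_of_nhdsWithin hp
    simp only [he.NH_eq hΩ.1 hpe hp] at h1
    have hg := (gradNorm_pos (he.fderiv_chartFun_ne_zero hpe)).ne'
    rw [map_sum]
    simp only [map_smul, smul_eq_mul]
    rw [← mul_right_inj' (inv_ne_zero hg), mul_zero, ← h1, Finset.mul_sum]
    exact Finset.sum_congr rfl fun k _ => by ring
  have hz := he.apply_eq_zero_of_tangent hΩ.1 hpe hp hF hF0 hv
  rw [← hz, sum_apply, ← Finset.sum_add_distrib]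
  refine Finset.sum_congr rfl fun k _ => ?_
  have hX : ∀ j, XD j (fun g => ζ g k) p = fderiv ℝ (fun g => ζ g k) p (X j p) := fun j =>
    XD_eq (hζk k) j
  simp only [nablaH, hX, jU, jH, add_apply, smul_apply,
    ContinuousLinearMap.comp_apply, ContinuousLinearMap.flip_apply, map_sum, map_smul,
    smul_eq_mul, Finset.sum_mul]
  simp only [← Finset.sum_add_distrib]
  exact Finset.sum_congr rfl fun j _ => by ring

theorem sum_comm_mul_mul {U : HIdx n → ℝ} : ∑ j, ∑ i, comm i j * U i * U j = 0 := by
  have h : ∑ j, ∑ i, comm i j * U i * U j = -∑ j, ∑ i, comm i j * U i * U j := by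
    conv_lhs => rw [Finset.sum_comm]
    simp only [← Finset.sum_neg_distrib]
    exact Finset.sum_congr rfl fun j _ => Finset.sum_congr rfl fun i _ => by
      rw [comm_swap]; ring
  linarith

/-- With `∇_H u = c W ν`, the left side is `c W²` times the tangential trace of `X_j X_k u`, and the
differentiated tangency relations identify this trace with `c W 𝓗`. -/
theorem sum_jV_mul_NH (hn : 1 ≤ n) {Ω : Set (Heis n)} (hΩ : IsC2Open Ω) {u : Heis n → ℝ}
    (hu : ContinuousOn u (closure Ω)) {D₁ : Heis n → Heis n →L[ℝ] ℝ}
    {D₂ : Heis n → Heis n →L[ℝ] Heis n →L[ℝ] ℝ}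
    (hd₁ : ∀ g ∈ Ω, HasFDerivAt u (D₁ g) g) (hd₂ : ∀ g ∈ Ω, HasFDerivAt D₁ (D₂ g) g)
    (hD₁ : ContinuousOn D₁ (closure Ω)) (hD₂ : ContinuousOn D₂ (closure Ω))
    (h0 : ∀ g ∈ frontier Ω, u g = 0) {p : Heis n} (hp : p ∈ frontier Ω) :
    ∑ j, jV (p, D₁ p, D₂ p) j * NH Ω p j
      = angle Ω p * (meanCurv Ω p * ∑ i, jU (p, D₁ p, D₂ p) i ^ 2) := by
  set z : Jet n := (p, D₁ p, D₂ p)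
  -- At characteristic points both sides vanish, whatever value `meanCurv` has there.
  by_cases hW : angle Ω p = 0
  · have h1 : ∑ j, NH Ω p j ^ 2 = 0 := by rw [← angle_sq, hW]; ring
    have h2 := (Finset.sum_eq_zero_iff_of_nonneg fun k _ => sq_nonneg (NH Ω p k)).1 h1
    rw [hW, zero_mul]
    exact Finset.sum_eq_zero fun j hj => by
      rw [(pow_eq_zero_iff two_ne_zero).1 (h2 j hj), mul_zero]
  have hex := exists_horizontalTangentFrame hn hΩ hp hW
  have hm : meanCurv Ω p = -∑ a, ∑ k, nablaH (hex.choose a p) (hex.choose a) p k * nuH Ω p k := by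
    rw [meanCurv, if_neg fun h => hW h.2, meanCurvNonchar, dif_pos hex]
  obtain ⟨hf1, hf2⟩ := hex.choose_spec
  set f := hex.choose
  obtain ⟨c, hc⟩ := exists_eq_mul_NH hΩ hu hd₁ hD₁ h0 hp
  have hfp := hf2.self_of_nhdsWithin hp
  have hN : ∀ k, NH Ω p k = angle Ω p * nuH Ω p k := fun k => by
    rw [nuH]; field_simp
  have hU : ∀ k, jU z k = c * angle Ω p * nuH Ω p k := fun k => by
    rw [mul_assoc, ← hN]; exact hc k
  have hrel : ∀ a, ∑ k, nablaH (f a p) (f a) p k * jU z k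
      + ∑ k, ∑ j, f a p j * f a p k * jH z j k = 0 := fun a =>
    sum_nablaH_add_sum_jH hΩ hu hd₁ hd₂ hD₁ hD₂ h0 hp (hf1 a) (hf2.mono fun g hg => hg.2 a)
  have hsum := sum_frame_mul hn hW hfp.1 hfp.2
  have htr : ∑ a, ∑ k, ∑ j, f a p j * f a p k * jH z j k
      = ∑ i, jH z i i - ∑ k, ∑ j, nuH Ω p j * nuH Ω p k * jH z j k := by
    rw [Finset.sum_comm]
    have h1 : ∀ k, ∑ a, ∑ j, f a p j * f a p k * jH z j k
        = jH z k k - ∑ j, nuH Ω p j * nuH Ω p k * jH z j k := fun k => by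
      rw [Finset.sum_comm]
      simp only [← Finset.sum_mul, hsum, sub_mul, Finset.sum_sub_distrib]
      simp
    simp only [h1, Finset.sum_sub_distrib]
  have hH : c * angle Ω p * meanCurv Ω p
      = ∑ i, jH z i i - ∑ k, ∑ j, nuH Ω p j * nuH Ω p k * jH z j k := by
    have h1 := Finset.sum_congr (rfl : (Finset.univ : Finset (Fin (2 * n - 1))) = _)
      fun a _ => hrel a
    rw [Finset.sum_add_distrib, htr, Finset.sum_const_zero] at h1
    have h2 : ∑ a, ∑ k, nablaH (f a p) (f a) p k * jU z k
        = -(c * angle Ω p * meanCurv Ω p) := by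
      rw [hm, mul_neg, neg_neg, Finset.mul_sum]
      refine Finset.sum_congr rfl fun a _ => ?_
      rw [Finset.mul_sum]
      exact Finset.sum_congr rfl fun k _ => by rw [hU]; ring
    linarith
  have hν := sum_nuH_sq hW
  have hcomm := sum_comm_mul_mul (U := nuH Ω p)
  have hU2 : ∑ i, jU z i ^ 2 = (c * angle Ω p) ^ 2 := by
    rw [← mul_one ((c * angle Ω p) ^ 2), ← hν, Finset.mul_sum]
    exact Finset.sum_congr rfl fun k _ => by rw [hU]; ring
  have hV : ∑ j, jV z j * NH Ω p j = c * angle Ω p * angle Ω p *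
      ((∑ j, nuH Ω p j * nuH Ω p j) * ∑ i, jH z i i
        - ∑ k, ∑ j, nuH Ω p j * nuH Ω p k * jH z j k
        - (∑ j, ∑ i, comm i j * nuH Ω p i * nuH Ω p j) * jT z) := by
    rw [Finset.sum_mul, Finset.sum_mul, ← Finset.sum_sub_distrib, ← Finset.sum_sub_distrib,
      Finset.mul_sum]
    refine Finset.sum_congr rfl fun j _ => ?_
    rw [jV, hN]
    simp only [hU, sub_mul, mul_sub, Finset.sum_mul, Finset.mul_sum]
    congr 1
    · congr 1
      · exact Finset.sum_congr rfl fun i _ => by ring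
      · exact Finset.sum_congr rfl fun i _ => by ring
    · exact Finset.sum_congr rfl fun i _ => by ring
  rw [hV, hν, hcomm, zero_mul, sub_zero, one_mul, ← hH, hU2]
  ring

end Heisenberg


namespace Heisenberg

variable {n : ℕ}

/-! ### The integrals in terms of jets -/

theorem integrals_eq_integral_jQ {Ω : Set (Heis n)} (hΩ : IsOpen Ω) (hbdd : Bornology.IsBounded Ω)
    {u : Heis n → ℝ} (hu : ContDiffOn ℝ 2 u Ω) {z : Heis n → Jet n}
    (hz : ContinuousOn z (closure Ω)) (hj : ∀ g ∈ Ω, jet u g = z g) :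
    (IntegrableOn (fun g => lapH u g ^ 2) Ω ∧ IntegrableOn (fun g => hessHNormSq u g) Ω ∧
      IntegrableOn (fun g => TD u g ^ 2) Ω) ∧
    (∫ g in Ω, lapH u g ^ 2) - (∫ g in Ω, hessHNormSq u g)
      + 3 / 2 * (n : ℝ) * (∫ g in Ω, TD u g ^ 2) = ∫ g in Ω, jQ (z g) := by
  have hat : ∀ g ∈ Ω, ContDiffAt ℝ 2 u g := fun g hg => hu.contDiffAt (hΩ.mem_nhds hg)
  have key : ∀ {F : Jet n → ℝ} {f : Heis n → ℝ}, Continuous F → (∀ g ∈ Ω, F (jet u g) = f g) →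
      IntegrableOn f Ω := fun {F f} hF hf => by
    have h1 : IntegrableOn (fun g => F (z g)) Ω :=
      ((hF.comp_continuousOn hz).integrableOn_compact hbdd.isCompact_closure).mono_set
        subset_closure
    refine h1.congr_fun (fun g hg => ?_) hΩ.measurableSet
    rw [← hf g hg, hj g hg]
  have h1 : IntegrableOn (fun g => lapH u g ^ 2) Ω :=
    key (F := fun z => (∑ i, jH z i i) ^ 2)
      ((continuous_finsetSum _ fun i _ => continuous_jH i i).pow 2)
      fun g hg => by rw [lapH_eq (hat g hg)]
  have h2 : IntegrableOn (fun g => hessHNormSq u g) Ω :=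
    key (F := fun z => ∑ i, ∑ j, ((jH z i j + jH z j i) / 2) ^ 2)
      (continuous_finsetSum _ fun i _ => continuous_finsetSum _ fun j _ =>
        (((continuous_jH i j).add (continuous_jH j i)).div_const 2).pow 2)
      fun g hg => by rw [hessHNormSq_eq (hat g hg)]
  have h3 : IntegrableOn (fun g => TD u g ^ 2) Ω :=
    key (F := fun z => jT z ^ 2) (continuous_jT.pow 2)
      fun g hg => by rw [(jet_relations (hat g hg)).2.2]
  refine ⟨⟨h1, h2, h3⟩, ?_⟩
  have h12 : Integrable (fun g => lapH u g ^ 2 - hessHNormSq u g) (volume.restrict Ω) := h1.sub h2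
  rw [← integral_const_mul, ← integral_sub h1 h2, ← integral_add h12 (h3.const_mul _)]
  refine setIntegral_congr_fun hΩ.measurableSet fun g hg => ?_
  rw [← hj g hg]
  exact jQ_jet (hat g hg)

/-- Testing the weak identity with a cutoff equal to one near the support of `u` leaves only the
integral of `jQ`: the field vanishes wherever the cutoff varies. -/
theorem integral_jQ_eq_zero {Ω : Set (Heis n)} (hΩ : IsOpen Ω) {u : Heis n → ℝ}
    (hu : ContDiff ℝ 2 u) (hc : HasCompactSupport u) (hs : tsupport u ⊆ Ω) :
    ∫ g in Ω, jQ (jet u g) = 0 := by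
  obtain ⟨χ, hχ, hχc, hχs, hχ1⟩ := exists_contDiff_cutoff hc hΩ hs
  have hjet : ∀ g, g ∉ tsupport u → jet u g = (g, 0, 0) := fun g hg => by
    have h1 : u =ᶠ[𝓝 g] fun _ => 0 := notMem_tsupport_iff_eventuallyEq.1 hg
    have h2 : fderiv ℝ u =ᶠ[𝓝 g] fun _ => 0 := by
      filter_upwards [h1.eventuallyEq_nhds] with g' hg'
      rw [hg'.fderiv_eq, fderiv_fun_const]
      rfl
    rw [jet, h2.fderiv_eq, fderiv_fun_const, h2.eq_of_nhds]
    rfl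
  have hU : ∀ g, g ∉ tsupport u → ∀ i, jU (jet u g) i = 0 := fun g hg i => by
    simp [hjet g hg, jU]
  have hQ : ∀ g, g ∉ tsupport u → jQ (jet u g) = 0 := fun g hg => by
    simp [hjet g hg, jQ, jH, jT]
  rw [setIntegral_eq_integral_of_forall_compl_eq_zero fun g hg => hQ g fun h => hg (hs h),
    ← integral_weakIntegrand hΩ hu.contDiffOn (contDiff_infty.1 hχ 1) hχc hχs]
  congr 1 with g
  by_cases hg : g ∈ tsupport u
  · have h1 : χ =ᶠ[𝓝 g] fun _ => 1 := (eventually_nhdsSet_iff_forall.1 hχ1) g hg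
    have h2 : ∀ j, XD j χ g = 0 := fun j => by
      rw [XD_eq ((contDiff_infty.1 hχ 1).differentiable one_ne_zero g), h1.fderiv_eq]
      simp
    simp [weakIntegrand, h2, h1.eq_of_nhds]
  · simp [weakIntegrand, jV, hU g hg, hQ g hg]

theorem two_mul_det_hessH (u : Heis 1 → ℝ) (g : Heis 1) :
    2 * (hessH u g).det = lapH u g ^ 2 - hessHNormSq u g := by
  rw [← Matrix.det_submatrix_equiv_self (finSumFinEquiv (m := 1) (n := 1)).symm,
    Matrix.det_fin_two]
  have h0 : (finSumFinEquiv (m := 1) (n := 1)).symm 0 = Sum.inl 0 := rfl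
  have h1 : (finSumFinEquiv (m := 1) (n := 1)).symm 1 = Sum.inr 0 := rfl
  simp only [Matrix.submatrix_apply, h0, h1, hessHNormSq, lapH, hessH, Matrix.of_apply,
    Fintype.sum_sum_type, Fin.sum_univ_one]
  ring

/-! ### The boundary integral -/

theorem ae_mem_frontier (Ω : Set (Heis n)) :
    ∀ᵐ g ∂surfaceMeasure (frontier Ω), g ∈ frontier Ω := by
  have := ae_restrict_mem (μ := surfaceMeasure (frontier Ω))
    (isClosed_frontier (s := Ω)).measurableSet
  rwa [surfaceMeasure_restrict isClosed_frontier.measurableSet] at this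

theorem aemeasurable_angle {Ω : Set (Heis n)} (hΩ : IsC2Open Ω) :
    AEMeasurable (fun g => ENNReal.ofReal (angle Ω g)) (surfaceMeasure (frontier Ω)) :=
  (aestronglyMeasurable_surfaceMeasure (Real.continuous_sqrt.comp_continuousOn
    (continuousOn_finsetSum _ fun j _ => (continuousOn_NH hΩ j).pow 2))).aemeasurable.ennreal_ofReal

theorem integrable_perimeterMeasure_iff {Ω : Set (Heis n)} (hΩ : IsC2Open Ω) {f : Heis n → ℝ} :
    Integrable f (perimeterMeasure Ω)
      ↔ Integrable (fun g => angle Ω g * f g) (surfaceMeasure (frontier Ω)) := by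
  rw [perimeterMeasure, integrable_withDensity_iff_integrable_smul₀' (aemeasurable_angle hΩ)
    (Filter.Eventually.of_forall fun _ => ENNReal.ofReal_lt_top)]
  simp only [ENNReal.toReal_ofReal (Real.sqrt_nonneg _), angle, smul_eq_mul]

theorem integral_perimeterMeasure {Ω : Set (Heis n)} (hΩ : IsC2Open Ω) (f : Heis n → ℝ) :
    ∫ g, f g ∂(perimeterMeasure Ω) = ∫ g, angle Ω g * f g ∂(surfaceMeasure (frontier Ω)) := by
  rw [perimeterMeasure, integral_withDensity_eq_integral_toReal_smul₀ (aemeasurable_angle hΩ)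
    (Filter.Eventually.of_forall fun _ => ENNReal.ofReal_lt_top)]
  simp only [ENNReal.toReal_ofReal (Real.sqrt_nonneg _), angle, smul_eq_mul]

/-- The boundary values of `X_i u`, defined as limits from inside, are read off from the continuous
extension of the jet. -/
theorem gradHNormSq_eq {Ω : Set (Heis n)} {u : Heis n → ℝ} {z : Heis n → Jet n}
    (hz : ContinuousOn z (closure Ω)) (hu : ∀ g ∈ Ω, ∀ i, XD i u g = jU (z g) i) {p : Heis n}
    (hp : p ∈ closure Ω) : gradHNormSq Ω u p = ∑ i, jU (z p) i ^ 2 := by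
  refine Finset.sum_congr rfl fun i _ => ?_
  rw [extendFrom_eq (y := jU (z p) i) hp]
  have h1 := (((continuous_jU i).comp_continuousOn hz) p hp).mono subset_closure
  refine h1.tendsto.congr' ?_
  filter_upwards [self_mem_nhdsWithin] with g hg using (hu g hg i).symm

theorem integral_meanCurv_mul_gradHNormSq_nonneg {Ω : Set (Heis n)} (hΩ : IsC2Open Ω)
    (u : Heis n → ℝ) (hH : ∀ g ∈ frontier Ω \ charSet Ω, 0 ≤ meanCurv Ω g) :
    0 ≤ ∫ g, meanCurv Ω g * gradHNormSq Ω u g ∂(perimeterMeasure Ω) := by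
  rw [integral_perimeterMeasure hΩ]
  refine integral_nonneg_of_ae ?_
  filter_upwards [ae_mem_frontier Ω] with g hg
  change 0 ≤ angle Ω g * (meanCurv Ω g * gradHNormSq Ω u g)
  -- The weight `W` removes the characteristic points, where no sign of the curvature is known.
  by_cases hW : angle Ω g = 0
  · rw [hW, zero_mul]
  · exact mul_nonneg (Real.sqrt_nonneg _) (mul_nonneg (hH g ⟨hg, fun h => hW h.2⟩)
      (Finset.sum_nonneg fun _ _ => sq_nonneg _))

/-- The integral identity for functions that vanish on the boundary. -/
theorem integral_jQ_eq_boundary (hn : 1 ≤ n) {Ω : Set (Heis n)} (hΩ : IsC2Open Ω)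
    (hbdd : Bornology.IsBounded Ω) {u : Heis n → ℝ} (hc : ContinuousOn u (closure Ω))
    (hu : ContDiffOn ℝ 2 u Ω) (h0 : ∀ g ∈ frontier Ω, u g = 0)
    {D₁ : Heis n → Heis n →L[ℝ] ℝ} {D₂ : Heis n → Heis n →L[ℝ] Heis n →L[ℝ] ℝ}
    (hD₁ : ContinuousOn D₁ (closure Ω)) (hD₂ : ContinuousOn D₂ (closure Ω))
    (hj : ∀ g ∈ Ω, fderiv ℝ u g = D₁ g ∧ fderiv ℝ (fderiv ℝ u) g = D₂ g) :
    Integrable (fun g => meanCurv Ω g * gradHNormSq Ω u g) (perimeterMeasure Ω) ∧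
    ∫ g in Ω, jQ (g, D₁ g, D₂ g)
      = ∫ g, meanCurv Ω g * gradHNormSq Ω u g ∂(perimeterMeasure Ω) := by
  set z : Heis n → Jet n := fun g => (g, D₁ g, D₂ g) with hzdef
  have hz : ContinuousOn z (closure Ω) := continuousOn_id.prodMk (hD₁.prodMk hD₂)
  have hat : ∀ g ∈ Ω, ContDiffAt ℝ 2 u g := fun g hg => hu.contDiffAt (hΩ.1.mem_nhds hg)
  have hjz : ∀ g ∈ Ω, jet u g = z g := fun g hg => by
    rw [jet, (hj g hg).1, (hj g hg).2]
  have hd₁ : ∀ g ∈ Ω, HasFDerivAt u (D₁ g) g := fun g hg => by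
    rw [← (hj g hg).1]
    exact ((hat g hg).differentiableAt (by simp)).hasFDerivAt
  have hd₂ : ∀ g ∈ Ω, HasFDerivAt D₁ (D₂ g) g := fun g hg => by
    rw [← (hj g hg).2]
    refine (hasFDerivAt_fderiv (hat g hg)).congr_of_eventuallyEq ?_
    filter_upwards [hΩ.1.mem_nhds hg] with g' hg' using (hj g' hg').1.symm
  obtain ⟨hint, heq⟩ := divergence_theorem hΩ hbdd (q := fun g => jQ (z g))
    (V := fun j g => jV (z g) j) (continuous_jQ.comp_continuousOn hz)
    (fun j => (continuous_jV j).comp_continuousOn hz) fun φ hφ hφc hφs => by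
      rw [← integral_weakIntegrand hΩ.1 hu hφ hφc hφs]
      congr 1 with g
      change weakIntegrand φ z g = _
      by_cases hg : g ∈ tsupport φ
      · simp only [weakIntegrand, hjz g (hφs hg)]
      · rw [weakIntegrand_eq_zero hg, weakIntegrand_eq_zero hg]
  have hae : (fun g => ∑ j, jV (z g) j * NH Ω g j) =ᵐ[surfaceMeasure (frontier Ω)]
      fun g => angle Ω g * (meanCurv Ω g * gradHNormSq Ω u g) := by
    filter_upwards [ae_mem_frontier Ω] with g hg
    rw [gradHNormSq_eq hz (fun g hg i => by rw [← hjz g hg]; exact (jet_relations (hat g hg)).1 i)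
      (frontier_subset_closure hg)]
    exact sum_jV_mul_NH hn hΩ hc hd₁ hd₂ hD₁ hD₂ h0 hg
  exact ⟨(integrable_perimeterMeasure_iff hΩ).2 (hint.congr hae), by
    rw [integral_perimeterMeasure hΩ, ← integral_congr_ae hae]; exact heq⟩

end Heisenberg
end

/-! ### The identities and the inequality. -/

theorem corollaryC (n : ℕ) (hn : 1 ≤ n) (Ω : Set (Heis n))
    (hΩ : IsC2Open Ω) (hbdd : Bornology.IsBounded Ω) :
    (∀ u : Heis n → ℝ, MemGamma Ω 3 u → MemC2Closure Ω u →
      (∀ g ∈ Ω, u g ≤ 0) → (∀ g ∈ frontier Ω, u g = 0) →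
      (IntegrableOn (fun g => lapH u g ^ 2) Ω ∧
        IntegrableOn (fun g => hessHNormSq u g) Ω ∧
        IntegrableOn (fun g => TD u g ^ 2) Ω ∧
        Integrable (fun g => meanCurv Ω g * gradHNormSq Ω u g) (perimeterMeasure Ω)) ∧
      ((∫ g in Ω, lapH u g ^ 2) - (∫ g in Ω, hessHNormSq u g)
          + 3 / 2 * (n : ℝ) * (∫ g in Ω, TD u g ^ 2)
        = ∫ g, meanCurv Ω g * gradHNormSq Ω u g ∂(perimeterMeasure Ω)) ∧
      ((∀ g ∈ frontier Ω \ charSet Ω, 0 ≤ meanCurv Ω g) →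
        (∫ g in Ω, hessHNormSq u g)
          ≤ (∫ g in Ω, lapH u g ^ 2) + 3 / 2 * (n : ℝ) * (∫ g in Ω, TD u g ^ 2)) ∧
      (n = 1 →
        IntegrableOn (fun g => (hessH u g).det) Ω ∧
        (∫ g in Ω, (hessH u g).det) + 3 / 4 * (∫ g in Ω, TD u g ^ 2)
          = 1 / 2 * ∫ g, meanCurv Ω g * gradHNormSq Ω u g ∂(perimeterMeasure Ω))) ∧
    (∀ u : Heis n → ℝ, ContDiff ℝ (⊤ : ℕ∞) u → HasCompactSupport u → tsupport u ⊆ Ω →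
      (IntegrableOn (fun g => lapH u g ^ 2) Ω ∧
        IntegrableOn (fun g => hessHNormSq u g) Ω ∧
        IntegrableOn (fun g => TD u g ^ 2) Ω) ∧
      (∫ g in Ω, hessHNormSq u g)
        = (∫ g in Ω, lapH u g ^ 2) + 3 / 2 * (n : ℝ) * (∫ g in Ω, TD u g ^ 2)) := by
  refine ⟨fun u _ hu _ h0 => ?_, fun u hu hc hs => ?_⟩
  · obtain ⟨D₁, D₂, hD₁, hD₂, hj⟩ := hu.exists_extension
    have hz : ContinuousOn (fun g => ((g, D₁ g, D₂ g) : Jet n)) (closure Ω) :=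
      continuousOn_id.prodMk (hD₁.prodMk hD₂)
    obtain ⟨⟨h1, h2, h3⟩, heq⟩ := integrals_eq_integral_jQ hΩ.1 hbdd hu.2.1 hz fun g hg => by
      rw [jet, (hj g hg).1, (hj g hg).2]
    obtain ⟨h4, hbd⟩ := integral_jQ_eq_boundary hn hΩ hbdd hu.1 hu.2.1 h0 hD₁ hD₂ hj
    rw [hbd] at heq
    refine ⟨⟨h1, h2, h3, h4⟩, heq, fun hH => ?_, fun hn1 => ?_⟩
    · have := integral_meanCurv_mul_gradHNormSq_nonneg hΩ u hH
      linarith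
    · subst hn1
      have hdet : (fun g => (hessH u g).det)
          = fun g => 1 / 2 * (lapH u g ^ 2 - hessHNormSq u g) := funext fun g => by
        rw [← two_mul_det_hessH]
        ring
      have h12 : Integrable (fun g => lapH u g ^ 2 - hessHNormSq u g) (volume.restrict Ω) :=
        h1.sub h2
      rw [hdet, ← heq, integral_const_mul, integral_sub h1 h2]
      refine ⟨h12.const_mul _, ?_⟩
      push_cast
      ring
  · have hu2 : ContDiff ℝ 2 u := contDiff_infty.1 hu 2
    obtain ⟨hint, heq⟩ := integrals_eq_integral_jQ hΩ.1 hbdd hu2.contDiffOn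
      (continuous_jet hu2).continuousOn fun g _ => rfl
    rw [integral_jQ_eq_zero hΩ.1 hu2 hc hs] at heq
    exact ⟨hint, by linarith⟩
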